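/- For groups $\Gamma,\Lambda$ (all groups are discrete) let $\Gamma\wr\Lambda=\left(\bigoplus_{\Lambda}\Gamma\right)\rtimes\Lambda$ be the (restricted) wreath product, where $\Lambda$ acts on $\bigoplus_\Lambda\Gamma$ by left shifts, and identify $\Lambda$ with $\{(e,h):h\in\Lambda\}\subset\Gamma\wr\Lambda$. For an ordinal $\alpha$ and a family of groups $(\Gamma_\beta)_{\beta<\alpha}$, define an increasing family of groups $(G_\beta)_{\beta\le\alpha}$ by transfinite recursion: $G_0=\{e\}$, $G_{\beta+1}=\Gamma_\beta\wr G_\beta$, and $G_\beta=\bigcup_{\gamma<\beta}G_\gamma$ for limit ordinals $\beta$. The group $G=G_\alpha$ is called the iterated wreath product of $(\Gamma_\beta)_{\beta<\alpha}$. A von Neumann algebra $M$ is called prime if, whenever $M$ is isomorphic to a von Neumann algebra tensor product $M_1\mathbin{\overline{\otimes}}M_2$, one of $M_1,M_2$ is of type I. A $*$-subalgebra $A\subset M$ (not assumed to be unital or closed) is called regular if $\{u\in U(M): uAu^*=A\}''=M$. Proposition 5.1. Let $\alpha$ be a limit ordinal of uncountable cofinality, let $(\Gamma_\beta)_{\beta<\alpha}$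 be a family of non-trivial torsion-free groups, and let $G$ be its iterated wreath product. Then the group von Neumann algebra $L(G)$ is a type II$_1$ factor, it is prime, and it has no infinite dimensional regular abelian $*$-subalgebra. -/

import Mathlib

noncomputable section

/-! ### Wreath products -/

/-- The (restricted) wreath product `Γ ≀ Λ = (⨁_Λ Γ) ⋊ Λ`: the pairs `(b, h)` with `b : Λ → Γ`
finitely supported and `h ∈ Λ`, with `(b, h)(b', h') = (b · b'(h⁻¹ ·), hh')`, as a subgroup of the
unrestricted regular wreath product. -/
def wreathProduct (Γ Λ : Type*) [Group Γ] [Group Λ] : Subgroup (RegularWreathProduct Γ Λ) where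
  carrier := {a | (Function.mulSupport a.left).Finite}
  one_mem' := by simp
  mul_mem' {a b} ha hb := by
    refine (ha.union (hb.image fun x => a.right * x)).subset fun x hx => ?_
    by_contra hc
    simp only [Set.mem_union, Function.mem_mulSupport, Set.mem_image, not_or, not_not,
      not_exists, not_and] at hc
    refine hx ?_
    have h2 : b.left (a.right⁻¹ * x) = 1 := by
      by_contra h
      exact hc.2 _ h (by simp)
    simp [hc.1, h2]
  inv_mem' {a} ha := by
    refine (ha.image fun x => a.right⁻¹ * x).subset fun x hx => ?_
    refine ⟨a.right * x, ?_, by simp⟩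
    intro h
    exact hx (by simp [h])

namespace wreathProduct

variable {Γ Λ : Type*} [Group Γ] [Group Λ]

/-- The canonical embedding `h ↦ (e, h)` of `Λ` into `Γ ≀ Λ`. -/
def ofRight : Λ →* wreathProduct Γ Λ :=
  (RegularWreathProduct.inl : Λ →* RegularWreathProduct Γ Λ).codRestrict _ fun h => by
    change (Function.mulSupport (1 : Λ → Γ)).Finite
    simp

open Classical in
/-- The embedding of `Γ` into `Γ ≀ Λ` as the direct summand at the unit of `Λ`. -/
def ofBase : Γ →* wreathProduct Γ Λ where
  toFun x := ⟨⟨Pi.mulSingle 1 x, 1⟩,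
    (Set.finite_singleton (1 : Λ)).subset Pi.mulSupport_mulSingle_subset⟩
  map_one' := by
    apply Subtype.ext
    ext <;> simp
  map_mul' x y := by
    apply Subtype.ext
    ext q
    · simp [Pi.mulSingle_mul]
    · simp

/-- The quotient map `Γ ≀ Λ → Λ`. -/
def toRight : wreathProduct Γ Λ →* Λ :=
  (RegularWreathProduct.rightHom : RegularWreathProduct Γ Λ →* Λ).comp (Subgroup.subtype _)

theorem toRight_ofRight (h : Λ) : toRight (ofRight h : wreathProduct Γ Λ) = h := rfl

theorem toRight_ofBase (x : Γ) : toRight (ofBase x : wreathProduct Γ Λ) = 1 := rfl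

theorem ofRight_injective : Function.Injective (ofRight : Λ →* wreathProduct Γ Λ) :=
  Function.LeftInverse.injective toRight_ofRight

/-- `Γ ≀ Λ` is generated by `Γ` (at the unit) and `Λ`. -/
theorem eq_top_of_le {S : Subgroup (wreathProduct Γ Λ)} (hr : ∀ h, ofRight h ∈ S)
    (hb : ∀ x, ofBase x ∈ S) : S = ⊤ := by
  classical
  rw [eq_top_iff]
  rintro ⟨⟨b, h⟩, hbf⟩ -
  change (Function.mulSupport b).Finite at hbf
  -- the base group is generated by translates of the summand at the unit
  have key : ∀ (F : Finset Λ) (b : Λ → Γ) (hbf : (Function.mulSupport b).Finite),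
      Function.mulSupport b ⊆ F →
      (⟨⟨b, 1⟩, hbf⟩ : wreathProduct Γ Λ) ∈ S := by
    intro F
    induction F using Finset.induction_on with
    | empty =>
      intro b hbf hb0
      have : b = 1 := by
        rw [← Function.mulSupport_eq_empty_iff]
        simpa using hb0
      subst this
      exact S.one_mem
    | insert q F hq ih =>
      intro b hbf hbF
      have h1 : (Function.mulSupport (Function.update b q 1)).Finite := by
        refine hbf.subset fun x hx => ?_
        rcases eq_or_ne x q with rfl | hxq
        · simp at hx
        · simpa [hxq] using hx
      have h2 : Function.mulSupport (Function.update b q 1) ⊆ F := by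
        intro x hx
        rcases eq_or_ne x q with rfl | hxq
        · simp at hx
        · have : x ∈ (insert q F : Finset Λ) := by
            exact_mod_cast hbF (show b x ≠ 1 by simpa [hxq] using hx)
          simpa [hxq] using this
      have h3 := S.mul_mem (S.mul_mem (S.mul_mem (hr q) (hb (b q))) (S.inv_mem (hr q)))
        (ih _ h1 h2)
      convert h3 using 1
      apply Subtype.ext
      ext x
      · change b x = _
        rcases eq_or_ne x q with rfl | hxq
        · simp [ofRight, ofBase]
        · have : q⁻¹ * x ≠ 1 := by
            intro h
            exact hxq (by rw [inv_mul_eq_one] at h; exact h.symm)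
          simp [ofRight, ofBase, hxq, this]
      · simp [ofRight, ofBase]
  have h4 := S.mul_mem (key hbf.toFinset b hbf (by simp)) (hr h)
  convert h4 using 1
  apply Subtype.ext
  ext x
  · simp [ofRight]
  · simp [ofRight]

end wreathProduct

/-! ### Iterated wreath products -/

namespace IteratedWreath

open Monoid

universe u v

section Construction

variable {α : Ordinal.{u}} (Γ : Set.Iio α → Type v) [∀ β, Group (Γ β)]

/-- For a quotient `F ⧸ N` of the free product `F` of all `Γ_β`, the homomorphism from `F` to
`Γ_γ ≀ (F ⧸ N)` that embeds `Γ_γ` as the summand at the unit, sends each `Γ_β` with `β < γ` to its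
image in `F ⧸ N`, and kills each `Γ_β` with `β > γ`. -/
def stepHom (γ : Set.Iio α) (N : Subgroup (CoprodI Γ)) [N.Normal] :
    CoprodI Γ →* wreathProduct (Γ γ) (CoprodI Γ ⧸ N) :=
  CoprodI.lift fun β =>
    if h : β = γ then h.symm ▸ (wreathProduct.ofBase : Γ γ →* wreathProduct (Γ γ) (CoprodI Γ ⧸ N))
    else if β < γ then wreathProduct.ofRight.comp ((QuotientGroup.mk' N).comp CoprodI.of)
    else 1

/-- The normal subgroup `N_β` of the free product `F` with `F ⧸ N_β = G_β`. By recursion, `N_β` is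
the intersection of the kernels of the homomorphisms `F → Γ_γ ≀ (F ⧸ N_γ) = Γ_γ ≀ G_γ = G_{γ+1}`
over `γ < β`. -/
def relations (β : Ordinal.{u}) : {N : Subgroup (CoprodI Γ) // N.Normal} :=
  ⟨⨅ γ : {γ : Set.Iio α // γ.1 < β},
      haveI := (relations γ.1.1).2
      (stepHom Γ γ.1 (relations γ.1.1).1).ker,
    Subgroup.normal_iInf_normal fun γ =>
      haveI := (relations γ.1.1).2
      inferInstance⟩
termination_by β
decreasing_by all_goals exact γ.2

instance relations_normal (β : Ordinal.{u}) : (relations Γ β).1.Normal := (relations Γ β).2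

/-- The homomorphism `F → Γ_γ ≀ G_γ`. -/
def step (γ : Set.Iio α) :
    CoprodI Γ →* wreathProduct (Γ γ) (CoprodI Γ ⧸ (relations Γ γ.1).1) :=
  stepHom Γ γ (relations Γ γ.1).1

theorem mem_relations {β : Ordinal.{u}} {w : CoprodI Γ} :
    w ∈ (relations Γ β).1 ↔ ∀ γ : Set.Iio α, γ.1 < β → step Γ γ w = 1 := by
  rw [relations, Subgroup.mem_iInf]
  exact ⟨fun h γ hγ => h ⟨γ, hγ⟩, fun h γ => h γ.1 γ.2⟩

theorem step_of_self (γ : Set.Iio α) (x : Γ γ) :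
    step Γ γ (CoprodI.of x) = wreathProduct.ofBase x := by
  simp [step, stepHom]

theorem step_of_lt {β γ : Set.Iio α} (h : β < γ) (x : Γ β) :
    step Γ γ (CoprodI.of x) =
      wreathProduct.ofRight (QuotientGroup.mk' (relations Γ γ.1).1 (CoprodI.of x)) := by
  simp [step, stepHom, h, h.ne]

theorem step_of_gt {β γ : Set.Iio α} (h : γ < β) (x : Γ β) :
    step Γ γ (CoprodI.of x) = 1 := by
  simp [step, stepHom, h.ne', h.not_gt]

/-- The subgroup of the free product generated by the `Γ_γ` with `γ < β`. -/
def freeStage (β : Ordinal.{u}) : Subgroup (CoprodI Γ) :=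
  Subgroup.closure {w | ∃ γ : Set.Iio α, γ.1 < β ∧ ∃ x : Γ γ, w = CoprodI.of x}

theorem of_mem_relations {β : Ordinal.{u}} {γ : Set.Iio α} (h : β ≤ γ.1) (x : Γ γ) :
    (CoprodI.of x : CoprodI Γ) ∈ (relations Γ β).1 :=
  (mem_relations Γ).2 fun _ hδ => step_of_gt Γ (show _ < γ from Subtype.coe_lt_coe.1 (hδ.trans_le h)) x

theorem step_of_mem_freeStage {β : Ordinal.{u}} {γ : Set.Iio α} (h : β ≤ γ.1) {w : CoprodI Γ}
    (hw : w ∈ freeStage Γ β) :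
    step Γ γ w = wreathProduct.ofRight (QuotientGroup.mk' (relations Γ γ.1).1 w) := by
  induction hw using Subgroup.closure_induction with
  | mem w hw =>
    obtain ⟨δ, hδ, x, rfl⟩ := hw
    exact step_of_lt Γ (Subtype.coe_lt_coe.1 (hδ.trans_le h)) x
  | one => simp
  | mul a b _ _ ha hb => simp only [map_mul, ha, hb]
  | inv a _ ha => simp only [map_inv, ha]

theorem relations_anti {β β' : Ordinal.{u}} (h : β ≤ β') :
    (relations Γ β').1 ≤ (relations Γ β).1 := fun _ hw =>
  (mem_relations Γ).2 fun γ hγ => (mem_relations Γ).1 hw γ (hγ.trans_le h)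

/-- On words in the `Γ_γ`, `γ < β`, the relations of all later stages are those of stage `β`. -/
theorem mem_relations_of_le {β : Ordinal.{u}} {w : CoprodI Γ} (hw : w ∈ freeStage Γ β)
    (h : w ∈ (relations Γ β).1) (β' : Ordinal.{u}) : w ∈ (relations Γ β').1 := by
  induction β' using WellFoundedLT.induction with
  | ind β' ih =>
    refine (mem_relations Γ).2 fun γ hγ => ?_
    rcases lt_or_ge γ.1 β with hlt | hle
    · exact (mem_relations Γ).1 h γ hlt
    · rw [step_of_mem_freeStage Γ hle hw]
      have : QuotientGroup.mk' (relations Γ γ.1).1 w = 1 :=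
        (QuotientGroup.eq_one_iff w).2 (ih _ hγ)
      rw [this, map_one]

theorem toRight_step (γ : Set.Iio α) (w : CoprodI Γ) :
    wreathProduct.toRight (step Γ γ w) = QuotientGroup.mk' (relations Γ γ.1).1 w := by
  have : wreathProduct.toRight.comp (step Γ γ) = QuotientGroup.mk' (relations Γ γ.1).1 := by
    refine CoprodI.ext_hom _ _ fun β => MonoidHom.ext fun x => ?_
    change wreathProduct.toRight (step Γ γ (CoprodI.of x)) =
      QuotientGroup.mk' (relations Γ γ.1).1 (CoprodI.of x)
    rcases lt_trichotomy β γ with h | rfl | h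
    · rw [step_of_lt Γ h, wreathProduct.toRight_ofRight]
    · rw [step_of_self, wreathProduct.toRight_ofBase]
      exact ((QuotientGroup.eq_one_iff _).2 (of_mem_relations Γ le_rfl x)).symm
    · rw [step_of_gt Γ h, map_one]
      exact ((QuotientGroup.eq_one_iff _).2 (of_mem_relations Γ h.le x)).symm
  exact DFunLike.congr_fun this w

end Construction

end IteratedWreath

/-- The iterated wreath product `G = G_α` of a family of groups `(Γ_β)_{β < α}`. It is realized as a
quotient of the free product of the `Γ_β`; the theorems `stage_zero`, `stage_succ`, `stage_limit`
and `stage_top` below show that it is the union of the increasing family of groups `G_0 = {e}`,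
`G_{β+1} = Γ_β ≀ G_β`, `G_β = ⋃_{γ < β} G_γ` for limit ordinals `β`. -/
def IteratedWreath.{u, v} {α : Ordinal.{u}} (Γ : Set.Iio α → Type v) [∀ β, Group (Γ β)] :
    Type (max (u + 1) v) :=
  Monoid.CoprodI Γ ⧸ (IteratedWreath.relations Γ α).1

namespace IteratedWreath

open Monoid

universe u v

variable {α : Ordinal.{u}} (Γ : Set.Iio α → Type v) [∀ β, Group (Γ β)]

instance instGroup : Group (IteratedWreath Γ) :=
  inferInstanceAs (Group (CoprodI Γ ⧸ (relations Γ α).1))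

/-- The canonical map from the free product onto `G`. -/
def proj : CoprodI Γ →* IteratedWreath Γ := QuotientGroup.mk' (relations Γ α).1

theorem proj_surjective : Function.Surjective (proj Γ) := QuotientGroup.mk'_surjective _

theorem proj_eq_one {w : CoprodI Γ} : proj Γ w = 1 ↔ w ∈ (relations Γ α).1 :=
  QuotientGroup.eq_one_iff w

/-- The canonical homomorphism `Γ_β → G`. -/
def of (β : Set.Iio α) : Γ β →* IteratedWreath Γ := (proj Γ).comp CoprodI.of

/-- The subgroup `G_β` of `G`, generated by the `Γ_γ` with `γ < β`. -/
def stage (β : Ordinal.{u}) : Subgroup (IteratedWreath Γ) :=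
  ⨆ γ : {γ : Set.Iio α // γ.1 < β}, (of Γ γ.1).range

theorem of_mem_stage {β : Ordinal.{u}} {γ : Set.Iio α} (h : γ.1 < β) (x : Γ γ) :
    of Γ γ x ∈ stage Γ β :=
  (le_iSup (fun γ : {γ : Set.Iio α // γ.1 < β} => (of Γ γ.1).range) ⟨γ, h⟩) ⟨x, rfl⟩

theorem stage_eq_map (β : Ordinal.{u}) : stage Γ β = (freeStage Γ β).map (proj Γ) := by
  apply le_antisymm
  · refine iSup_le fun γ => ?_
    rintro _ ⟨x, rfl⟩
    exact ⟨CoprodI.of x, Subgroup.subset_closure ⟨γ.1, γ.2, x, rfl⟩, rfl⟩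
  · rw [Subgroup.map_le_iff_le_comap, freeStage, Subgroup.closure_le]
    rintro _ ⟨γ, hγ, x, rfl⟩
    exact of_mem_stage Γ hγ x

theorem stage_mono : Monotone (stage Γ) := fun _ _ h =>
  iSup_le fun γ => le_iSup_of_le (⟨γ.1, γ.2.trans_le h⟩ : {γ : Set.Iio α // γ.1 < _}) le_rfl

/-- `G_0` is the trivial group. -/
theorem stage_zero : stage Γ 0 = ⊥ := by
  rw [eq_bot_iff]
  exact iSup_le fun γ => absurd γ.2 (not_lt.2 zero_le)

/-- `G_α = G`. -/
theorem stage_top : stage Γ α = ⊤ := by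
  rw [eq_top_iff]
  intro g _
  obtain ⟨w, rfl⟩ := proj_surjective Γ g
  induction w using CoprodI.induction_on with
  | one => simp
  | of β x => exact of_mem_stage Γ β.2 x
  | mul a b ha hb => rw [map_mul]; exact mul_mem (ha trivial) (hb trivial)

/-- `G_β` is the union of the `G_γ`, `γ < β`, for limit ordinals `β`. -/
theorem stage_limit {β : Ordinal.{u}} (hβ : Order.IsSuccLimit β) :
    (stage Γ β : Set (IteratedWreath Γ)) = ⋃ γ < β, (stage Γ γ : Set (IteratedWreath Γ)) := by
  apply Set.Subset.antisymm
  · have h0 : (0 : Ordinal.{u}) < β := by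
      have := hβ.ne_bot
      exact pos_iff_ne_zero.2 (by simpa using this)
    have : Nonempty (Set.Iio β) := ⟨⟨0, h0⟩⟩
    have hd : Directed (· ≤ ·) fun γ : Set.Iio β => stage Γ γ.1 :=
      Monotone.directed_le fun _ _ h => stage_mono Γ h
    have hle : stage Γ β ≤ ⨆ γ : Set.Iio β, stage Γ γ.1 := by
      refine iSup_le fun γ => ?_
      rintro _ ⟨x, rfl⟩
      exact (le_iSup (fun γ : Set.Iio β => stage Γ γ.1) ⟨Order.succ γ.1.1, hβ.succ_lt γ.2⟩)
        (of_mem_stage Γ (Order.lt_succ _) x)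
    intro g hg
    obtain ⟨γ, hγ⟩ := (Subgroup.mem_iSup_of_directed hd).1 (hle hg)
    exact Set.mem_iUnion₂.2 ⟨γ.1, γ.2, hγ⟩
  · exact Set.iUnion₂_subset fun γ hγ => stage_mono Γ hγ.le

theorem exists_freeStage (β : Ordinal.{u}) (w : CoprodI Γ) :
    ∃ w' ∈ freeStage Γ β, QuotientGroup.mk' (relations Γ β).1 w' =
      QuotientGroup.mk' (relations Γ β).1 w := by
  induction w using CoprodI.induction_on with
  | one => exact ⟨1, one_mem _, rfl⟩
  | of γ x =>
    rcases lt_or_ge γ.1 β with h | h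
    · exact ⟨_, Subgroup.subset_closure ⟨γ, h, x, rfl⟩, rfl⟩
    · refine ⟨1, one_mem _, ?_⟩
      rw [map_one]
      exact ((QuotientGroup.eq_one_iff _).2 (of_mem_relations Γ h x)).symm
  | mul a b ha hb =>
    obtain ⟨a', ha', ha⟩ := ha
    obtain ⟨b', hb', hb⟩ := hb
    exact ⟨a' * b', mul_mem ha' hb', by rw [map_mul, map_mul, ha, hb]⟩

/-- The retraction `G → F ⧸ N_β`, for `β ≤ α`. -/
def retract {β : Ordinal.{u}} (h : β ≤ α) :
    IteratedWreath Γ →* CoprodI Γ ⧸ (relations Γ β).1 :=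
  QuotientGroup.lift (relations Γ α).1 (QuotientGroup.mk' (relations Γ β).1) fun w hw =>
    (QuotientGroup.eq_one_iff w).2 (relations_anti Γ h hw)

theorem retract_proj {β : Ordinal.{u}} (h : β ≤ α) (w : CoprodI Γ) :
    retract Γ h (proj Γ w) = QuotientGroup.mk' (relations Γ β).1 w := rfl

/-- The subgroup `G_β` of `G` is isomorphic to `F ⧸ N_β`. -/
def stageEquiv {β : Ordinal.{u}} (h : β ≤ α) :
    stage Γ β ≃* CoprodI Γ ⧸ (relations Γ β).1 :=
  MulEquiv.ofBijective ((retract Γ h).comp (stage Γ β).subtype) (by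
    constructor
    · rw [injective_iff_map_eq_one]
      rintro ⟨g, hg⟩ h1
      have hg' := hg
      rw [stage_eq_map] at hg'
      obtain ⟨w, hw, rfl⟩ := hg'
      have h2 : w ∈ (relations Γ β).1 := (QuotientGroup.eq_one_iff w).1 h1
      exact Subtype.ext ((proj_eq_one Γ).2 (mem_relations_of_le Γ hw h2 α))
    · intro q
      obtain ⟨w, rfl⟩ := QuotientGroup.mk'_surjective _ q
      obtain ⟨w', hw', h1⟩ := exists_freeStage Γ β w
      refine ⟨⟨proj Γ w', ?_⟩, h1⟩
      rw [stage_eq_map]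
      exact ⟨w', hw', rfl⟩)

theorem step_surjective (γ : Set.Iio α) : Function.Surjective (step Γ γ) := by
  rw [← MonoidHom.range_eq_top]
  refine wreathProduct.eq_top_of_le (fun q => ?_) (fun x => ⟨CoprodI.of x, step_of_self Γ γ x⟩)
  obtain ⟨w, rfl⟩ := QuotientGroup.mk'_surjective _ q
  obtain ⟨w', hw', h1⟩ := exists_freeStage Γ γ.1 w
  exact ⟨w', by rw [step_of_mem_freeStage Γ le_rfl hw', h1]⟩

theorem ker_step (γ : Set.Iio α) : (step Γ γ).ker = (relations Γ (Order.succ γ.1)).1 := by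
  ext w
  rw [MonoidHom.mem_ker, mem_relations]
  constructor
  · intro h δ hδ
    rcases (Order.lt_succ_iff.1 hδ).lt_or_eq with h1 | h1
    · have h2 : w ∈ (relations Γ γ.1).1 := by
        rw [← QuotientGroup.eq_one_iff]
        exact (toRight_step Γ γ w).symm.trans (by rw [h, map_one])
      exact (mem_relations Γ).1 h2 δ h1
    · obtain rfl : δ = γ := Subtype.ext h1
      exact h
  · intro h
    exact h γ (Order.lt_succ _)

end IteratedWreath

/-- Functoriality of the wreath product in the acting group. -/
def wreathProduct.congrRight {Γ Λ Λ' : Type*} [Group Γ] [Group Λ] [Group Λ'] (e : Λ ≃* Λ') :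
    wreathProduct Γ Λ ≃* wreathProduct Γ Λ' where
  toFun a := ⟨⟨a.1.left ∘ e.symm, e a.1.right⟩, by
    have h : (Function.mulSupport a.1.left).Finite := a.2
    exact (h.preimage e.symm.injective.injOn : _)⟩
  invFun a := ⟨⟨a.1.left ∘ e, e.symm a.1.right⟩, by
    have h : (Function.mulSupport a.1.left).Finite := a.2
    exact (h.preimage e.injective.injOn : _)⟩
  left_inv a := by
    apply Subtype.ext
    ext <;> simp
  right_inv a := by
    apply Subtype.ext
    ext <;> simp
  map_mul' a b := by
    apply Subtype.ext
    ext <;> simp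

namespace IteratedWreath

open Monoid

universe u v

/-- `G_{β+1} = Γ_β ≀ G_β` for `β < α`, where `G_β ⊆ G_{β+1}` is the canonical copy of `G_β` in the
wreath product, and `Γ_β` is the summand at the unit. -/
theorem stage_succ {α : Ordinal.{u}} (Γ : Set.Iio α → Type v) [∀ β, Group (Γ β)]
    (β : Set.Iio α) :
    ∃ e : stage Γ (Order.succ β.1) ≃* wreathProduct (Γ β) (stage Γ β.1),
      (∀ g : stage Γ β.1,
        e (Subgroup.inclusion (stage_mono Γ (Order.le_succ β.1)) g) = wreathProduct.ofRight g) ∧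
      ∀ x : Γ β, e ⟨of Γ β x, of_mem_stage Γ (Order.lt_succ β.1) x⟩ = wreathProduct.ofBase x := by
  classical
  have hs : Order.succ β.1 ≤ α := Order.succ_le_of_lt β.2
  have hb : β.1 ≤ α := le_of_lt β.2
  let e₂ : CoprodI Γ ⧸ (relations Γ (Order.succ β.1)).1 ≃*
      wreathProduct (Γ β) (CoprodI Γ ⧸ (relations Γ β.1).1) :=
    (QuotientGroup.quotientMulEquivOfEq (ker_step Γ β).symm).trans
      (QuotientGroup.quotientKerEquivOfSurjective _ (step_surjective Γ β))
  have he₂ : ∀ w, e₂ (QuotientGroup.mk' _ w) = step Γ β w := fun w => rfl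
  refine ⟨((stageEquiv Γ hs).trans e₂).trans
    (wreathProduct.congrRight (stageEquiv Γ hb).symm), ?_, ?_⟩
  · rintro ⟨g, hg⟩
    have hg' := hg
    rw [stage_eq_map] at hg'
    obtain ⟨w, hw, rfl⟩ := hg'
    have h1 : stageEquiv Γ hs (Subgroup.inclusion (stage_mono Γ (Order.le_succ β.1))
        ⟨proj Γ w, hg⟩) = QuotientGroup.mk' _ w := rfl
    have h2 : stageEquiv Γ hb ⟨proj Γ w, hg⟩ = QuotientGroup.mk' _ w := rfl
    rw [MulEquiv.trans_apply, MulEquiv.trans_apply, h1, he₂, step_of_mem_freeStage Γ le_rfl hw,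
      ← h2]
    apply Subtype.ext
    ext q
    · rfl
    · change ((stageEquiv Γ hb).symm (stageEquiv Γ hb ⟨proj Γ w, hg⟩) : IteratedWreath Γ) = _
      rw [MulEquiv.symm_apply_apply]
      rfl
  · intro x
    have h1 : stageEquiv Γ hs ⟨of Γ β x, of_mem_stage Γ (Order.lt_succ β.1) x⟩ =
      QuotientGroup.mk' _ (CoprodI.of x) := rfl
    rw [MulEquiv.trans_apply, MulEquiv.trans_apply, h1, he₂, step_of_self]
    apply Subtype.ext
    ext q
    · by_cases hq : q = 1
      · subst hq
        simp [wreathProduct.congrRight, wreathProduct.ofBase]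
      · have : stageEquiv Γ hb q ≠ 1 := by simpa using hq
        simp [wreathProduct.congrRight, wreathProduct.ofBase, hq, this]
    · change (((stageEquiv Γ hb).symm 1 : stage Γ β.1) : IteratedWreath Γ) = _
      rw [map_one]
      rfl

end IteratedWreath
end


noncomputable section

open scoped TensorProduct

/-- The von Neumann algebra `W*(S) = (S ∪ S*)''` generated by a set `S` of bounded operators. -/
def vonNeumannGenerate {H : Type*} [NormedAddCommGroup H] [InnerProductSpace ℂ H] [CompleteSpace H]
    (S : Set (H →L[ℂ] H)) : VonNeumannAlgebra H where
  toStarSubalgebra := StarSubalgebra.centralizer ℂ (StarSubalgebra.centralizer ℂ S : Set (H →L[ℂ] H))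
  centralizer_centralizer' := by
    change Set.centralizer (Set.centralizer
      (StarSubalgebra.centralizer ℂ (StarSubalgebra.centralizer ℂ S : Set (H →L[ℂ] H)) :
        Set (H →L[ℂ] H))) =
      (StarSubalgebra.centralizer ℂ (StarSubalgebra.centralizer ℂ S : Set (H →L[ℂ] H)) :
        Set (H →L[ℂ] H))
    rw [StarSubalgebra.coe_centralizer_centralizer, Set.centralizer_centralizer_centralizer]

theorem coe_vonNeumannGenerate {H : Type*} [NormedAddCommGroup H] [InnerProductSpace ℂ H]
    [CompleteSpace H] (S : Set (H →L[ℂ] H)) :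
    (vonNeumannGenerate S : Set (H →L[ℂ] H)) = (S ∪ star S).centralizer.centralizer :=
  StarSubalgebra.coe_centralizer_centralizer ℂ S

/-! ### Group von Neumann algebras -/

/-- The Hilbert space `ℓ²(G)`. -/
abbrev EllTwo (G : Type*) : Type _ := lp (fun _ : G => ℂ) 2

/-- Left translation `λ_g` on `ℓ²(G)`, `(λ_g ξ)(x) = ξ(g⁻¹ x)`, as a linear isometry. -/
def leftTranslation {G : Type*} [Group G] (g : G) : EllTwo G →ₗᵢ[ℂ] EllTwo G where
  toFun ξ := ⟨fun x => ξ (g⁻¹ * x), by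
    have h := lp.memℓp ξ
    change Memℓp (fun x => ξ (g⁻¹ * x)) 2
    rw [memℓp_gen_iff (by norm_num)] at h ⊢
    exact (Equiv.mulLeft g⁻¹).summable_iff.mpr h⟩
  map_add' _ _ := rfl
  map_smul' _ _ := rfl
  norm_map' ξ := by
    rw [lp.norm_eq_tsum_rpow (by norm_num), lp.norm_eq_tsum_rpow (by norm_num)]
    congr 1
    exact (Equiv.mulLeft g⁻¹).tsum_eq (fun x => ‖ξ x‖ ^ (ENNReal.toReal 2))

theorem leftTranslation_apply {G : Type*} [Group G] (g : G) (ξ : EllTwo G) (x : G) :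
    leftTranslation g ξ x = ξ (g⁻¹ * x) := rfl

/-- The group von Neumann algebra `L(G) = {λ_g : g ∈ G}''` on `ℓ²(G)`. -/
def groupVonNeumannAlgebra (G : Type*) [Group G] : VonNeumannAlgebra (EllTwo G) :=
  vonNeumannGenerate (Set.range fun g : G => (leftTranslation g).toContinuousLinearMap)

/-! ### Tensor products -/

/-- The Hilbert space tensor product. -/
abbrev HilbertTensor (H₁ H₂ : Type*) [NormedAddCommGroup H₁] [InnerProductSpace ℂ H₁]
    [NormedAddCommGroup H₂] [InnerProductSpace ℂ H₂] : Type _ :=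
  UniformSpace.Completion (H₁ ⊗[ℂ] H₂)

/-- The operator `x ⊗ y` on the Hilbert space tensor product: the continuous extension of the
algebraic `x ⊗ y`. -/
def opTensor {H₁ H₂ : Type*} [NormedAddCommGroup H₁] [InnerProductSpace ℂ H₁]
    [NormedAddCommGroup H₂] [InnerProductSpace ℂ H₂] (x : H₁ →L[ℂ] H₁) (y : H₂ →L[ℂ] H₂) :
    HilbertTensor H₁ H₂ →L[ℂ] HilbertTensor H₁ H₂ :=
  (UniformSpace.Completion.toComplL.comp (TensorProduct.mapL x y)).extend
    (UniformSpace.Completion.toComplL : (H₁ ⊗[ℂ] H₂) →L[ℂ] HilbertTensor H₁ H₂)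

theorem opTensor_tmul {H₁ H₂ : Type*} [NormedAddCommGroup H₁] [InnerProductSpace ℂ H₁]
    [NormedAddCommGroup H₂] [InnerProductSpace ℂ H₂] (x : H₁ →L[ℂ] H₁) (y : H₂ →L[ℂ] H₂)
    (ξ : H₁) (η : H₂) :
    opTensor x y ((ξ ⊗ₜ[ℂ] η : H₁ ⊗[ℂ] H₂) : HilbertTensor H₁ H₂) =
      ((x ξ ⊗ₜ[ℂ] y η : H₁ ⊗[ℂ] H₂) : HilbertTensor H₁ H₂) :=
  ContinuousLinearMap.extend_eq _ UniformSpace.Completion.denseRange_coe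
    (UniformSpace.Completion.isUniformInducing_coe _) (ξ ⊗ₜ[ℂ] η)

namespace VonNeumannAlgebra

/-- The von Neumann algebra tensor product `M₁ ⊗̄ M₂`, generated by the operators `x ⊗ y` with
`x ∈ M₁` and `y ∈ M₂`. -/
def tensor {H₁ H₂ : Type*} [NormedAddCommGroup H₁] [InnerProductSpace ℂ H₁] [CompleteSpace H₁]
    [NormedAddCommGroup H₂] [InnerProductSpace ℂ H₂] [CompleteSpace H₂]
    (M₁ : VonNeumannAlgebra H₁) (M₂ : VonNeumannAlgebra H₂) :
    VonNeumannAlgebra (HilbertTensor H₁ H₂) :=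
  vonNeumannGenerate {T | ∃ x ∈ M₁, ∃ y ∈ M₂, T = opTensor x y}

/-! ### Types, factors, primeness -/

variable {H : Type*} [NormedAddCommGroup H] [InnerProductSpace ℂ H] [CompleteSpace H]

/-- A factor: a nonzero von Neumann algebra with centre `ℂ1`. -/
def IsFactor (M : VonNeumannAlgebra H) : Prop :=
  (1 : H →L[ℂ] H) ≠ 0 ∧ ∀ x ∈ M, x ∈ M.commutant → ∃ c : ℂ, x = c • (1 : H →L[ℂ] H)

/-- A nonzero projection `p ∈ M` that is abelian, i.e. the corner `pMp` is commutative. -/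
def IsNonzeroAbelianProjection (M : VonNeumannAlgebra H) (p : H →L[ℂ] H) : Prop :=
  p ∈ M ∧ IsStarProjection p ∧ p ≠ 0 ∧
    ∀ x ∈ M, ∀ y ∈ M, (p * x * p) * (p * y * p) = (p * y * p) * (p * x * p)

/-- Type I: every nonzero central projection `z` majorizes a nonzero abelian projection `p`
(`p ≤ z` is written as `z p = p`). -/
def IsTypeI (M : VonNeumannAlgebra H) : Prop :=
  ∀ z ∈ M, z ∈ M.commutant → IsStarProjection z → z ≠ 0 →
    ∃ p, M.IsNonzeroAbelianProjection p ∧ z * p = p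

/-- Finite: every isometry in `M` is a unitary. -/
def IsFiniteType (M : VonNeumannAlgebra H) : Prop :=
  ∀ v ∈ M, star v * v = 1 → v * star v = 1

/-- Type II₁: finite and without nonzero abelian projections. -/
def IsTypeIIOne (M : VonNeumannAlgebra H) : Prop :=
  M.IsFiniteType ∧ ∀ p, ¬ M.IsNonzeroAbelianProjection p

/-- A type II₁ factor. -/
def IsIIOneFactor (M : VonNeumannAlgebra H) : Prop :=
  M.IsFactor ∧ M.IsTypeIIOne

/-- Prime: whenever `M` is `*`-isomorphic to `M₁ ⊗̄ M₂`, one of `M₁`, `M₂` is of type I. -/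
def IsPrimeAlgebra.{u, w₁, w₂} {H : Type u} [NormedAddCommGroup H] [InnerProductSpace ℂ H]
    [CompleteSpace H] (M : VonNeumannAlgebra H) : Prop :=
  ∀ (H₁ : Type w₁) [NormedAddCommGroup H₁] [InnerProductSpace ℂ H₁] [CompleteSpace H₁]
    (H₂ : Type w₂) [NormedAddCommGroup H₂] [InnerProductSpace ℂ H₂] [CompleteSpace H₂]
    (M₁ : VonNeumannAlgebra H₁) (M₂ : VonNeumannAlgebra H₂),
    Nonempty (M.toStarSubalgebra ≃⋆ₐ[ℂ] (M₁.tensor M₂).toStarSubalgebra) →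
      M₁.IsTypeI ∨ M₂.IsTypeI

/-- The normalizer `𝒩_M(A) = {u ∈ U(M) : u A u* = A}`. -/
def normalizerOf (M : VonNeumannAlgebra H) (A : NonUnitalStarSubalgebra ℂ (H →L[ℂ] H)) :
    Set (H →L[ℂ] H) :=
  {u | u ∈ M ∧ u ∈ unitary (H →L[ℂ] H) ∧
    (fun a => u * a * star u) '' (A : Set (H →L[ℂ] H)) = (A : Set (H →L[ℂ] H))}

/-- A `*`-subalgebra `A` of `M` (not assumed unital or closed) is regular if `𝒩_M(A)'' = M`. -/
def IsRegular (M : VonNeumannAlgebra H) (A : NonUnitalStarSubalgebra ℂ (H →L[ℂ] H)) : Prop :=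
  (M.normalizerOf A).centralizer.centralizer = (M : Set (H →L[ℂ] H))

end VonNeumannAlgebra
end

universe u v w₁ w₂

noncomputable section

/-! ### Projections in von Neumann algebras -/

namespace VonNeumannAlgebra

open scoped ComplexOrder InnerProductSpace
open Filter Topology

variable {K : Type*} [NormedAddCommGroup K] [InnerProductSpace ℂ K] [CompleteSpace K]

/-! Everything about `G` enters through one property, `HasMalnormalHulls`: every countable subset of
`G` lies in a proper malnormal subgroup. Uncountable cofinality puts a countable set into some stage
`G_δ` with `δ < α`, and non-triviality of `Γ_δ` makes that stage proper. It is malnormal because,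
for `g` outside `G_δ` and `h, ghg⁻¹ ∈ G_δ`, the finite nonempty support of the base part of `g` is
invariant under translation by `ghg⁻¹`, so that element has finite order, and `G` is torsion-free
(`isMalnormal_stage`, `eq_one_of_pow_eq_one`).

An element of `L(G)` has countably many nonzero Fourier coefficients. So any sequence in `L(G)` lies
in `L(H)` for a proper malnormal `H`. Malnormality makes `H` mixing: if `u_n ∈ L(H)` are unitaries,
weakly null on `δ₁`, and `x u_n = w_n x` with unitaries `w_n ∈ L(H)`, then `x ∈ L(H)`
(`supportedOn_of_intertwines`). A von Neumann algebra without minimal projections supplies such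
`u_n` (`exists_unitary_tendsto_inner_zero`).

Regular abelian `A`: if `A''` has no minimal projection, take `u_n ∈ A''` and `H` containing them.
Then `A''` commutes with the `u_n`, so it lies in `L(H)`; hence the normalizer does, hence so does
`L(G)`, which is absurd. If `A''` has a minimal projection, its orbit under the normalizer consists
of orthogonal projections of equal trace. The orbit is therefore finite, its sum is central, hence
`1`, and `A` is finite dimensional.

Primeness: if neither tensor factor has a minimal projection, take weakly null unitaries in both and
one `H` for all of them. Each factor commutes with the unitaries of the other, so both lie in
`L(H)`. The isomorphism is only algebraic, and its normality is not invoked to conclude that `L(G)`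
is then contained in `L(H)`; instead, a vector state of `L(G)` is compared with a vector state of
`M₁ ⊗̄ M₂` on a corner (`exists_norm_representation_le`, `not_generates_of_supportedOn`). A factor
with a minimal projection is of type I because the corner of that projection is `ℂp`.

The II₁ factor property comes from direct comparison of Fourier coefficients, using the trace vector
`δ₁` and unique double coset decompositions. -/

theorem smul_mem' (N : VonNeumannAlgebra K) (c : ℂ) {x : K →L[ℂ] K} (hx : x ∈ N) : c • x ∈ N :=
  N.toStarSubalgebra.smul_mem hx c

theorem mem_of_forall_commute {N : VonNeumannAlgebra K} {x : K →L[ℂ] K}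
    (h : ∀ y ∈ N.commutant, Commute x y) : x ∈ N := by
  rw [← N.commutant_commutant, mem_commutant_iff]
  exact fun y hy => (h y hy).eq.symm

theorem commute_of_mem_commutant {N : VonNeumannAlgebra K} {x y : K →L[ℂ] K} (hx : x ∈ N)
    (hy : y ∈ N.commutant) : Commute x y :=
  mem_commutant_iff.1 hy x hx

/-- The projection onto a closed subspace invariant under the commutant lies in the algebra. -/
theorem starProjection_mem (N : VonNeumannAlgebra K) (E : Submodule ℂ K)
    [E.HasOrthogonalProjection] (h : ∀ y ∈ N.commutant, ∀ ξ ∈ E, y ξ ∈ E) :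
    E.starProjection ∈ N := by
  rw [IsStarProjection.mem_iff isStarProjection_starProjection]
  intro y hy
  rw [Submodule.range_starProjection]
  exact fun ξ hξ => h y hy ξ hξ

theorem posPart_mem {N : VonNeumannAlgebra K} {a : K →L[ℂ] K} (ha : a ∈ N) : a⁺ ∈ N :=
  mem_of_forall_commute fun _ hy => (commute_of_mem_commutant ha hy).cfcₙ_real _

theorem sqrt_mem {N : VonNeumannAlgebra K} {a : K →L[ℂ] K} (ha : a ∈ N) : CFC.sqrt a ∈ N :=
  mem_of_forall_commute fun _ hy => (commute_of_mem_commutant ha hy).cfcₙ_nnreal _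

/-- The projection onto the part of the kernel of `b` under `p`. -/
theorem exists_kernel_projection {N : VonNeumannAlgebra K} {b p : K →L[ℂ] K} (hb : b ∈ N)
    (hp : p ∈ N) :
    ∃ q ∈ N, IsStarProjection q ∧ p * q = q ∧ b * q = 0 ∧ ∀ ξ, b ξ = 0 → p ξ = ξ → q ξ = ξ := by
  let E : Submodule ℂ K := LinearMap.ker (b : K →ₗ[ℂ] K) ⊓ LinearMap.ker ((p - 1 : K →L[ℂ] K) : K →ₗ[ℂ] K)
  have hE : IsClosed (E : Set K) := by
    exact (ContinuousLinearMap.isClosed_ker b).inter (ContinuousLinearMap.isClosed_ker (p - 1))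
  have hm : ∀ ξ, ξ ∈ E ↔ b ξ = 0 ∧ p ξ = ξ := fun ξ => by
    simp [E, Submodule.mem_inf, LinearMap.mem_ker, sub_eq_zero]
  have : CompleteSpace E := hE.completeSpace_coe
  refine ⟨E.starProjection, N.starProjection_mem E ?_, isStarProjection_starProjection, ?_, ?_, ?_⟩
  · intro y hy ξ hξ
    rw [hm] at hξ ⊢
    have h1 := DFunLike.congr_fun (commute_of_mem_commutant hb hy).eq ξ
    have h2 := DFunLike.congr_fun (commute_of_mem_commutant hp hy).eq ξ
    simp only [mul_apply_eq_comp, hξ.1, hξ.2, map_zero] at h1 h2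
    exact ⟨h1, h2⟩
  · ext ξ
    exact ((hm _).1 (E.starProjection_apply_mem ξ)).2
  · ext ξ
    exact ((hm _).1 (E.starProjection_apply_mem ξ)).1
  · intro ξ h1 h2
    exact Submodule.starProjection_eq_self_iff.2 ((hm _).2 ⟨h1, h2⟩)

/-- A minimal projection: a nonzero projection of `N` without proper nonzero subprojections. -/
def IsMinimalProjection (N : VonNeumannAlgebra K) (p : K →L[ℂ] K) : Prop :=
  p ∈ N ∧ IsStarProjection p ∧ p ≠ 0 ∧
    ∀ q ∈ N, IsStarProjection q → p * q = q → q = 0 ∨ q = p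

theorem eq_zero_of_mul_self_eq_zero {a : K →L[ℂ] K} (ha : IsSelfAdjoint a) (h : a * a = 0) :
    a = 0 := by
  rw [← CStarRing.star_mul_self_eq_zero_iff, ha.star_eq, h]

/-- By minimality the projection onto `ker b⁺ ∩ pK` is `0` or `p`. If it is `p`, then `b⁺` vanishes
on `pK`. If it is `0`, then `b⁻p`, whose range lies in that space because `b⁺b⁻ = 0`, is zero. -/
theorem IsMinimalProjection.posPart_eq_zero_or {N : VonNeumannAlgebra K} {p : K →L[ℂ] K}
    (hp : N.IsMinimalProjection p) {b : K →L[ℂ] K} (hb : b ∈ N) (hsa : IsSelfAdjoint b)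
    (hpb : p * b = b) : b⁺ = 0 ∨ b⁻ = 0 := by
  have hbp : b * p = b := by
    simpa [hsa.star_eq, hp.2.1.isSelfAdjoint.star_eq] using congrArg star hpb
  have hbs : b⁺ - b⁻ = b := CFC.posPart_sub_negPart b hsa
  have hpos : IsSelfAdjoint b⁺ := .of_nonneg (CFC.posPart_nonneg b)
  have hneg : IsSelfAdjoint b⁻ := .of_nonneg (CFC.negPart_nonneg b)
  obtain ⟨q, hqN, hq, hpq, hbq, hker⟩ := exists_kernel_projection (posPart_mem hb) hp.1
  rcases hp.2.2.2 q hqN hq hpq with rfl | rfl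
  · right
    have hcomm : p * b⁻ = b⁻ * p := by
      have : Commute b p := by rw [commute_iff_eq, hbp, hpb]
      exact (this.cfcₙ_real (·⁻)).eq.symm
    have h0 : b⁻ * p = 0 := by
      ext ξ
      have h1 : p ((b⁻ * p) ξ) = (b⁻ * p) ξ := by
        rw [← mul_apply_eq_comp, ← mul_assoc, hcomm, mul_assoc,
          hp.2.1.isIdempotentElem.eq]
      have h2 : b⁺ ((b⁻ * p) ξ) = 0 := by
        rw [← mul_apply_eq_comp, ← mul_assoc, CFC.posPart_mul_negPart, zero_mul]; rfl
      exact (hker _ h2 h1).symm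
    refine eq_zero_of_mul_self_eq_zero hneg ?_
    have h3 : b⁻ * b = - (b⁻ * b⁻) := by
      nth_rewrite 2 [← hbs]
      rw [mul_sub, CFC.negPart_mul_posPart, zero_sub]
    have h4 : b⁻ * (p * b) = 0 := by rw [← mul_assoc, h0, zero_mul]
    rw [← neg_eq_zero, ← h3, ← h4, hpb]
  · left
    refine eq_zero_of_mul_self_eq_zero hpos ?_
    have h3 : b⁺ * b = b⁺ * b⁺ := by
      nth_rewrite 2 [← hbs]
      rw [mul_sub, CFC.posPart_mul_negPart, sub_zero]
    have h4 : b⁺ * (q * b) = 0 := by rw [← mul_assoc, hbq, zero_mul]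
    rw [← h3, ← h4, hpb]

theorem inner_star_left (a : K →L[ℂ] K) (ξ η : K) : ⟪star a ξ, η⟫_ℂ = ⟪ξ, a η⟫_ℂ :=
  ContinuousLinearMap.adjoint_inner_left a η ξ

theorem inner_star_right (a : K →L[ℂ] K) (ξ η : K) : ⟪ξ, star a η⟫_ℂ = ⟪a ξ, η⟫_ℂ :=
  ContinuousLinearMap.adjoint_inner_right a ξ η

theorem apply_eq_zero_of_nonneg {b : K →L[ℂ] K} (hb : 0 ≤ b) {η : K} (h : ⟪η, b η⟫_ℂ = 0) :
    b η = 0 := by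
  have h1 : CFC.sqrt b * CFC.sqrt b = b := CFC.sqrt_mul_sqrt_self b
  have hs : IsSelfAdjoint (CFC.sqrt b) := .of_nonneg (CFC.sqrt_nonneg b)
  have h2 : CFC.sqrt b η = 0 := by
    rw [← inner_self_eq_zero (𝕜 := ℂ), ← h]
    conv_rhs => rw [← h1]
    rw [mul_apply_eq_comp, ← inner_star_left _ η (CFC.sqrt b η), hs.star_eq]
  rw [← h1, mul_apply_eq_comp, h2, map_zero]

/-- Sign dichotomy replaces the spectral theorem. Subtract from `a` the multiple of `p` that makes
the expectation at some `η ∈ pK` vanish. The difference `b` is semidefinite, so it kills `η`; then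
its kernel projection under `p` is nonzero, hence equal to `p`. -/
theorem IsMinimalProjection.exists_smul_of_isSelfAdjoint {N : VonNeumannAlgebra K}
    {p : K →L[ℂ] K} (hp : N.IsMinimalProjection p) {a : K →L[ℂ] K} (ha : a ∈ N)
    (hsa : IsSelfAdjoint a) (hpa : p * a = a) : ∃ c : ℂ, a = c • p := by
  have hap : a * p = a := by
    simpa [hsa.star_eq, hp.2.1.isSelfAdjoint.star_eq] using congrArg star hpa
  obtain ⟨ξ, hξ⟩ : ∃ ξ, p ξ ≠ 0 := by
    by_contra! h
    exact hp.2.2.1 (ContinuousLinearMap.ext h)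
  have hpp : p * p = p := hp.2.1.isIdempotentElem.eq
  set η := p ξ with hη
  have hpη : p η = η := by rw [hη, ← mul_apply_eq_comp, hpp]
  have hηη : ⟪η, η⟫_ℂ ≠ 0 := by simpa using hξ
  -- The Rayleigh quotient of `a` at `η`. Taking the real part keeps `b` self-adjoint; nothing is
  -- lost, since the quotient is already real.
  set c : ℝ := (⟪η, a η⟫_ℂ / ⟪η, η⟫_ℂ).re with hc
  have hcc : (c : ℂ) = ⟪η, a η⟫_ℂ / ⟪η, η⟫_ℂ := by
    rw [hc]
    apply Complex.conj_eq_iff_re.1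
    rw [map_div₀, inner_conj_symm, inner_conj_symm]
    congr 1
    rw [← inner_star_left a, hsa.star_eq]
  set b := a - (c : ℂ) • p with hb
  have hbN : b ∈ N := sub_mem ha (N.smul_mem' _ hp.1)
  have hbsa : IsSelfAdjoint b := by
    refine hsa.sub ?_
    rw [isSelfAdjoint_iff, star_smul, hp.2.1.isSelfAdjoint.star_eq]
    simp
  have hpb : p * b = b := by rw [hb, mul_sub, hpa, mul_smul_comm, hpp]
  have hinner : ⟪η, b η⟫_ℂ = 0 := by
    rw [hb, sub_apply, smul_apply, hpη, inner_sub_right,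
      inner_smul_right, hcc, div_mul_cancel₀ _ hηη, sub_self]
  have hbη : b η = 0 := by
    rcases hp.posPart_eq_zero_or hbN hbsa hpb with h | h
    · have h1 : b ≤ 0 := (CFC.posPart_eq_zero_iff b hbsa).1 h
      have := apply_eq_zero_of_nonneg (b := -b) (η := η) (by simpa using h1) (by simp [hinner])
      simpa using this
    · exact apply_eq_zero_of_nonneg ((CFC.negPart_eq_zero_iff b hbsa).1 h) hinner
  obtain ⟨q, hqN, hq, hpq, hbq, hker⟩ := exists_kernel_projection hbN hp.1
  have hqη : q η = η := hker η hbη hpη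
  rcases hp.2.2.2 q hqN hq hpq with rfl | rfl
  · exact absurd hqη.symm hξ
  · refine ⟨c, ?_⟩
    rw [hb, sub_mul, hap, smul_mul_assoc, hpp, sub_eq_zero] at hbq
    exact hbq

/-- If `p` is minimal, then `pNp = ℂp`. -/
theorem IsMinimalProjection.exists_smul {N : VonNeumannAlgebra K} {p : K →L[ℂ] K}
    (hp : N.IsMinimalProjection p) {x : K →L[ℂ] K} (hx : x ∈ N) : ∃ c : ℂ, p * x * p = c • p := by
  have hpp : p * p = p := hp.2.1.isIdempotentElem.eq
  have hsp : star p = p := hp.2.1.isSelfAdjoint.star_eq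
  have key : ∀ y ∈ N, IsSelfAdjoint y → ∃ c : ℂ, p * y * p = c • p := fun y hy hsy =>
    hp.exists_smul_of_isSelfAdjoint (mul_mem (mul_mem hp.1 hy) hp.1)
      (by rw [isSelfAdjoint_iff]; simp [hsp, hsy.star_eq, mul_assoc])
      (by rw [← mul_assoc, ← mul_assoc, hpp])
  obtain ⟨c, hc⟩ := key (x + star x) (add_mem hx (star_mem hx)) (.add_star_self x)
  obtain ⟨d, hd⟩ := key (Complex.I • (x - star x))
    (N.smul_mem' _ (sub_mem hx (star_mem hx))) (by
      rw [isSelfAdjoint_iff]; simp only [star_smul, star_sub, star_star, RCLike.star_def, Complex.conj_I]; module)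
  refine ⟨(1 / 2) * (c - Complex.I * d), ?_⟩
  have hx2 : x = (1 / 2 : ℂ) • ((x + star x) - Complex.I • (Complex.I • (x - star x))) := by
    rw [smul_smul, Complex.I_mul_I]
    module
  conv_lhs => rw [hx2]
  rw [mul_smul_comm, smul_mul_assoc, mul_sub, sub_mul, hc, mul_smul_comm, smul_mul_assoc, hd]
  module

/-- The supremum of a chain of projections in a von Neumann algebra. -/
theorem exists_sup_of_isChain (N : VonNeumannAlgebra K) {c : Set (K →L[ℂ] K)}
    (hc : IsChain (· ≤ ·) c) (hne : c.Nonempty) (hN : ∀ p ∈ c, p ∈ N)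
    (hpr : ∀ p ∈ c, IsStarProjection p) :
    ∃ r ∈ N, IsStarProjection r ∧ (∀ p ∈ c, p ≤ r) ∧
      ∀ ξ : K, ∀ ε > 0, ∃ p ∈ c, ‖(r - p) ξ‖ < ε := by
  have : Nonempty c := hne.to_subtype
  choose hU hUeq using fun p : c => isStarProjection_iff_eq_starProjection_range.1 (hpr p.1 p.2)
  let U : c → Submodule ℂ K := fun p => p.1.range
  have hmono : Monotone U := by
    rintro p q hpq _ ⟨ξ, rfl⟩
    have := ((hpr p.1 p.2).le_iff_mul_eq_right (hpr q.1 q.2)).1 hpq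
    exact ⟨p.1 ξ, DFunLike.congr_fun this ξ⟩
  have hdir : IsDirectedOrder c := ⟨fun p q => by
    rcases hc.total p.2 q.2 with h | h
    · exact ⟨q, h, le_rfl⟩
    · exact ⟨p, le_rfl, h⟩⟩
  let E := (⨆ p, U p).topologicalClosure
  have : CompleteSpace E := (Submodule.isClosed_topologicalClosure _).completeSpace_coe
  refine ⟨E.starProjection, N.starProjection_mem E fun y hy => ?_,
    isStarProjection_starProjection, fun p hp => ?_, fun ξ ε hε => ?_⟩
  · have h1 : (⨆ p, U p) ≤ E.comap (y : K →ₗ[ℂ] K) := by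
      refine iSup_le fun p => ?_
      rintro _ ⟨ξ, rfl⟩
      refine Submodule.le_topologicalClosure _ (Submodule.mem_iSup_of_mem p ⟨y ξ, ?_⟩)
      exact DFunLike.congr_fun (commute_of_mem_commutant (hN p.1 p.2) hy).eq ξ
    intro ξ hξ
    exact Submodule.topologicalClosure_minimal _ h1
      ((Submodule.isClosed_topologicalClosure _).preimage y.continuous) hξ
  · rw [(hpr p hp).le_iff_mul_eq_right isStarProjection_starProjection]
    ext ξ
    exact Submodule.starProjection_eq_self_iff.2 (Submodule.le_topologicalClosure _
      (Submodule.mem_iSup_of_mem (⟨p, hp⟩ : c) ⟨ξ, rfl⟩))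
  · have ht := Submodule.starProjection_tendsto_closure_iSup U hmono ξ
    obtain ⟨p, hp⟩ := ((Metric.tendsto_nhds.1 ht) ε hε).exists
    refine ⟨p.1, p.2, ?_⟩
    rw [dist_comm, dist_eq_norm, ← hUeq] at hp
    exact hp

end VonNeumannAlgebra
end

noncomputable section

/-! ### Weakly null sequences of unitaries -/

namespace VonNeumannAlgebra

open scoped ComplexOrder InnerProductSpace
open Filter Topology

variable {K : Type*} [NormedAddCommGroup K] [InnerProductSpace ℂ K] [CompleteSpace K]

theorem norm_sq_add_norm_sq_of_mul_eq_zero {q r : K →L[ℂ] K} (hq : IsStarProjection q)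
    (hqr : q * r = 0) (η : K) : ‖(q + r) η‖ ^ 2 = ‖q η‖ ^ 2 + ‖r η‖ ^ 2 := by
  have h : ⟪q η, r η⟫_ℂ = 0 := by
    rw [← hq.isSelfAdjoint.star_eq, inner_star_left, ← mul_apply_eq_comp, hqr]
    simp
  have := norm_add_sq_eq_norm_sq_add_norm_sq_of_inner_eq_zero (𝕜 := ℂ) _ _ h
  simpa [sq] using this

/-- The projection `p` carries a unitary of `pNp` with small matrix coefficients. -/
def HasSmallUnitary (N : VonNeumannAlgebra K) (ξ : K) (F : Finset K) (ε : ℝ)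
    (p : K →L[ℂ] K) : Prop :=
  ∃ v ∈ N, star v * v = p ∧ v * star v = p ∧ p * v = v ∧
    ∑ η ∈ F, ‖⟪η, v ξ⟫_ℂ‖ ^ 2 ≤ ε * ∑ η ∈ F, ‖p η‖ ^ 2

/-- The unitary is `p` itself, by Cauchy–Schwarz. This is the source of small coefficients:
projections that are small at `ξ` satisfy the estimate for free. -/
theorem hasSmallUnitary_of_norm_le (N : VonNeumannAlgebra K) {ξ : K} (F : Finset K) {ε : ℝ}
    {p : K →L[ℂ] K} (hp : p ∈ N) (hpr : IsStarProjection p) (h : ‖p ξ‖ ^ 2 ≤ ε) :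
    N.HasSmallUnitary ξ F ε p := by
  have hs := hpr.isSelfAdjoint.star_eq
  have hpp : p * p = p := hpr.isIdempotentElem.eq
  refine ⟨p, hp, by rw [hs, hpp], by rw [hs, hpp], hpp, ?_⟩
  rw [Finset.mul_sum]
  refine Finset.sum_le_sum fun η _ => ?_
  have h1 : ⟪η, p ξ⟫_ℂ = ⟪p η, p ξ⟫_ℂ := by
    conv_rhs => rw [← hs, inner_star_left, ← mul_apply_eq_comp, hs, hpp]
  rw [h1]
  calc ‖⟪p η, p ξ⟫_ℂ‖ ^ 2 ≤ (‖p η‖ * ‖p ξ‖) ^ 2 := by gcongr; exact norm_inner_le_norm _ _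
    _ = ‖p ξ‖ ^ 2 * ‖p η‖ ^ 2 := by ring
    _ ≤ ε * ‖p η‖ ^ 2 := by gcongr

/-- Both `v + w` and `v - w` are unitaries of the corner of `q + r`. By the parallelogram law the
mean of their two sums of squares is the sum of those of `v` and `w`, so one sign is good enough.
The bound is weighted by `‖pη‖²` so that it is additive over orthogonal projections and no constant
is lost. -/
theorem HasSmallUnitary.add {N : VonNeumannAlgebra K} {ξ : K} {F : Finset K} {ε : ℝ}
    {q r : K →L[ℂ] K} (hq : IsStarProjection q) (hr : IsStarProjection r) (hqr : q * r = 0)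
    (h1 : N.HasSmallUnitary ξ F ε q) (h2 : N.HasSmallUnitary ξ F ε r) :
    N.HasSmallUnitary ξ F ε (q + r) := by
  obtain ⟨v, hv, hv1, hv2, hv3, hv4⟩ := h1
  obtain ⟨w, hw, hw1, hw2, hw3, hw4⟩ := h2
  have hsq := hq.isSelfAdjoint.star_eq
  have hsr := hr.isSelfAdjoint.star_eq
  have hrq : r * q = 0 := by simpa [hsq, hsr] using congrArg star hqr
  -- initial projections
  have hv5 : v * q = v := by rw [← hv1, ← mul_assoc, hv2, hv3]
  have hw5 : w * r = w := by rw [← hw1, ← mul_assoc, hw2, hw3]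
  have hqw : q * w = 0 := by rw [← hw3, ← mul_assoc, hqr, zero_mul]
  have hrv : r * v = 0 := by rw [← hv3, ← mul_assoc, hrq, zero_mul]
  have e1 : star v * w = 0 := by
    rw [← hv3, star_mul, hsq, mul_assoc, hqw, mul_zero]
  have e2 : star w * v = 0 := by
    rw [← hw3, star_mul, hsr, mul_assoc, hrv, mul_zero]
  have e3 : v * star w = 0 := by
    rw [← hv5, ← hw5, star_mul, hsr, mul_assoc, ← mul_assoc q, hqr, zero_mul, mul_zero]
  have e4 : w * star v = 0 := by
    rw [← hv5, ← hw5, star_mul, hsq, mul_assoc, ← mul_assoc r, hrq, zero_mul, mul_zero]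
  have hsum : ∑ η ∈ F, ‖⟪η, (v + w) ξ⟫_ℂ‖ ^ 2 + ∑ η ∈ F, ‖⟪η, (v - w) ξ⟫_ℂ‖ ^ 2 ≤
      2 * (ε * ∑ η ∈ F, ‖(q + r) η‖ ^ 2) := by
    have : ∀ η ∈ F, ‖⟪η, (v + w) ξ⟫_ℂ‖ ^ 2 + ‖⟪η, (v - w) ξ⟫_ℂ‖ ^ 2 =
        2 * (‖⟪η, v ξ⟫_ℂ‖ ^ 2 + ‖⟪η, w ξ⟫_ℂ‖ ^ 2) := by
      intro η _
      rw [add_apply, sub_apply, inner_add_right, inner_sub_right]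
      have := parallelogram_law_with_norm ℂ ⟪η, v ξ⟫_ℂ ⟪η, w ξ⟫_ℂ
      linarith
    rw [← Finset.sum_add_distrib, Finset.sum_congr rfl this, ← Finset.mul_sum,
      Finset.sum_add_distrib]
    simp_rw [norm_sq_add_norm_sq_of_mul_eq_zero hq hqr]
    rw [Finset.sum_add_distrib]
    linarith
  rcases le_total (∑ η ∈ F, ‖⟪η, (v + w) ξ⟫_ℂ‖ ^ 2) (∑ η ∈ F, ‖⟪η, (v - w) ξ⟫_ℂ‖ ^ 2) with h | h
  · refine ⟨v + w, add_mem hv hw, ?_, ?_, ?_, by linarith⟩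
    · simp only [star_add, add_mul, mul_add, hv1, hw1, e1, e2]; abel
    · simp only [star_add, add_mul, mul_add, hv2, hw2, e3, e4]; abel
    · simp only [add_mul, mul_add, hv3, hw3, hqw, hrv]; abel
  · refine ⟨v - w, sub_mem hv hw, ?_, ?_, ?_, by linarith⟩
    · simp only [star_sub, sub_mul, mul_sub, hv1, hw1, e1, e2]; abel
    · simp only [star_sub, sub_mul, mul_sub, hv2, hw2, e3, e4]; abel
    · simp only [add_mul, mul_sub, hv3, hw3, hqw, hrv]; abel

/-- In a von Neumann algebra without minimal projections there are unitaries with small matrix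
coefficients. -/
theorem exists_unitary_sum_inner_le {N : VonNeumannAlgebra K}
    (hN : ∀ p, ¬ N.IsMinimalProjection p) (ξ : K) (F : Finset K) {ε : ℝ} (hε : 0 < ε) :
    ∃ u ∈ N, u ∈ unitary (K →L[ℂ] K) ∧
      ∑ η ∈ F, ‖⟪η, u ξ⟫_ℂ‖ ^ 2 ≤ ε * ∑ η ∈ F, ‖η‖ ^ 2 := by
  by_cases hgood : N.HasSmallUnitary ξ F ε 1
  · obtain ⟨v, hv, h1, h2, -, h4⟩ := hgood
    exact ⟨v, hv, Unitary.mem_iff.2 ⟨h1, h2⟩, by simpa using h4⟩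
  exfalso
  -- Zorn's lemma is applied to complements of bad projections. A maximal element gives a bad
  -- projection all of whose proper subprojections are good, and such a projection must be minimal,
  -- since a splitting into two good pieces would make it good.
  let S : Set (K →L[ℂ] K) :=
    {r | r ∈ N ∧ IsStarProjection r ∧ ¬ N.HasSmallUnitary ξ F ε (1 - r)}
  have h0 : (0 : K →L[ℂ] K) ∈ S := ⟨zero_mem N, .zero _, by simpa using hgood⟩
  obtain ⟨m, -, hm⟩ := zorn_le_nonempty₀ S (fun c hcS hc y hy => by
    obtain ⟨r, hrN, hr, hle, hlim⟩ := N.exists_sup_of_isChain hc ⟨y, hy⟩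
      (fun p hp => (hcS hp).1) (fun p hp => (hcS hp).2.1)
    refine ⟨r, ⟨hrN, hr, fun hbad => ?_⟩, hle⟩
    -- Near the supremum the gap `r - p` is small at `ξ`, hence good. If `1 - r` were good too, then
    -- so would be `1 - p = (1 - r) + (r - p)`.
    obtain ⟨p, hp, hlt⟩ := hlim ξ (Real.sqrt ε) (Real.sqrt_pos.2 hε)
    obtain ⟨hpN, hpp, hpbad⟩ := hcS hp
    have hsub : IsStarProjection (r - p) := (hpp.le_iff_sub hr).1 (hle p hp)
    have h1 : N.HasSmallUnitary ξ F ε (r - p) := N.hasSmallUnitary_of_norm_le F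
      (sub_mem hrN hpN) hsub (by
        have := pow_le_pow_left₀ (norm_nonneg _) hlt.le 2
        rwa [Real.sq_sqrt hε.le] at this)
    have hmul : (1 - r) * (r - p) = 0 := by
      have h2 := (hpp.le_iff_mul_eq_right hr).1 (hle p hp)
      have h3 := hr.isIdempotentElem.eq
      simp only [sub_mul, mul_sub, one_mul, h2, h3]
      abel
    have := hbad.add hr.one_sub hsub hmul h1
    rw [sub_add_sub_cancel] at this
    exact hpbad this) 0 h0
  obtain ⟨hmN, hmp, hmbad⟩ := hm.prop
  have hpp := hmp.one_sub
  have hne : 1 - m ≠ 0 := by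
    intro h
    rw [h] at hmbad
    exact hmbad (N.hasSmallUnitary_of_norm_le F (zero_mem N) (.zero _) (by simpa using hε.le))
  refine hN (1 - m) ⟨sub_mem (one_mem N) hmN, hpp, hne, fun q hqN hq hmq => ?_⟩
  by_contra! hq'
  have hqle : q ≤ 1 - m := (hq.le_iff_mul_eq_right hpp).2 hmq
  have hsub : IsStarProjection (1 - m - q) := (hq.le_iff_sub hpp).1 hqle
  have good : ∀ r ∈ N, IsStarProjection r → r ≤ 1 - m → r ≠ 1 - m →
      N.HasSmallUnitary ξ F ε r := by
    intro r hrN hr hle hne'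
    by_contra hbad
    have hmem : (1 - r) ∈ S := ⟨sub_mem (one_mem N) hrN, hr.one_sub, by simpa using hbad⟩
    have := hm.eq_of_le hmem (by rw [le_sub_comm]; exact hle)
    exact hne' (by rw [this]; simp)
  have g1 := good q hqN hq hqle hq'.2
  have g2 := good (1 - m - q) (sub_mem (sub_mem (one_mem N) hmN) hqN) hsub
    (sub_le_self _ hq.nonneg) (by simpa using hq'.1)
  have hmul : q * (1 - m - q) = 0 := by
    have h2 := (hq.le_iff_mul_eq_left hpp).1 hqle
    rw [mul_sub, h2, hq.isIdempotentElem.eq, sub_self]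
  have := g1.add hq hsub hmul g2
  rw [add_sub_cancel] at this
  exact hmbad this

/-- The vectors against which a bounded sequence is weakly null form a closed subspace. -/
theorem tendsto_inner_zero_of_mem_closure {K : Type*} [NormedAddCommGroup K]
    [InnerProductSpace ℂ K] {v : ℕ → K} {C : ℝ} (hv : ∀ n, ‖v n‖ ≤ C) {S : Set K}
    (hS : ∀ η ∈ S, Tendsto (fun n => ⟪v n, η⟫_ℂ) atTop (𝓝 0)) {η : K}
    (hη : η ∈ (Submodule.span ℂ S).topologicalClosure) :
    Tendsto (fun n => ⟪v n, η⟫_ℂ) atTop (𝓝 0) := by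
  have hspan : ∀ η ∈ Submodule.span ℂ S, Tendsto (fun n => ⟪v n, η⟫_ℂ) atTop (𝓝 0) := by
    intro η hη
    induction hη using Submodule.span_induction with
    | mem η h => exact hS η h
    | zero => simp
    | add a b _ _ ha hb => simpa [inner_add_right] using ha.add hb
    | smul c a _ ha => simpa [inner_smul_right] using ha.const_mul c
  have hC : 0 ≤ C := (norm_nonneg _).trans (hv 0)
  rw [Metric.tendsto_atTop]
  intro ε hε
  obtain ⟨b, hb, hdist⟩ := Metric.mem_closure_iff.1 hη (ε / (2 * (C + 1))) (by positivity)
  obtain ⟨n₀, hn₀⟩ := Metric.tendsto_atTop.1 (hspan b hb) (ε / 2) (by positivity)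
  refine ⟨n₀, fun n hn => ?_⟩
  have h1 := hn₀ n hn
  rw [dist_zero_right] at h1 ⊢
  have h2 : ⟪v n, η⟫_ℂ = ⟪v n, b⟫_ℂ + ⟪v n, η - b⟫_ℂ := by rw [← inner_add_right]; simp
  have h3 : ‖⟪v n, η - b⟫_ℂ‖ ≤ ε / 2 := by
    calc ‖⟪v n, η - b⟫_ℂ‖ ≤ ‖v n‖ * ‖η - b‖ := norm_inner_le_norm _ _
      _ ≤ (C + 1) * (ε / (2 * (C + 1))) := by
        gcongr
        · linarith [hv n]
        · rw [← dist_eq_norm]; exact hdist.le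
      _ = ε / 2 := by field_simp
  rw [h2]
  linarith [norm_add_le ⟪v n, b⟫_ℂ ⟪v n, η - b⟫_ℂ]

/-- A bounded sequence that is asymptotically orthogonal to each of its members is weakly null. -/
theorem tendsto_inner_zero_of_self {v : ℕ → K} {C : ℝ} (hv : ∀ n, ‖v n‖ ≤ C)
    (h : ∀ j, Tendsto (fun n => ⟪v n, v j⟫_ℂ) atTop (𝓝 0)) (η : K) :
    Tendsto (fun n => ⟪v n, η⟫_ℂ) atTop (𝓝 0) := by
  let E := (Submodule.span ℂ (Set.range v)).topologicalClosure
  have : CompleteSpace E := (Submodule.isClosed_topologicalClosure _).completeSpace_coe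
  -- Only the component of `η` in the closed span of the sequence contributes to the inner products.
  have h1 : Tendsto (fun n => ⟪v n, E.starProjection η⟫_ℂ) atTop (𝓝 0) :=
    tendsto_inner_zero_of_mem_closure hv (S := Set.range v) (by rintro _ ⟨j, rfl⟩; exact h j)
      (E.starProjection_apply_mem η)
  refine h1.congr fun n => ?_
  have h2 : v n ∈ E := Submodule.le_topologicalClosure _ (Submodule.subset_span ⟨n, rfl⟩)
  have h3 := Submodule.sub_starProjection_mem_orthogonal (K := E) η
  have h4 := Submodule.inner_right_of_mem_orthogonal h2 h3
  rw [inner_sub_right, sub_eq_zero] at h4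
  exact h4.symm

theorem norm_apply_of_mem_unitary {u : K →L[ℂ] K} (hu : u ∈ unitary (K →L[ℂ] K)) (ξ : K) :
    ‖u ξ‖ = ‖ξ‖ := by
  have h : ⟪u ξ, u ξ⟫_ℂ = ⟪ξ, ξ⟫_ℂ := by
    rw [← inner_star_right, ← mul_apply_eq_comp, Unitary.star_mul_self_of_mem hu,
      one_apply_eq_self]
  rw [@norm_eq_sqrt_re_inner ℂ, h, ← @norm_eq_sqrt_re_inner ℂ]

/-- A von Neumann algebra without minimal projections contains a sequence of unitaries along which
a given vector becomes weakly null. -/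
theorem exists_unitary_tendsto_inner_zero {N : VonNeumannAlgebra K}
    (hN : ∀ p, ¬ N.IsMinimalProjection p) (ξ : K) :
    ∃ u : ℕ → K →L[ℂ] K, (∀ n, u n ∈ N) ∧ (∀ n, u n ∈ unitary (K →L[ℂ] K)) ∧
      ∀ η, Tendsto (fun n => ⟪u n ξ, η⟫_ℂ) atTop (𝓝 0) := by
  classical
  have hstep : ∀ (n : ℕ) (F : Finset K), ∃ u ∈ N, u ∈ unitary (K →L[ℂ] K) ∧
      ∀ η ∈ F, ‖⟪u ξ, η⟫_ℂ‖ ^ 2 ≤ 1 / ((n : ℝ) + 1) := by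
    intro n F
    set c : ℝ := ∑ η ∈ F, ‖η‖ ^ 2
    have hc : 0 ≤ c := Finset.sum_nonneg fun _ _ => by positivity
    -- The factor `c + 1` absorbs the sum `c` of the squared norms and stays positive when `F` is
    -- empty.
    obtain ⟨u, hu, huu, hsum⟩ := exists_unitary_sum_inner_le hN ξ F
      (ε := 1 / (((n : ℝ) + 1) * (c + 1))) (by positivity)
    refine ⟨u, hu, huu, fun η hη => ?_⟩
    rw [norm_inner_symm]
    calc ‖⟪η, u ξ⟫_ℂ‖ ^ 2 ≤ ∑ η ∈ F, ‖⟪η, u ξ⟫_ℂ‖ ^ 2 :=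
          Finset.single_le_sum (f := fun η => ‖⟪η, u ξ⟫_ℂ‖ ^ 2) (fun _ _ => by positivity) hη
      _ ≤ 1 / (((n : ℝ) + 1) * (c + 1)) * c := hsum
      _ ≤ 1 / ((n : ℝ) + 1) := by
        rw [div_mul_eq_mul_div, div_le_div_iff₀ (by positivity) (by positivity)]
        nlinarith [Nat.cast_nonneg (α := ℝ) n]
  choose f hfN hfU hf using hstep
  -- the unitaries chosen so far
  let P : ℕ → (K →L[ℂ] K) × Finset K := fun n => n.rec (f 0 ∅, {f 0 ∅ ξ}) fun n a =>
    (f (n + 1) a.2, insert (f (n + 1) a.2 ξ) a.2)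
  have hP : ∀ n, P (n + 1) = (f (n + 1) (P n).2, insert (f (n + 1) (P n).2 ξ) (P n).2) :=
    fun n => rfl
  have hmem : ∀ n j, j ≤ n → (P j).1 ξ ∈ (P n).2 := by
    intro n
    induction n with
    | zero =>
      intro j hj
      obtain rfl : j = 0 := by omega
      simp [P]
    | succ n ih =>
      intro j hj
      rw [hP]
      rcases Nat.lt_or_eq_of_le hj with h | rfl
      · exact Finset.mem_insert_of_mem (ih j (by omega))
      · rw [hP]; exact Finset.mem_insert_self _ _
  have hUn : ∀ n, (P n).1 ∈ unitary (K →L[ℂ] K) := by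
    intro n; cases n with
    | zero => exact hfU _ _
    | succ n => exact hfU _ _
  refine ⟨fun n => (P n).1, fun n => ?_, hUn, ?_⟩
  · cases n with
    | zero => exact hfN _ _
    | succ n => exact hfN _ _
  · refine tendsto_inner_zero_of_self (C := ‖ξ‖) (fun n => (norm_apply_of_mem_unitary (hUn n) ξ).le)
      fun j => ?_
    rw [tendsto_zero_iff_norm_tendsto_zero]
    have hsq : Tendsto (fun n => ‖⟪(P n).1 ξ, (P j).1 ξ⟫_ℂ‖ ^ 2) atTop (𝓝 0) := by
      refine squeeze_zero' (Eventually.of_forall fun _ => by positivity) ?_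
        tendsto_one_div_add_atTop_nhds_zero_nat
      filter_upwards [eventually_gt_atTop j] with n hn
      obtain ⟨m, rfl⟩ : ∃ m, n = m + 1 := ⟨n - 1, by omega⟩
      rw [hP m]
      exact hf (m + 1) (P m).2 _ (hmem m j (by omega))
    have := (Real.continuous_sqrt.tendsto 0).comp hsq
    simpa [Function.comp_def, Real.sqrt_sq (norm_nonneg _)] using this

end VonNeumannAlgebra
end

noncomputable section

/-! ### Comparison of a representation with the identity representation -/

namespace VonNeumannAlgebra

open scoped ComplexOrder InnerProductSpace
open Filter Topology

variable {K : Type*} [NormedAddCommGroup K] [InnerProductSpace ℂ K] [CompleteSpace K]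

theorem operator_nonneg_iff {K : Type*} [NormedAddCommGroup K] [InnerProductSpace ℂ K] {a : K →L[ℂ] K} : 0 ≤ a ↔ ∀ ξ, 0 ≤ ⟪ξ, a ξ⟫_ℂ := by
  rw [ContinuousLinearMap.nonneg_iff_isPositive]
  refine ⟨fun h ξ => h.inner_nonneg_right ξ, fun h => ?_⟩
  rw [ContinuousLinearMap.isPositive_iff_complex]
  intro ξ
  have h1 := h ξ
  have h2 : ⟪a ξ, ξ⟫_ℂ = ⟪ξ, a ξ⟫_ℂ := by
    rw [← inner_conj_symm]
    exact Complex.conj_eq_iff_im.2 (Complex.nonneg_iff.1 h1).2.symm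
  rw [h2]
  have h3 := Complex.nonneg_iff.1 h1
  exact ⟨Complex.conj_eq_iff_re.1 (Complex.conj_eq_iff_im.2 h3.2.symm), h3.1⟩

/-- Bounded families of operators have limits in the weak operator topology along
ultrafilters. -/
theorem exists_tendsto_inner_ultrafilter {ι : Type*} (U : Ultrafilter ι) (T : ι → K →L[ℂ] K)
    (hT : ∀ i, ‖T i‖ ≤ 1) :
    ∃ S : K →L[ℂ] K, ∀ ξ η, Tendsto (fun i => ⟪ξ, T i η⟫_ℂ) U (𝓝 ⟪ξ, S η⟫_ℂ) := by
  have hb : ∀ i ξ η, ‖⟪ξ, T i η⟫_ℂ‖ ≤ ‖ξ‖ * ‖η‖ := fun i ξ η =>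
    (norm_inner_le_norm _ _).trans (by
      gcongr
      simpa using (T i).le_of_opNorm_le (hT i) η)
  have hex : ∀ ξ η, ∃ z : ℂ, ‖z‖ ≤ ‖ξ‖ * ‖η‖ ∧ Tendsto (fun i => ⟪ξ, T i η⟫_ℂ) U (𝓝 z) := by
    intro ξ η
    -- The matrix coefficients stay in a compact disc, whose radius also bounds the limiting
    -- sesquilinear form.
    obtain ⟨z, hz, hle⟩ := (isCompact_closedBall (0 : ℂ) (‖ξ‖ * ‖η‖)).ultrafilter_le_nhds
      (U.map fun i => ⟪ξ, T i η⟫_ℂ) (by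
        rw [le_principal_iff]
        exact mem_map.2 (Filter.mem_of_superset univ_mem fun i _ => by simpa using hb i ξ η))
    exact ⟨z, by simpa using hz, hle⟩
  choose B hB hlim using hex
  let f : K →ₗ⋆[ℂ] K →ₗ[ℂ] ℂ := LinearMap.mk₂'ₛₗ (starRingEnd ℂ) (RingHom.id ℂ) B
    (fun ξ ξ' η => tendsto_nhds_unique (hlim _ _)
      (by simpa [inner_add_left] using (hlim ξ η).add (hlim ξ' η)))
    (fun c ξ η => tendsto_nhds_unique (hlim _ _)
      (by simpa [inner_smul_left, mul_comm] using (hlim ξ η).const_mul (starRingEnd ℂ c)))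
    (fun ξ η η' => tendsto_nhds_unique (hlim _ _)
      (by simpa [inner_add_right] using (hlim ξ η).add (hlim ξ η')))
    (fun c ξ η => tendsto_nhds_unique (hlim _ _)
      (by simpa [inner_smul_right] using (hlim ξ η).const_mul c))
  let g : K →L⋆[ℂ] K →L[ℂ] ℂ := f.mkContinuous₂ 1 (fun ξ η => by simpa [f] using hB ξ η)
  refine ⟨star (InnerProductSpace.continuousLinearMapOfBilin g), fun ξ η => ?_⟩
  rw [inner_star_right, InnerProductSpace.continuousLinearMapOfBilin_apply]
  exact hlim ξ η

/-- For a representation `π` of a von Neumann algebra `R` on `K` and a vector `δ`, the vector state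
of `δ` is dominated by one of `K` after cutting down by some nonzero `s ∈ R`. -/
theorem exists_norm_representation_le (R : VonNeumannAlgebra K) [Nontrivial K] {L : Type*}
    [NormedAddCommGroup L] [InnerProductSpace ℂ L] [CompleteSpace L]
    (π : R.toStarSubalgebra →⋆ₐ[ℂ] (L →L[ℂ] L)) (δ : L) :
    ∃ (s : R.toStarSubalgebra) (ζ : K), s ≠ 0 ∧
      ∀ x : R.toStarSubalgebra, ‖π (x * s) δ‖ ≤ ‖(x * s : K →L[ℂ] K) ζ‖ := by
  -- The strict inequality gives `f 1 < ω 1`, which is what keeps the maximal element below away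
  -- from `1`.
  obtain ⟨ζ, hζ⟩ := NormedSpace.exists_lt_norm ℂ K ‖δ‖
  let f : R.toStarSubalgebra → ℝ := fun a => (⟪δ, π a δ⟫_ℂ).re
  let ω : R.toStarSubalgebra → ℝ := fun a => (⟪ζ, a.1 ζ⟫_ℂ).re
  have hf_add : ∀ a b, f (a + b) = f a + f b := fun a b => by simp [f]
  have hω_add : ∀ a b, ω (a + b) = ω a + ω b := fun a b => by simp [ω]
  have hf_sq : ∀ x, f (star x * x) = ‖π x δ‖ ^ 2 := fun x => by
    simp only [f, map_mul, map_star, mul_apply_eq_comp, inner_star_right]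
    exact inner_self_eq_norm_sq (𝕜 := ℂ) _
  have hω_sq : ∀ x, ω (star x * x) = ‖x.1 ζ‖ ^ 2 := fun x => by
    simp only [ω, MulMemClass.coe_mul, StarMemClass.coe_star, mul_apply_eq_comp, inner_star_right]
    exact inner_self_eq_norm_sq (𝕜 := ℂ) _
  have hsqrt : ∀ a : R.toStarSubalgebra, 0 ≤ a.1 → ∃ s : R.toStarSubalgebra, star s * s = a := by
    intro a ha
    refine ⟨⟨CFC.sqrt a.1, sqrt_mem a.2⟩, Subtype.ext ?_⟩
    change star (CFC.sqrt a.1) * CFC.sqrt a.1 = a.1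
    rw [(IsSelfAdjoint.of_nonneg (CFC.sqrt_nonneg a.1)).star_eq, CFC.sqrt_mul_sqrt_self a.1]
  have hf_mono : ∀ a b : R.toStarSubalgebra, a.1 ≤ b.1 → f a ≤ f b := by
    intro a b hab
    obtain ⟨s, hs⟩ := hsqrt (b - a) (by simpa using hab)
    have h1 : f b = f a + f (b - a) := by rw [← hf_add]; simp
    rw [h1, ← hs, hf_sq]
    exact le_add_of_nonneg_right (by positivity)
  -- An exhaustion argument: a maximal `m` in the unit interval of `R` with `ω m ≤ f m` leaves room
  -- `1 - m ≠ 0` under which no nonzero positive `b` has `ω b ≤ f b`. The element sought is the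
  -- square root of `1 - m`.
  let S : Set R.toStarSubalgebra := {a | 0 ≤ a.1 ∧ a.1 ≤ 1 ∧ ω a ≤ f a}
  have h0 : (0 : R.toStarSubalgebra) ∈ S := ⟨le_rfl, zero_le_one, by simp [ω, f]⟩
  obtain ⟨m, -, hm⟩ := zorn_le_nonempty₀ S (fun c hcS hc y hy => by
    have : Nonempty c := ⟨⟨y, hy⟩⟩
    have hdir : IsDirectedOrder c := ⟨fun p q => by
      rcases hc.total p.2 q.2 with h | h
      · exact ⟨q, h, le_rfl⟩
      · exact ⟨p, le_rfl, h⟩⟩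
    let U : Ultrafilter c := Ultrafilter.of atTop
    have hU : (U : Filter c) ≤ atTop := Ultrafilter.of_le _
    obtain ⟨T, hT⟩ := exists_tendsto_inner_ultrafilter U (fun i : c => i.1.1) fun i =>
      (CStarAlgebra.norm_le_one_iff_of_nonneg _ (hcS i.2).1).2 (hcS i.2).2.1
    have := Complex.orderClosedTopology
    have hle : ∀ a ∈ c, a.1 ≤ T := by
      intro a ha
      rw [← sub_nonneg, operator_nonneg_iff]
      intro ξ
      refine ge_of_tendsto ((hT ξ ξ).sub_const ⟪ξ, a.1 ξ⟫_ℂ |>.congr fun i => ?_ :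
        Tendsto (fun i : c => ⟪ξ, (i.1.1 - a.1) ξ⟫_ℂ) U (𝓝 _)) ?_ |>.trans_eq ?_
      · simp
      · have : ∀ᶠ i : c in U, (⟨a, ha⟩ : c) ≤ i := hU (eventually_ge_atTop _)
        filter_upwards [this] with i hi
        exact operator_nonneg_iff.1 (sub_nonneg.2 (show a.1 ≤ i.1.1 from hi)) ξ
      · simp
    have hT1 : T ≤ 1 := by
      rw [← sub_nonneg, operator_nonneg_iff]
      intro ξ
      refine ge_of_tendsto ((hT ξ ξ).const_sub ⟪ξ, ξ⟫_ℂ |>.congr fun i => ?_ :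
        Tendsto (fun i : c => ⟪ξ, (1 - i.1.1) ξ⟫_ℂ) U (𝓝 _)) ?_ |>.trans_eq ?_
      · simp
      · exact Eventually.of_forall fun i =>
          operator_nonneg_iff.1 (sub_nonneg.2 (hcS i.2).2.1) ξ
      · simp
    have hTR : T ∈ R := by
      refine mem_of_forall_commute fun z hz => ?_
      refine ContinuousLinearMap.ext fun η => ext_inner_left ℂ fun ξ => ?_
      refine tendsto_nhds_unique (hT ξ (z η)) ?_
      have h1 := hT (star z ξ) η
      rw [inner_star_left] at h1
      refine h1.congr fun i => ?_
      rw [inner_star_left, ← mul_apply_eq_comp, ← mul_apply_eq_comp,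
        (commute_of_mem_commutant (show i.1.1 ∈ R from i.1.2) hz).eq]
    refine ⟨⟨T, hTR⟩, ⟨(hcS hy).1.trans (hle y hy), hT1, ?_⟩, fun a ha => hle a ha⟩
    -- Only the vector functional `ω` has to be continuous along the chain. For `f` monotonicity is
    -- enough, so no normality of `π` is needed.
    have h1 : Tendsto (fun i : c => ω i.1) U (𝓝 (ω ⟨T, hTR⟩)) :=
      (Complex.continuous_re.tendsto _).comp (hT ζ ζ)
    exact le_of_tendsto h1 (Eventually.of_forall fun i =>
      (hcS i.2).2.2.trans (hf_mono _ _ (hle i.1 i.2)))) 0 h0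
  obtain ⟨hm0, hm1, hmω⟩ := hm.prop
  obtain ⟨s, hs⟩ := hsqrt (1 - m) (by simpa using hm1)
  refine ⟨s, ζ, fun hs0 => ?_, fun x => ?_⟩
  · have h1 : m = 1 := by
      rw [hs0] at hs
      rw [star_zero, zero_mul] at hs
      exact (sub_eq_zero.1 hs.symm).symm
    have h2 : ω 1 = ‖ζ‖ ^ 2 := by simpa using hω_sq 1
    have h3 : f 1 = ‖δ‖ ^ 2 := by simpa using hf_sq 1
    rw [h1, h2, h3] at hmω
    exact absurd (pow_lt_pow_left₀ hζ (norm_nonneg _) two_ne_zero) (not_lt.2 hmω)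
  -- The claim is homogeneous in `x`. After scaling `x` to a contraction `y`, the element
  -- `(ys)*(ys)` lies below `s*s = 1 - m`, so adding it to `m` stays in the unit interval.
  · set C : ℝ := (‖x.1‖ + 1)⁻¹ with hC
    have hCpos : 0 < C := by positivity
    set y : R.toStarSubalgebra := (C : ℂ) • x with hy
    have hyn : ‖y.1‖ ≤ 1 := by
      change ‖(C : ℂ) • x.1‖ ≤ 1
      rw [norm_smul, Complex.norm_real, Real.norm_of_nonneg hCpos.le, hC,
        inv_mul_le_one₀ (by positivity)]
      linarith
    suffices h : f (star (y * s) * (y * s)) ≤ ω (star (y * s) * (y * s)) by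
      rw [hf_sq, hω_sq] at h
      have h2 := (sq_le_sq₀ (norm_nonneg _) (norm_nonneg _)).1 h
      have e1 : π (y * s) δ = (C : ℂ) • π (x * s) δ := by
        rw [hy, smul_mul_assoc, map_smul, smul_apply]
      have e2 : (y * s).1 ζ = (C : ℂ) • (x * s : K →L[ℂ] K) ζ := by
        change (((C : ℂ) • x.1) * s.1) ζ = _
        rw [smul_mul_assoc, smul_apply]
      rw [e1, e2, norm_smul, norm_smul, Complex.norm_real, Real.norm_of_nonneg hCpos.le] at h2
      exact le_of_mul_le_mul_left h2 hCpos
    by_contra! hlt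
    set b := star (y * s) * (y * s) with hb
    have hb0 : 0 ≤ b.1 := star_mul_self_nonneg ((y * s).1)
    have hb1 : b.1 ≤ (1 - m).1 := by
      rw [← sub_nonneg, operator_nonneg_iff, ← hs]
      intro ξ
      have e1 : ⟪ξ, b.1 ξ⟫_ℂ = ((‖y.1 (s.1 ξ)‖ ^ 2 : ℝ) : ℂ) := by
        change ⟪ξ, (star (y.1 * s.1) * (y.1 * s.1)) ξ⟫_ℂ = _
        rw [mul_apply_eq_comp, inner_star_right, inner_self_eq_norm_sq_to_K]
        simp
      have e2 : ⟪ξ, (star s * s).1 ξ⟫_ℂ = ((‖s.1 ξ‖ ^ 2 : ℝ) : ℂ) := by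
        change ⟪ξ, (star s.1 * s.1) ξ⟫_ℂ = _
        rw [mul_apply_eq_comp, inner_star_right, inner_self_eq_norm_sq_to_K]
        simp
      rw [sub_apply, inner_sub_right, e1, e2, ← Complex.ofReal_sub]
      refine Complex.zero_le_real.2 (sub_nonneg.2 ?_)
      gcongr
      simpa using y.1.le_of_opNorm_le hyn (s.1 ξ)
    have hmem : m + b ∈ S := by
      refine ⟨add_nonneg hm0 hb0, ?_, ?_⟩
      · change m.1 + b.1 ≤ 1
        rw [← le_sub_iff_add_le']
        exact hb1
      · rw [hω_add, hf_add]
        linarith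
    have heq := hm.eq_of_le hmem (show m.1 ≤ m.1 + b.1 from le_add_of_nonneg_right hb0)
    have hbz : b = 0 := by simpa using heq
    rw [hbz] at hlt
    simp [ω, f] at hlt

end VonNeumannAlgebra
end

noncomputable section

/-! ### Fourier coefficients in group von Neumann algebras -/

namespace EllTwo

open scoped InnerProductSpace ComplexConjugate
open Filter Topology

variable {G : Type*}

open Classical in
/-- The standard basis vector at `g`. -/
def basisVec (g : G) : EllTwo G := lp.single 2 g (1 : ℂ)

open Classical in
theorem basisVec_apply (g x : G) : basisVec g x = if x = g then 1 else 0 := by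
  rw [basisVec, lp.single_apply, Pi.single_apply]

theorem inner_basisVec_left (g : G) (ξ : EllTwo G) : ⟪basisVec g, ξ⟫_ℂ = ξ g := by
  classical
  rw [basisVec, lp.inner_single_left]
  simp

theorem inner_basisVec_right (g : G) (ξ : EllTwo G) : ⟪ξ, basisVec g⟫_ℂ = conj (ξ g) := by
  rw [← inner_conj_symm, inner_basisVec_left]

theorem hasSum_basisVec (ξ : EllTwo G) : HasSum (fun g => ξ g • basisVec g) ξ := by
  classical
  have h := lp.hasSum_single (p := 2) (by norm_num) ξ
  convert h using 2 with g
  rw [basisVec, ← lp.single_smul, smul_eq_mul, mul_one]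

theorem norm_basisVec (g : G) : ‖basisVec g‖ = 1 := by
  rw [@norm_eq_sqrt_re_inner ℂ, inner_basisVec_left, basisVec_apply]
  simp

theorem norm_apply_le (ξ : EllTwo G) (g : G) : ‖ξ g‖ ≤ ‖ξ‖ := by
  rw [← inner_basisVec_left]
  simpa [norm_basisVec] using norm_inner_le_norm (𝕜 := ℂ) (basisVec g) ξ

/-- A vector lies in the closed span of the basis vectors of its support. -/
theorem mem_closure_span_of_support {ξ : EllTwo G} {S : Set G} (h : ∀ g ∉ S, ξ g = 0) :
    ξ ∈ (Submodule.span ℂ (basisVec '' S)).topologicalClosure := by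
  refine mem_closure_of_tendsto (hasSum_basisVec ξ) (Eventually.of_forall fun F => ?_)
  refine Submodule.sum_mem _ fun g _ => ?_
  by_cases hg : g ∈ S
  · exact Submodule.smul_mem _ _ (Submodule.subset_span ⟨g, hg, rfl⟩)
  · rw [h g hg, zero_smul]; exact Submodule.zero_mem _

theorem continuousLinearMap_ext {E : Type*} [NormedAddCommGroup E] [NormedSpace ℂ E]
    {S T : EllTwo G →L[ℂ] E} (h : ∀ g, S (basisVec g) = T (basisVec g)) : S = T := by
  ext ξ
  have h1 := (hasSum_basisVec ξ).mapL S
  have h2 := (hasSum_basisVec ξ).mapL T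
  simp only [map_smul, h] at h1 h2
  exact h1.unique h2

/-- Only countably many coordinates of a vector are nonzero. -/
theorem countable_support (ξ : EllTwo G) : {g | ξ g ≠ 0}.Countable := by
  have h := lp.memℓp ξ
  rw [memℓp_gen_iff (by norm_num)] at h
  refine h.countable_support.mono fun g hg => ?_
  simpa using hg

/-- Composition with a permutation of the index set. -/
def reindex (e : G ≃ G) : EllTwo G →ₗᵢ[ℂ] EllTwo G where
  toFun ξ := ⟨fun x => ξ (e x), by
    have h := lp.memℓp ξ
    change Memℓp (fun x => ξ (e x)) 2
    rw [memℓp_gen_iff (by norm_num)] at h ⊢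
    exact e.summable_iff.mpr h⟩
  map_add' _ _ := rfl
  map_smul' _ _ := rfl
  norm_map' ξ := by
    rw [lp.norm_eq_tsum_rpow (by norm_num), lp.norm_eq_tsum_rpow (by norm_num)]
    congr 1
    exact e.tsum_eq (fun x => ‖ξ x‖ ^ (ENNReal.toReal 2))

open Classical in
/-- The restriction of vectors to a set of coordinates. -/
def cutoff (S : Set G) : EllTwo G →L[ℂ] EllTwo G :=
  LinearMap.mkContinuous
    { toFun := fun ξ => ⟨fun x => if x ∈ S then ξ x else 0, by
        have h := lp.memℓp ξ
        change Memℓp (fun x => if x ∈ S then ξ x else 0) 2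
        rw [memℓp_gen_iff (by norm_num)] at h ⊢
        refine Summable.of_nonneg_of_le (fun x => by positivity) (fun x => ?_) h
        by_cases hx : x ∈ S
        · simp [hx]
        · simp [hx]⟩
      map_add' := fun ξ η => by
        ext x
        change (if x ∈ S then ξ x + η x else 0) =
          (if x ∈ S then ξ x else 0) + (if x ∈ S then η x else 0)
        by_cases hx : x ∈ S <;> simp [hx]
      map_smul' := fun c ξ => by
        ext x
        by_cases hx : x ∈ S <;> simp [hx] } 1
    (fun ξ => by
      rw [one_mul]
      refine lp.norm_le_of_tsum_le (by norm_num) (norm_nonneg _) ?_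
      rw [lp.norm_rpow_eq_tsum (by norm_num) ξ]
      have h := (memℓp_gen_iff (by norm_num)).1 (lp.memℓp ξ)
      have hle : ∀ x, ‖(if x ∈ S then ξ x else 0)‖ ^ (ENNReal.toReal 2) ≤
          ‖ξ x‖ ^ (ENNReal.toReal 2) := fun x => by
        by_cases hx : x ∈ S
        · simp [hx]
        · simp [hx]
      exact Summable.tsum_le_tsum hle
        (Summable.of_nonneg_of_le (fun x => by positivity) hle h) h)

open Classical in
theorem cutoff_apply (S : Set G) (ξ : EllTwo G) (x : G) :
    cutoff S ξ x = if x ∈ S then ξ x else 0 := rfl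

theorem cutoff_eq_self_iff {S : Set G} {ξ : EllTwo G} :
    cutoff S ξ = ξ ↔ ∀ g ∉ S, ξ g = 0 := by
  constructor
  · intro h g hg
    rw [← h, cutoff_apply, if_neg hg]
  · intro h
    ext x
    rw [cutoff_apply]
    split_ifs with hx
    · rfl
    · exact (h x hx).symm

variable [Group G]

/-- Right translation, `(ρ_g ξ)(x) = ξ(x g)`. -/
def rightTranslation (g : G) : EllTwo G →L[ℂ] EllTwo G :=
  (reindex (Equiv.mulRight g)).toContinuousLinearMap

theorem rightTranslation_apply (g : G) (ξ : EllTwo G) (x : G) :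
    rightTranslation g ξ x = ξ (x * g) := rfl

/-- Left translation as a bounded operator. -/
def leftOp (g : G) : EllTwo G →L[ℂ] EllTwo G := (leftTranslation g).toContinuousLinearMap

theorem leftOp_apply (g : G) (ξ : EllTwo G) (x : G) : leftOp g ξ x = ξ (g⁻¹ * x) := rfl

theorem star_leftOp (g : G) : star (leftOp g) = leftOp g⁻¹ := by
  refine ContinuousLinearMap.ext fun η => ext_inner_left ℂ fun ξ => ?_
  rw [VonNeumannAlgebra.inner_star_right]
  have h : leftTranslation g (leftOp g⁻¹ η) = η := by
    ext x
    rw [leftTranslation_apply, leftOp_apply]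
    simp
  nth_rewrite 1 [← h]
  exact (leftTranslation g).inner_map_map ξ (leftOp g⁻¹ η)

/-- The conjugation `(Jξ)(x) = conj (ξ(x⁻¹))`. -/
def modularConj : EllTwo G →L⋆[ℂ] EllTwo G :=
  ((starₗᵢ ℂ : EllTwo G ≃ₗᵢ⋆[ℂ] EllTwo G) : EllTwo G →L⋆[ℂ] EllTwo G).comp
    (reindex (Equiv.inv G)).toContinuousLinearMap

theorem modularConj_apply (ξ : EllTwo G) (x : G) : modularConj ξ x = conj (ξ x⁻¹) := rfl

theorem norm_modularConj (ξ : EllTwo G) : ‖modularConj ξ‖ = ‖ξ‖ := by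
  change ‖star (reindex (Equiv.inv G) ξ)‖ = ‖ξ‖
  rw [norm_star, LinearIsometry.norm_map]

/-- Right multiplication by an element of the group von Neumann algebra. -/
def rightOp (u : EllTwo G →L[ℂ] EllTwo G) : EllTwo G →L[ℂ] EllTwo G :=
  modularConj.comp ((star u).comp modularConj)

theorem rightOp_apply (u : EllTwo G →L[ℂ] EllTwo G) (ξ : EllTwo G) :
    rightOp u ξ = modularConj (star u (modularConj ξ)) := rfl

theorem modularConj_basisVec (g : G) : modularConj (basisVec g) = basisVec g⁻¹ := by
  classical
  ext x
  rw [modularConj_apply, basisVec_apply, basisVec_apply, inv_eq_iff_eq_inv]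
  split_ifs <;> simp

theorem norm_rightOp {u : EllTwo G →L[ℂ] EllTwo G} (hu : u ∈ unitary _) (ξ : EllTwo G) :
    ‖rightOp u ξ‖ = ‖ξ‖ := by
  rw [rightOp_apply, norm_modularConj,
    VonNeumannAlgebra.norm_apply_of_mem_unitary (Unitary.star_mem hu), norm_modularConj]

end EllTwo

/-! ### Elements of `L(G)` as convolution operators with trace vector `δ₁` -/

namespace groupVonNeumannAlgebra

open EllTwo
open scoped InnerProductSpace ComplexConjugate
open Filter Topology

variable {G : Type*} [Group G]

theorem leftOp_mem (g : G) : leftOp g ∈ groupVonNeumannAlgebra G := by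
  rw [← SetLike.mem_coe, groupVonNeumannAlgebra, coe_vonNeumannGenerate]
  exact Set.subset_centralizer_centralizer (Or.inl ⟨g, rfl⟩)

theorem commute_rightTranslation {x : EllTwo G →L[ℂ] EllTwo G} (hx : x ∈ groupVonNeumannAlgebra G)
    (g : G) (ξ : EllTwo G) : x (rightTranslation g ξ) = rightTranslation g (x ξ) := by
  rw [← SetLike.mem_coe, groupVonNeumannAlgebra, coe_vonNeumannGenerate] at hx
  have hcomm : ∀ h : G, leftOp h * rightTranslation g = rightTranslation g * leftOp h := fun h => by
    ext ξ x
    exact congrArg ξ (mul_assoc _ _ _)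
  have hmem : rightTranslation g ∈ (Set.range (fun g : G =>
      (leftTranslation g).toContinuousLinearMap) ∪ star (Set.range fun g : G =>
      (leftTranslation g).toContinuousLinearMap)).centralizer := by
    rintro y (⟨h, rfl⟩ | ⟨h, hh⟩)
    · exact hcomm h
    · have : y = leftOp h⁻¹ := by
        rw [← star_leftOp, ← star_star y]
        exact congrArg star hh.symm
      rw [this]
      exact hcomm _
  exact DFunLike.congr_fun (hx _ hmem).symm ξ

/-- Commutation with right translations makes the matrix of `x` depend on `gh⁻¹` only, so `x` is
determined by the vector `x δ₁` of its Fourier coefficients. -/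
theorem apply_basisVec {x : EllTwo G →L[ℂ] EllTwo G} (hx : x ∈ groupVonNeumannAlgebra G)
    (g h : G) : x (basisVec h) g = x (basisVec 1) (g * h⁻¹) := by
  classical
  have : basisVec h = rightTranslation h⁻¹ (basisVec (1 : G)) := by
    ext y
    rw [rightTranslation_apply, basisVec_apply, basisVec_apply, mul_inv_eq_one]
  rw [this, commute_rightTranslation hx, rightTranslation_apply]

theorem star_apply_basisVec_one {x : EllTwo G →L[ℂ] EllTwo G}
    (hx : x ∈ groupVonNeumannAlgebra G) (g : G) :
    star x (basisVec 1) g = conj (x (basisVec 1) g⁻¹) := by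
  rw [← inner_basisVec_left, VonNeumannAlgebra.inner_star_right, inner_basisVec_right,
    apply_basisVec hx, one_mul]

/-- This carries the trace property: since `J` is isometric, `‖x* δ₁‖ = ‖x δ₁‖`. It also makes `J u*
J` act on `L(G)δ₁` as right multiplication by `u`. -/
theorem star_apply_eq_modularConj {x : EllTwo G →L[ℂ] EllTwo G}
    (hx : x ∈ groupVonNeumannAlgebra G) :
    star x (basisVec 1) = modularConj (x (basisVec 1)) := by
  ext g
  rw [star_apply_basisVec_one hx, modularConj_apply]

/-- The vector `δ_1` is separating. -/
theorem eq_of_apply_eq {x y : EllTwo G →L[ℂ] EllTwo G} (hx : x ∈ groupVonNeumannAlgebra G)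
    (hy : y ∈ groupVonNeumannAlgebra G) (h : x (basisVec 1) = y (basisVec 1)) : x = y := by
  refine continuousLinearMap_ext fun g => ?_
  ext k
  rw [apply_basisVec hx, apply_basisVec hy, h]

theorem eq_zero_of_apply_eq_zero {x : EllTwo G →L[ℂ] EllTwo G}
    (hx : x ∈ groupVonNeumannAlgebra G) (h : x (basisVec 1) = 0) : x = 0 :=
  eq_of_apply_eq hx (zero_mem _) (by simpa using h)

/-- The Fourier coefficients of a product are given by convolution. -/
theorem mul_apply_basisVec_one {x y : EllTwo G →L[ℂ] EllTwo G}
    (hx : x ∈ groupVonNeumannAlgebra G) (g : G) :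
    (x * y) (basisVec 1) g = ∑' k, x (basisVec 1) (g * k⁻¹) * y (basisVec 1) k := by
  rw [← inner_basisVec_left, mul_apply_eq_comp, ← VonNeumannAlgebra.inner_star_left,
    lp.inner_eq_tsum]
  refine tsum_congr fun k => ?_
  rw [apply_basisVec (star_mem hx), star_apply_basisVec_one hx]
  simp [mul_comm]

theorem leftOp_basisVec_one (g : G) : leftOp g (basisVec 1) = basisVec g := by
  classical
  ext x
  rw [leftOp_apply, basisVec_apply, basisVec_apply, inv_mul_eq_one]
  simp only [eq_comm]

theorem mul_leftOp_apply {x : EllTwo G →L[ℂ] EllTwo G} (hx : x ∈ groupVonNeumannAlgebra G)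
    (g k : G) : (x * leftOp g) (basisVec 1) k = x (basisVec 1) (k * g⁻¹) := by
  rw [mul_apply_eq_comp, leftOp_basisVec_one, apply_basisVec hx]

theorem rightOp_apply_eq {x u : EllTwo G →L[ℂ] EllTwo G} (hx : x ∈ groupVonNeumannAlgebra G)
    (hu : u ∈ groupVonNeumannAlgebra G) :
    rightOp u (x (basisVec 1)) = (x * u) (basisVec 1) := by
  rw [rightOp_apply, ← star_apply_eq_modularConj hx, ← mul_apply_eq_comp, ← star_mul,
    ← star_apply_eq_modularConj (star_mem (mul_mem hx hu)), star_star]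

theorem rightOp_basisVec {u : EllTwo G →L[ℂ] EllTwo G} (hu : u ∈ groupVonNeumannAlgebra G)
    (g k : G) : rightOp u (basisVec g) k = u (basisVec 1) (g⁻¹ * k) := by
  rw [rightOp_apply, modularConj_basisVec, modularConj_apply, apply_basisVec (star_mem hu),
    star_apply_basisVec_one hu]
  simp

/-- The elements of `L(G)` with Fourier coefficients supported on a subgroup. -/
def SupportedOn (H : Subgroup G) (x : EllTwo G →L[ℂ] EllTwo G) : Prop :=
  x ∈ groupVonNeumannAlgebra G ∧ ∀ g ∉ H, x (basisVec 1) g = 0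

/-- The matrix entry at `(k, g)` is the coefficient at `kg⁻¹`, which lies outside `H` when exactly
one of `k`, `g` is in `H`. Stated as commutation with one operator, membership in `L(H)` is visibly
stable under products and bicommutants. -/
theorem supportedOn_iff_commute {H : Subgroup G} {x : EllTwo G →L[ℂ] EllTwo G}
    (hx : x ∈ groupVonNeumannAlgebra G) :
    SupportedOn H x ↔ Commute x (cutoff (H : Set G)) := by
  classical
  constructor
  · rintro ⟨-, h⟩
    refine continuousLinearMap_ext fun g => ?_
    ext k
    rw [mul_apply_eq_comp, mul_apply_eq_comp, cutoff_apply]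
    by_cases hg : g ∈ H
    · have h1 : cutoff (H : Set G) (basisVec g) = basisVec g := by
        rw [cutoff_eq_self_iff]
        intro y hy
        rw [basisVec_apply, if_neg]
        rintro rfl
        exact hy hg
      rw [h1]
      split_ifs with hk
      · rfl
      · rw [apply_basisVec hx]
        exact h _ fun hc => hk (by simpa using H.mul_mem hc hg)
    · have h1 : cutoff (H : Set G) (basisVec g) = 0 := by
        ext y
        rw [cutoff_apply, basisVec_apply]
        split_ifs with h1 h2
        · exact absurd (h2 ▸ h1) hg
        · rfl
        · rfl
      rw [h1, map_zero]
      split_ifs with hk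
      · rw [apply_basisVec hx]
        refine (h _ fun hc => hg ?_).symm
        have := H.mul_mem (H.inv_mem hc) hk
        simpa using this
      · rfl
  · intro h
    refine ⟨hx, ?_⟩
    have h1 : cutoff (H : Set G) (basisVec 1) = basisVec 1 := by
      rw [cutoff_eq_self_iff]
      intro y hy
      rw [basisVec_apply, if_neg]
      rintro rfl
      exact hy H.one_mem
    refine cutoff_eq_self_iff.1 ?_
    rw [← mul_apply_eq_comp, ← h.eq, mul_apply_eq_comp, h1]

end groupVonNeumannAlgebra
end

noncomputable section

/-! ### Malnormal subgroups -/

/-- `H` is malnormal in `G`: `gHg⁻¹ ∩ H` is trivial for all `g ∉ H`. -/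
def IsMalnormal {G : Type*} [Group G] (H : Subgroup G) : Prop :=
  ∀ g ∉ H, ∀ h ∈ H, g * h * g⁻¹ ∈ H → h = 1

/-- Every countable subset of `G` lies in a proper malnormal subgroup. -/
def HasMalnormalHulls (G : Type*) [Group G] : Prop :=
  ∀ S : Set G, S.Countable → ∃ H : Subgroup G, IsMalnormal H ∧ H ≠ ⊤ ∧ S ⊆ H

namespace groupVonNeumannAlgebra

open EllTwo
open scoped InnerProductSpace ComplexConjugate
open Filter Topology

variable {G : Type*} [Group G] {H : Subgroup G}

namespace SupportedOn

theorem star {x : EllTwo G →L[ℂ] EllTwo G} (hx : SupportedOn H x) : SupportedOn H (star x) := by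
  refine ⟨star_mem hx.1, fun g hg => ?_⟩
  rw [star_apply_basisVec_one hx.1, hx.2 _ (by simpa using hg), map_zero]

theorem commute_cutoff {x : EllTwo G →L[ℂ] EllTwo G} (hx : SupportedOn H x) :
    Commute x (cutoff (H : Set G)) :=
  (supportedOn_iff_commute hx.1).1 hx

theorem mul {x y : EllTwo G →L[ℂ] EllTwo G} (hx : SupportedOn H x) (hy : SupportedOn H y) :
    SupportedOn H (x * y) :=
  (supportedOn_iff_commute (mul_mem hx.1 hy.1)).2 (hx.commute_cutoff.mul_left hy.commute_cutoff)

theorem add {x y : EllTwo G →L[ℂ] EllTwo G} (hx : SupportedOn H x) (hy : SupportedOn H y) :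
    SupportedOn H (x + y) :=
  (supportedOn_iff_commute (add_mem hx.1 hy.1)).2 (hx.commute_cutoff.add_left hy.commute_cutoff)

theorem smul (c : ℂ) {x : EllTwo G →L[ℂ] EllTwo G} (hx : SupportedOn H x) :
    SupportedOn H (c • x) :=
  ⟨VonNeumannAlgebra.smul_mem' _ c hx.1, fun g hg => by simp [hx.2 g hg]⟩

theorem mem_of_apply_ne_zero {x : EllTwo G →L[ℂ] EllTwo G} (hx : SupportedOn H x) {g : G}
    (h : x (basisVec 1) g ≠ 0) : g ∈ H := by
  by_contra hg
  exact h (hx.2 g hg)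

theorem of_mem_bicommutant {S : Set (EllTwo G →L[ℂ] EllTwo G)} (hS : ∀ y ∈ S, SupportedOn H y)
    {x : EllTwo G →L[ℂ] EllTwo G} (hx : x ∈ S.centralizer.centralizer) : SupportedOn H x := by
  have hxL : x ∈ groupVonNeumannAlgebra G := by
    rw [← SetLike.mem_coe, ← VonNeumannAlgebra.centralizer_centralizer]
    exact Set.centralizer_subset (Set.centralizer_subset fun y hy => (hS y hy).1) hx
  rw [supportedOn_iff_commute hxL]
  exact (hx _ fun y hy => (hS y hy).commute_cutoff.eq).symm

end SupportedOn

theorem one_supportedOn : SupportedOn H (1 : EllTwo G →L[ℂ] EllTwo G) :=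
  .of_mem_bicommutant (S := ∅) (by simp) Set.one_mem_centralizer

theorem exists_supportedOn (hG : HasMalnormalHulls G) {ι : Type*} [Countable ι]
    (x : ι → EllTwo G →L[ℂ] EllTwo G) (hx : ∀ i, x i ∈ groupVonNeumannAlgebra G) :
    ∃ H : Subgroup G, IsMalnormal H ∧ H ≠ ⊤ ∧ ∀ i, SupportedOn H (x i) := by
  obtain ⟨H, hH, hne, hS⟩ := hG (⋃ i, {g | x i (basisVec 1) g ≠ 0})
    (Set.countable_iUnion fun i => countable_support _)
  refine ⟨H, hH, hne, fun i => ⟨hx i, fun g hg => ?_⟩⟩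
  by_contra hc
  exact hg (hS (Set.mem_iUnion.2 ⟨i, hc⟩))

theorem modularConj_cutoff (ξ : EllTwo G) :
    modularConj (cutoff (H : Set G) ξ) = cutoff (H : Set G) (modularConj ξ) := by
  ext g
  rw [modularConj_apply, cutoff_apply, cutoff_apply, modularConj_apply]
  by_cases hg : g ∈ H
  · rw [if_pos (show g ∈ (H : Set G) from hg), if_pos (show g⁻¹ ∈ (H : Set G) from H.inv_mem hg)]
  · rw [if_neg (show g ∉ (H : Set G) from hg),
      if_neg (show g⁻¹ ∉ (H : Set G) from fun h => hg (inv_mem_iff.1 h)), map_zero]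

theorem rightOp_cutoff {u : EllTwo G →L[ℂ] EllTwo G} (hu : SupportedOn H u) (ξ : EllTwo G) :
    rightOp u (cutoff (H : Set G) ξ) = cutoff (H : Set G) (rightOp u ξ) := by
  rw [rightOp_apply, rightOp_apply, modularConj_cutoff, ← mul_apply_eq_comp,
    hu.star.commute_cutoff.eq, mul_apply_eq_comp, modularConj_cutoff]

/-- The inner product is a sum over `gH ∩ Hg'`. If `k` and `l` both lie there, then `h = g⁻¹lk⁻¹g`
and `ghg⁻¹ = lk⁻¹` are in `H`, so `k = l` by malnormality. At most one term survives: a coefficient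
of `w n`, bounded by `1`, times a fixed coefficient of `u n`, which tends to `0`. -/
theorem tendsto_inner_basisVec (hH : IsMalnormal H) {u w : ℕ → EllTwo G →L[ℂ] EllTwo G}
    (hu : ∀ n, SupportedOn H (u n)) (hw : ∀ n, SupportedOn H (w n))
    (hwU : ∀ n, w n ∈ unitary (EllTwo G →L[ℂ] EllTwo G))
    (hlim : ∀ η, Tendsto (fun n => ⟪u n (basisVec 1), η⟫_ℂ) atTop (𝓝 0)) {g g' : G}
    (hg : g ∉ H) :
    Tendsto (fun n => ⟪w n (basisVec g'), rightOp (u n) (basisVec g)⟫_ℂ) atTop (𝓝 0) := by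
  have hterm : ∀ n, ⟪w n (basisVec g'), rightOp (u n) (basisVec g)⟫_ℂ =
      ∑' k, conj (w n (basisVec 1) (k * g'⁻¹)) * u n (basisVec 1) (g⁻¹ * k) := by
    intro n
    rw [lp.inner_eq_tsum]
    refine tsum_congr fun k => ?_
    rw [apply_basisVec (hw n).1, rightOp_basisVec (hu n).1]
    simp [mul_comm]
  simp_rw [hterm]
  by_cases hk : ∃ k, g⁻¹ * k ∈ H ∧ k * g'⁻¹ ∈ H
  · obtain ⟨k, hk1, hk2⟩ := hk
    have huniq : ∀ l, l ≠ k → ∀ n,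
        conj (w n (basisVec 1) (l * g'⁻¹)) * u n (basisVec 1) (g⁻¹ * l) = 0 := by
      intro l hl n
      by_contra hne
      have h1 := (hu n).mem_of_apply_ne_zero (right_ne_zero_of_mul hne)
      have h2 := (hw n).mem_of_apply_ne_zero
        (fun h => left_ne_zero_of_mul hne (by rw [h, map_zero]))
      have h3 := hH g hg ((g⁻¹ * l) * (g⁻¹ * k)⁻¹) (H.mul_mem h1 (H.inv_mem hk1)) (by
        have := H.mul_mem h2 (H.inv_mem hk2)
        convert this using 1
        group)
      apply hl
      rw [mul_inv_eq_one] at h3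
      exact mul_left_cancel h3
    refine Tendsto.congr (fun n => (tsum_eq_single k fun l hl => huniq l hl n).symm) ?_
    have h1 := hlim (basisVec (g⁻¹ * k))
    simp_rw [inner_basisVec_right] at h1
    rw [tendsto_zero_iff_norm_tendsto_zero] at h1 ⊢
    refine squeeze_zero (fun n => norm_nonneg _) (fun n => ?_) h1
    rw [norm_mul, RCLike.norm_conj, RCLike.norm_conj]
    refine mul_le_of_le_one_left (norm_nonneg _) ((norm_apply_le _ _).trans ?_)
    rw [VonNeumannAlgebra.norm_apply_of_mem_unitary (hwU n), norm_basisVec]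
  · have hz : ∀ n l, conj (w n (basisVec 1) (l * g'⁻¹)) * u n (basisVec 1) (g⁻¹ * l) = 0 := by
      intro n l
      by_contra hne
      exact hk ⟨l, (hu n).mem_of_apply_ne_zero (right_ne_zero_of_mul hne),
        (hw n).mem_of_apply_ne_zero (fun h => left_ne_zero_of_mul hne (by rw [h, map_zero]))⟩
    simp [hz]

/-- An element that intertwines a weakly null sequence of unitaries of `L(H)` with unitaries of
`L(H)` lies in `L(H)`, for malnormal `H`. -/
theorem supportedOn_of_intertwines (hH : IsMalnormal H) {u w : ℕ → EllTwo G →L[ℂ] EllTwo G}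
    (hu : ∀ n, SupportedOn H (u n)) (huU : ∀ n, u n ∈ unitary (EllTwo G →L[ℂ] EllTwo G))
    (hw : ∀ n, SupportedOn H (w n)) (hwU : ∀ n, w n ∈ unitary (EllTwo G →L[ℂ] EllTwo G))
    (hlim : ∀ η, Tendsto (fun n => ⟪u n (basisVec 1), η⟫_ℂ) atTop (𝓝 0))
    {x : EllTwo G →L[ℂ] EllTwo G} (hx : x ∈ groupVonNeumannAlgebra G)
    (hxu : ∀ n, x * u n = w n * x) : SupportedOn H x := by
  set ξ := x (basisVec 1) with hξ
  -- The part of `x δ₁` off `H`, which has to vanish. Cutting off commutes with left and right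
  -- multiplication by elements of `L(H)`, so `ξ'` inherits the intertwining relation.
  set ξ' := ξ - cutoff (H : Set G) ξ with hξ'
  have hintertw : ∀ n, rightOp (u n) ξ' = w n ξ' := by
    intro n
    have h1 : rightOp (u n) ξ = w n ξ := by
      rw [hξ, rightOp_apply_eq hx (hu n).1, hxu n, mul_apply_eq_comp]
    rw [hξ', map_sub, map_sub, rightOp_cutoff (hu n), h1, ← mul_apply_eq_comp (w n) (cutoff (H : Set G)),
      (hw n).commute_cutoff.eq, mul_apply_eq_comp]
  have hmem : ξ' ∈ (Submodule.span ℂ (basisVec '' (H : Set G)ᶜ)).topologicalClosure := by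
    refine mem_closure_span_of_support fun g hg => ?_
    have hg' : g ∈ (H : Set G) := by simpa using hg
    change ξ g - cutoff (H : Set G) ξ g = 0
    rw [cutoff_apply, if_pos hg', sub_self]
  have hnorm : ∀ n η, ‖star (rightOp (u n)) η‖ ≤ ‖η‖ := by
    intro n η
    have h1 : ‖star (rightOp (u n))‖ ≤ 1 := by
      rw [ContinuousLinearMap.star_eq_adjoint, LinearIsometryEquiv.norm_map]
      exact ContinuousLinearMap.opNorm_le_bound _ zero_le_one fun ζ => by
        rw [norm_rightOp (huU n), one_mul]
    simpa using (star (rightOp (u n))).le_of_opNorm_le h1 η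
  -- The decay known for basis vectors is extended to `ξ'` one variable at a time: first on the side
  -- of `u n`, then on the side of `w n`. Unitarity gives the uniform bounds.
  have step : ∀ g' : G, Tendsto (fun n => ⟪w n (basisVec g'), rightOp (u n) ξ'⟫_ℂ) atTop (𝓝 0) := by
    intro g'
    have := VonNeumannAlgebra.tendsto_inner_zero_of_mem_closure
      (v := fun n => star (rightOp (u n)) (w n (basisVec g'))) (C := 1) (fun n => by
        refine (hnorm n _).trans ?_
        rw [VonNeumannAlgebra.norm_apply_of_mem_unitary (hwU n), norm_basisVec])
      (S := basisVec '' (H : Set G)ᶜ) (by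
        rintro _ ⟨g, hg, rfl⟩
        simp_rw [VonNeumannAlgebra.inner_star_left]
        exact tendsto_inner_basisVec hH hu hw hwU hlim hg) hmem
    simpa only [VonNeumannAlgebra.inner_star_left] using this
  have hfin := VonNeumannAlgebra.tendsto_inner_zero_of_mem_closure
      (v := fun n => Star.star (w n) (rightOp (u n) ξ')) (C := ‖ξ'‖) (fun n => by
        rw [VonNeumannAlgebra.norm_apply_of_mem_unitary (Unitary.star_mem (hwU n)),
          norm_rightOp (huU n)])
      (S := basisVec '' (H : Set G)ᶜ) (by
        rintro _ ⟨g, hg, rfl⟩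
        simp_rw [VonNeumannAlgebra.inner_star_left]
        have h1 := (Complex.continuous_conj.tendsto _).comp (step g)
        simpa [Function.comp_def, inner_conj_symm] using h1) hmem
  -- By the intertwining relation the sequence that tends to `0` is constantly `‖ξ'‖²`.
  have hconst : ∀ n, ⟪Star.star (w n) (rightOp (u n) ξ'), ξ'⟫_ℂ = ⟪ξ', ξ'⟫_ℂ := by
    intro n
    rw [hintertw, ← mul_apply_eq_comp, Unitary.star_mul_self_of_mem (hwU n), one_apply_eq_self]
  simp_rw [hconst] at hfin
  have hzero : ξ' = 0 := by
    exact inner_self_eq_zero.1 (tendsto_nhds_unique tendsto_const_nhds hfin)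
  refine ⟨hx, cutoff_eq_self_iff.1 ?_⟩
  exact (sub_eq_zero.1 hzero).symm

/-- Malnormality makes the decomposition `agb` of an element of the double coset `HgH` unique, so
the convolution has a single nonzero term. -/
theorem mul_leftOp_mul_apply (hH : IsMalnormal H) {x y : EllTwo G →L[ℂ] EllTwo G}
    (hx : SupportedOn H x) (hy : SupportedOn H y) {g : G} (hg : g ∉ H) {a b : G} (ha : a ∈ H) (hb : b ∈ H) :
    (x * leftOp g * y) (basisVec 1) (a * g * b) = x (basisVec 1) a * y (basisVec 1) b := by
  rw [mul_assoc x, mul_apply_basisVec_one hx.1, tsum_eq_single (g * b)]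
  · rw [mul_apply_eq_comp, leftOp_apply]
    congr 2 <;> group
  · intro k hk
    by_contra hne
    have h1 := hx.mem_of_apply_ne_zero (left_ne_zero_of_mul hne)
    have h2 := right_ne_zero_of_mul hne
    rw [mul_apply_eq_comp, leftOp_apply] at h2
    have h3 := hy.mem_of_apply_ne_zero h2
    have h4 := hH g hg (b * (g⁻¹ * k)⁻¹) (H.mul_mem hb (H.inv_mem h3)) (by
      have := H.mul_mem (H.inv_mem ha) h1
      convert this using 1
      group)
    rw [mul_inv_eq_one] at h4
    exact hk (by rw [h4]; group)

/-! ### The type II₁ factor property -/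

theorem isFactor (hG : HasMalnormalHulls G) : (groupVonNeumannAlgebra G).IsFactor := by
  classical
  refine ⟨fun h => ?_, fun x hx hx' => ?_⟩
  · have h1 : basisVec (1 : G) = 0 := by
      rw [← one_apply_eq_self (F := EllTwo G →L[ℂ] EllTwo G) (basisVec (1 : G)), h]
      rfl
    have := norm_basisVec (1 : G)
    rw [h1] at this
    simp at this
  · obtain ⟨H, hH, hne, hs⟩ := exists_supportedOn hG (fun _ : Unit => x) fun _ => hx
    obtain ⟨g, hg⟩ : ∃ g, g ∉ H := by
      by_contra! h
      exact hne (eq_top_iff.2 fun g _ => h g)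
    refine ⟨x (basisVec 1) 1, eq_of_apply_eq hx
      (VonNeumannAlgebra.smul_mem' _ _ (one_mem _)) ?_⟩
    ext k
    change x (basisVec 1) k = x (basisVec 1) 1 * basisVec 1 k
    rw [basisVec_apply]
    split_ifs with hk
    · rw [hk, mul_one]
    · rw [mul_zero]
      by_contra hc
      have hkH := (hs ()).mem_of_apply_ne_zero hc
      -- Commuting with `λ_g` makes the coefficients at `k` and `g⁻¹kg` agree. If they are nonzero,
      -- both elements are in `H`, and `g ∉ H` forces `k = 1`.
      have h1 := VonNeumannAlgebra.mem_commutant_iff.1 hx' _ (leftOp_mem g)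
      have h2 := DFunLike.congr_fun h1 (basisVec 1)
      have h3 : (leftOp g * x) (basisVec 1) (k * g) = (x * leftOp g) (basisVec 1) (k * g) := by
        rw [h2]
      rw [mul_leftOp_apply hx, mul_inv_cancel_right, mul_apply_eq_comp, leftOp_apply] at h3
      rw [← h3] at hc
      have h4 := (hs ()).mem_of_apply_ne_zero hc
      have h5 := hH g hg _ h4 (by convert hkH using 1; group)
      apply hk
      have : k = g * (g⁻¹ * (k * g)) * g⁻¹ := by group
      rw [this, h5]
      group

/-- For an isometry `v` the trace property gives `‖v* δ₁‖ = ‖v δ₁‖ = ‖δ₁‖`. So the projection `1 -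
vv*` kills the separating vector `δ₁`. -/
theorem isFiniteType : (groupVonNeumannAlgebra G).IsFiniteType := by
  intro v hv h
  have hp : IsStarProjection (1 - v * star v) := by
    refine IsStarProjection.one_sub ⟨?_, ?_⟩
    · change v * star v * (v * star v) = v * star v
      rw [mul_assoc, ← mul_assoc (star v), h, one_mul]
    · rw [isSelfAdjoint_iff, star_mul, star_star]
  have hn1 : ‖v (basisVec 1)‖ = ‖basisVec (1 : G)‖ := by
    have : ⟪v (basisVec 1), v (basisVec 1)⟫_ℂ = ⟪basisVec (1 : G), basisVec 1⟫_ℂ := by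
      rw [← VonNeumannAlgebra.inner_star_right, ← mul_apply_eq_comp, h, one_apply_eq_self]
    rw [@norm_eq_sqrt_re_inner ℂ, this, ← @norm_eq_sqrt_re_inner ℂ]
  have hn2 : ‖star v (basisVec 1)‖ = ‖basisVec (1 : G)‖ := by
    rw [star_apply_eq_modularConj hv, norm_modularConj, hn1]
  have hz : (1 - v * star v) (basisVec (1 : G)) = 0 := by
    rw [← inner_self_eq_zero (𝕜 := ℂ), ← VonNeumannAlgebra.inner_star_right,
      hp.isSelfAdjoint.star_eq, ← mul_apply_eq_comp, hp.isIdempotentElem.eq, sub_apply,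
      inner_sub_right, mul_apply_eq_comp, one_apply_eq_self]
    have : ⟪basisVec (1 : G), v (star v (basisVec 1))⟫_ℂ =
        ⟪star v (basisVec 1), star v (basisVec (1 : G))⟫_ℂ := by
      rw [VonNeumannAlgebra.inner_star_left]
    rw [this, inner_self_eq_norm_sq_to_K, inner_self_eq_norm_sq_to_K, hn2, sub_self]
  have := eq_zero_of_apply_eq_zero (sub_mem (one_mem _) (mul_mem hv (star_mem hv))) hz
  exact (sub_eq_zero.1 this).symm

theorem exists_apply_ne_zero {x : EllTwo G →L[ℂ] EllTwo G} (hx : x ∈ groupVonNeumannAlgebra G)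
    (h : x ≠ 0) : ∃ g, x (basisVec 1) g ≠ 0 := by
  by_contra! hc
  exact h (eq_zero_of_apply_eq_zero hx (lp.ext (funext hc)))

/-- Two hulls are used: `H` contains the support of `p`, and `K` contains that support together with
some `g ∉ H`. For `k ∉ K` the corner elements `pλ_gp` and `pλ_kp` do not commute, as the coefficient
of their two products at `(aga)k(a)` shows, where `a` is in the support of `p`. -/
theorem not_isNonzeroAbelianProjection (hG : HasMalnormalHulls G) (p : EllTwo G →L[ℂ] EllTwo G) :
    ¬ (groupVonNeumannAlgebra G).IsNonzeroAbelianProjection p := by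
  rintro ⟨hp, hpr, hp0, hab⟩
  obtain ⟨H, hH, hHne, hHp⟩ := exists_supportedOn hG (fun _ : Unit => p) fun _ => hp
  obtain ⟨g, hg⟩ : ∃ g, g ∉ H := by
    by_contra! h
    exact hHne (eq_top_iff.2 fun g _ => h g)
  obtain ⟨K, hK, hKne, hKp⟩ := exists_supportedOn hG (fun b : Bool => if b then p else leftOp g)
    (fun b => by cases b <;> simp [hp, leftOp_mem])
  have hKp' : SupportedOn K p := by simpa using hKp true
  have hKg : SupportedOn K (leftOp g) := by simpa using hKp false
  obtain ⟨k, hk⟩ : ∃ k, k ∉ K := by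
    by_contra! h
    exact hKne (eq_top_iff.2 fun g _ => h g)
  obtain ⟨a, ha⟩ := exists_apply_ne_zero hp hp0
  have haH := (hHp ()).mem_of_apply_ne_zero ha
  have haK := hKp'.mem_of_apply_ne_zero ha
  set X := p * leftOp g * p with hX
  have hXK : SupportedOn K X := (hKp'.mul hKg).mul hKp'
  have hXa : X (basisVec 1) (a * g * a) ≠ 0 := by
    rw [hX, mul_leftOp_mul_apply hH (hHp ()) (hHp ()) hg haH haH]
    exact mul_ne_zero ha ha
  have hbK := hXK.mem_of_apply_ne_zero hXa
  have hpp : p * p = p := hpr.isIdempotentElem.eq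
  have hcomm := hab _ (leftOp_mem g) _ (leftOp_mem k)
  have e1 : (p * leftOp g * p) * (p * leftOp k * p) = X * leftOp k * p := by
    rw [hX]; simp only [mul_assoc]; rw [← mul_assoc p p, hpp]
  have e2 : (p * leftOp k * p) * (p * leftOp g * p) = p * leftOp k * X := by
    rw [hX]; simp only [mul_assoc]; rw [← mul_assoc p p, hpp]
  rw [e1, e2] at hcomm
  have h3 : (X * leftOp k * p) (basisVec 1) (a * g * a * k * a) =
      (p * leftOp k * X) (basisVec 1) (a * g * a * k * a) := by rw [hcomm]
  -- Uniqueness of decompositions in `KkK` turns both sides into products: `X(aga) p(a)`, which is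
  -- nonzero, and `p(aga) X(a)`, which vanishes since `aga ∉ H`.
  rw [mul_leftOp_mul_apply hK hXK hKp' hk hbK haK, mul_leftOp_mul_apply hK hKp' hXK hk hbK haK] at h3
  have h4 : p (basisVec 1) (a * g * a) = 0 := by
    refine (hHp ()).2 _ fun hc => hg ?_
    have := H.mul_mem (H.mul_mem (H.inv_mem haH) hc) (H.inv_mem haH)
    convert this using 1
    group
  rw [h4, zero_mul] at h3
  exact mul_ne_zero hXa ha h3

theorem isIIOneFactor (hG : HasMalnormalHulls G) : (groupVonNeumannAlgebra G).IsIIOneFactor :=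
  ⟨isFactor hG, isFiniteType, not_isNonzeroAbelianProjection hG⟩

end groupVonNeumannAlgebra
end

noncomputable section

/-! ### Malnormality in iterated wreath products -/

namespace IteratedWreath


variable {α : Ordinal.{u}} (Γ : Set.Iio α → Type v) [∀ β, Group (Γ β)]

/-- Induction along the stages. -/
theorem induction_stage {P : IteratedWreath Γ → Prop} (h1 : P 1)
    (hs : ∀ β : Set.Iio α, (∀ g ∈ stage Γ β.1, P g) →
      ∀ g ∈ stage Γ (Order.succ β.1), g ∉ stage Γ β.1 → P g) (g : IteratedWreath Γ) : P g := by
  have key : ∀ γ : Ordinal.{u}, γ ≤ α → ∀ g ∈ stage Γ γ, P g := by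
    intro γ
    induction γ using WellFoundedLT.induction with
    | ind γ ih =>
      intro hγ g hg
      rcases Ordinal.zero_or_succ_or_isSuccLimit γ with rfl | ⟨δ, rfl⟩ | hlim
      · rw [stage_zero, Subgroup.mem_bot] at hg
        rwa [hg]
      · have hδ : δ < Order.succ δ := Order.lt_succ δ
        have ih' := ih δ hδ (hδ.le.trans hγ)
        by_cases hgδ : g ∈ stage Γ δ
        · exact ih' g hgδ
        · exact hs ⟨δ, hδ.trans_le hγ⟩ ih' g hg hgδ
      · rw [← SetLike.mem_coe, stage_limit Γ hlim] at hg
        obtain ⟨δ, hδ, hgδ⟩ := Set.mem_iUnion₂.1 hg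
        exact ih δ hδ (hδ.le.trans hγ) g hgδ
  exact key α le_rfl g (by rw [stage_top]; trivial)

/-- Let `g` first appear in `Γ_β ≀ G_β`. Its image in `G_β` has finite order, hence is trivial by
induction; then `g` is in the base group, where powers are computed coordinatewise in the
torsion-free `Γ_β`. -/
theorem eq_one_of_pow_eq_one (htf : ∀ β, ∀ g : Γ β, g ≠ 1 → ¬ IsOfFinOrder g)
    (g : IteratedWreath Γ) : ∀ n : ℕ, 0 < n → g ^ n = 1 → g = 1 := by
  induction g using induction_stage with
  | h1 => intros; rfl
  | hs β ih g hg _ =>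
    intro n hn hpow
    obtain ⟨e, -, -⟩ := stage_succ Γ β
    set w := e ⟨g, hg⟩ with hw
    have hwn : w ^ n = 1 := by
      rw [hw, ← map_pow, show (⟨g, hg⟩ : stage Γ (Order.succ β.1)) ^ n = 1 from
        Subtype.ext hpow, map_one]
    have hright : w.1.right = 1 := by
      have h1 : (wreathProduct.toRight w) ^ n = 1 := by rw [← map_pow, hwn, map_one]
      refine Subtype.ext (ih _ (wreathProduct.toRight w).2 n hn ?_)
      exact congrArg Subtype.val h1
    have hleft : ∀ m x, (w.1 ^ m).left x = (w.1.left x) ^ m ∧ (w.1 ^ m).right = 1 := by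
      intro m x
      induction m with
      | zero => simp
      | succ m ih =>
        rw [pow_succ, pow_succ, RegularWreathProduct.mul_left, RegularWreathProduct.mul_right,
          ih.2, hright]
        simp [ih.1]
    have hw1 : w = 1 := by
      apply Subtype.ext
      ext x
      · have h2 : (w.1.left x) ^ n = 1 := by
          rw [← (hleft n x).1]
          have : w.1 ^ n = 1 := congrArg Subtype.val hwn
          rw [this]
          rfl
        by_contra hne
        exact htf β _ hne (isOfFinOrder_iff_pow_eq_one.2 ⟨n, hn, h2⟩)
      · exact congrArg Subtype.val hright
    have := (map_eq_one_iff e e.injective).1 hw1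
    exact congrArg Subtype.val this

/-- For `g` in `G_{δ+1}` but not in `G_δ`, with `β ≤ δ`, the base part of `g` is a nontrivial
function of finite support on `G_δ`. The relation `gh = h'g` with `h, h' ∈ G_β` makes it invariant
under translation by `h'`. A free action with a finite invariant set forces `h'` to have finite
order, so `h' = 1`. -/
theorem isMalnormal_stage (htf : ∀ β, ∀ g : Γ β, g ≠ 1 → ¬ IsOfFinOrder g) (β : Ordinal.{u}) :
    IsMalnormal (stage Γ β) := by
  intro g
  induction g using induction_stage with
  | h1 => exact fun h => absurd (one_mem _) h
  | hs δ _ g hg hgδ =>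
    intro hgβ h hh hconj
    have hβδ : β ≤ δ.1 := by
      by_contra hlt
      exact hgβ (stage_mono Γ (Order.succ_le_of_lt (not_le.1 hlt)) hg)
    obtain ⟨e, he, -⟩ := stage_succ Γ δ
    have hle := stage_mono Γ (Order.le_succ δ.1)
    set w := e ⟨g, hg⟩ with hw
    let k : stage Γ δ.1 := ⟨h, stage_mono Γ hβδ hh⟩
    let k' : stage Γ δ.1 := ⟨g * h * g⁻¹, stage_mono Γ hβδ hconj⟩
    have hmul : w * wreathProduct.ofRight k = wreathProduct.ofRight k' * w := by
      rw [← he, ← he, hw, ← map_mul, ← map_mul]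
      congr 1
      apply Subtype.ext
      change g * h = g * h * g⁻¹ * g
      group
    -- Comparison of base parts: multiplying by `k` on the right does not change the base part,
    -- while multiplying by `k'` on the left translates it.
    have hinv : ∀ x, w.1.left x = w.1.left (k'⁻¹ * x) := by
      intro x
      have h1 : (w * wreathProduct.ofRight k).1.left x =
          (wreathProduct.ofRight k' * w).1.left x := by rw [hmul]
      simpa [wreathProduct.ofRight] using h1
    obtain ⟨x₀, hx₀⟩ : ∃ x, w.1.left x ≠ 1 := by
      by_contra! hc
      refine hgδ ?_
      have h1 : w = wreathProduct.ofRight w.1.right := by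
        apply Subtype.ext
        ext x
        · exact hc x
        · rfl
      rw [← he, hw] at h1
      have h2 := congrArg Subtype.val (e.injective h1)
      change g = _ at h2
      rw [h2]
      exact w.1.right.2
    have hmem : ∀ n : ℕ, (k'⁻¹) ^ n * x₀ ∈ Function.mulSupport w.1.left := by
      intro n
      induction n with
      | zero => simpa using hx₀
      | succ n ih =>
        rw [pow_succ', mul_assoc, Function.mem_mulSupport, ← hinv]
        exact ih
    have hfin : Finite (Function.mulSupport w.1.left) := Set.Finite.to_subtype w.2
    obtain ⟨m, n, hmn, heq⟩ : ∃ m n : ℕ, m < n ∧ (k'⁻¹) ^ m = (k'⁻¹) ^ n := by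
      have hni := not_injective_infinite_finite
        (fun n : ℕ => (⟨(k'⁻¹) ^ n * x₀, hmem n⟩ : Function.mulSupport w.1.left))
      simp only [Function.Injective, not_forall] at hni
      obtain ⟨m, n, h1, h2⟩ := hni
      have h3 := mul_right_cancel (congrArg Subtype.val h1)
      rcases lt_or_gt_of_ne h2 with h4 | h4
      · exact ⟨m, n, h4, h3⟩
      · exact ⟨n, m, h4, h3.symm⟩
    have hk' : k'⁻¹ ^ (n - m) = 1 := by
      have := pow_sub_mul_pow k'⁻¹ hmn.le
      rw [← heq] at this
      simpa using this
    have h5 : (g * h * g⁻¹)⁻¹ = 1 :=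
      eq_one_of_pow_eq_one Γ htf _ (n - m) (by omega) (congrArg Subtype.val hk')
    rw [inv_eq_one, mul_inv_eq_one, mul_eq_left] at h5
    exact h5

theorem of_notMem_stage (β : Set.Iio α) {x : Γ β} (hx : x ≠ 1) : of Γ β x ∉ stage Γ β.1 := by
  intro h
  obtain ⟨e, he, hb⟩ := stage_succ Γ β
  have h1 := hb x
  have h2 := he ⟨_, h⟩
  have h3 : wreathProduct.ofBase x = (wreathProduct.ofRight ⟨_, h⟩ :
      wreathProduct (Γ β) (stage Γ β.1)) := by rw [← h1, ← h2]; rfl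
  have h4 := congrArg (fun a : wreathProduct (Γ β) (stage Γ β.1) => a.1.left 1) h3
  simp [wreathProduct.ofBase, wreathProduct.ofRight] at h4
  exact hx h4

theorem hasMalnormalHulls (hlim : Order.IsSuccLimit α) (hcof : Cardinal.aleph0 < α.cof)
    (hnt : ∀ β, Nontrivial (Γ β)) (htf : ∀ β, ∀ g : Γ β, g ≠ 1 → ¬ IsOfFinOrder g) :
    HasMalnormalHulls (IteratedWreath Γ) := by
  intro S hS
  have hex : ∀ g : IteratedWreath Γ, ∃ γ < α, g ∈ stage Γ γ := by
    intro g
    have hg : g ∈ (stage Γ α : Set (IteratedWreath Γ)) := by rw [stage_top]; trivial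
    rw [stage_limit Γ hlim] at hg
    simpa using hg
  choose γ hγ hmem using hex
  -- Adding `1` makes the set nonempty, so that a sequence enumerates it.
  obtain ⟨f, hf⟩ := (hS.insert 1).exists_eq_range (Set.insert_nonempty _ _)
  have hsup : ⨆ n, γ (f n) < α := by
    refine Ordinal.lift_iSup_lt_of_lt_cof ?_ fun n => hγ _
    simpa using hcof
  set δ : Set.Iio α := ⟨⨆ n, γ (f n), hsup⟩
  refine ⟨stage Γ δ.1, isMalnormal_stage Γ htf δ.1, fun htop => ?_, fun g hg => ?_⟩
  · obtain ⟨x, hx⟩ := exists_ne (1 : Γ δ)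
    exact of_notMem_stage Γ δ hx (by rw [htop]; trivial)
  · obtain ⟨n, rfl⟩ : g ∈ Set.range f := hf ▸ Set.mem_insert_of_mem _ hg
    exact stage_mono Γ (Ordinal.le_iSup (fun n => γ (f n)) n) (hmem (f n))

end IteratedWreath
end

noncomputable section

open scoped TensorProduct

/-! ### Tensor products of von Neumann algebras -/

section Generate

variable {K : Type*} [NormedAddCommGroup K] [InnerProductSpace ℂ K] [CompleteSpace K]

theorem subset_vonNeumannGenerate {S : Set (K →L[ℂ] K)} {x : K →L[ℂ] K} (hx : x ∈ S) :
    x ∈ vonNeumannGenerate S := by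
  rw [← SetLike.mem_coe, coe_vonNeumannGenerate]
  exact Set.subset_centralizer_centralizer (Or.inl hx)

theorem commute_of_mem_vonNeumannGenerate {S : Set (K →L[ℂ] K)} (hS : ∀ y ∈ S, star y ∈ S)
    {x z : K →L[ℂ] K} (hx : x ∈ vonNeumannGenerate S) (hz : ∀ y ∈ S, Commute y z) :
    Commute x z := by
  rw [← SetLike.mem_coe, coe_vonNeumannGenerate] at hx
  refine (hx z ?_).symm
  rintro y (hy | hy)
  · exact (hz y hy).eq
  · exact (hz y (by simpa using hS _ hy)).eq

theorem mem_commutant_vonNeumannGenerate {S : Set (K →L[ℂ] K)} (hS : ∀ y ∈ S, star y ∈ S)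
    {z : K →L[ℂ] K} : z ∈ (vonNeumannGenerate S).commutant ↔ ∀ y ∈ S, Commute y z := by
  rw [VonNeumannAlgebra.mem_commutant_iff]
  exact ⟨fun h y hy => h y (subset_vonNeumannGenerate hy),
    fun h x hx => commute_of_mem_vonNeumannGenerate hS hx h⟩

end Generate

namespace VonNeumannAlgebra

open scoped InnerProductSpace

variable {H₁ H₂ H : Type*} [NormedAddCommGroup H₁] [InnerProductSpace ℂ H₁] [CompleteSpace H₁]
  [NormedAddCommGroup H₂] [InnerProductSpace ℂ H₂] [CompleteSpace H₂]
  [NormedAddCommGroup H] [InnerProductSpace ℂ H] [CompleteSpace H]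

/-- An operator on a tensor product `H` of `H₁` and `H₂` (with elementary tensors `V ξ η = W η ξ`
and amplifications `L₁`, `L₂`) that commutes with `M₁' ⊗ 1`, `1 ⊗ M₂` and `1 ⊗ M₂'` lies in
`M₁ ⊗ 1` if `M₂` is a factor. -/
theorem exists_eq_amplification (V : H₁ → H₂ →L[ℂ] H) (W : H₂ → H₁ →L[ℂ] H)
    (hVW : ∀ ξ η, V ξ η = W η ξ)
    (hinner : ∀ ξ η ξ' η', ⟪V ξ η, V ξ' η'⟫_ℂ = ⟪ξ, ξ'⟫_ℂ * ⟪η, η'⟫_ℂ)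
    (htotal : ∀ x y : H, (∀ ξ η, ⟪V ξ η, x⟫_ℂ = ⟪V ξ η, y⟫_ℂ) → x = y)
    (L₁ : (H₁ →L[ℂ] H₁) → H →L[ℂ] H) (L₂ : (H₂ →L[ℂ] H₂) → H →L[ℂ] H)
    (hL₁ : ∀ a ξ η, L₁ a (V ξ η) = V (a ξ) η) (hL₂ : ∀ b ξ η, L₂ b (V ξ η) = V ξ (b η))
    (hstar₁ : ∀ a, star (L₁ a) = L₁ (star a)) (hstar₂ : ∀ b, star (L₂ b) = L₂ (star b))
    (M₁ : VonNeumannAlgebra H₁) {M₂ : VonNeumannAlgebra H₂} (hM₂ : M₂.IsFactor) {T : H →L[ℂ] H}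
    (h₁ : ∀ a ∈ M₁.commutant, Commute T (L₁ a)) (h₂ : ∀ b ∈ M₂, Commute T (L₂ b))
    (h₂' : ∀ b ∈ M₂.commutant, Commute T (L₂ b)) : ∃ S ∈ M₁, T = L₁ S := by
  obtain ⟨η₀, hη₀⟩ : ∃ η₀ : H₂, ‖η₀‖ = 1 := by
    have : Nontrivial H₂ := by
      by_contra hn
      rw [not_nontrivial_iff_subsingleton] at hn
      exact hM₂.1 (ContinuousLinearMap.ext fun x => Subsingleton.elim _ _)
    exact exists_norm_eq H₂ zero_le_one
  have hη₀' : ⟪η₀, η₀⟫_ℂ = 1 := by rw [inner_self_eq_norm_sq_to_K, hη₀]; simp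
  -- The slice of `T` at `ξ, ξ'` commutes with `M₂` and with `M₂'`, so it lies in the centre of `M₂`
  -- and is scalar. No form of the commutation theorem for tensor products is needed.
  have hslice : ∀ ξ ξ', ∃ c : ℂ, ∀ η η', ⟪V ξ' η', T (V ξ η)⟫_ℂ = c * ⟪η', η⟫_ℂ := by
    intro ξ ξ'
    let B : H₂ →L[ℂ] H₂ := (V ξ').adjoint ∘L T ∘L V ξ
    have hB : ∀ η η', ⟪η', B η⟫_ℂ = ⟪V ξ' η', T (V ξ η)⟫_ℂ := fun η η' => by
      change ⟪η', (V ξ').adjoint (T (V ξ η))⟫_ℂ = _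
      rw [ContinuousLinearMap.adjoint_inner_right]
    have hcomm : ∀ b, Commute T (L₂ b) → Commute B b := by
      intro b hb
      refine ContinuousLinearMap.ext fun η => ext_inner_left ℂ fun η' => ?_
      rw [mul_apply_eq_comp, mul_apply_eq_comp, hB, ← inner_star_left b η', hB, ← hL₂, ← hL₂,
        ← hstar₂, inner_star_left, ← mul_apply_eq_comp, ← mul_apply_eq_comp, hb.eq]
    obtain ⟨c, hc⟩ := hM₂.2 B (mem_of_forall_commute fun b hb => hcomm b (h₂' b hb))
      (mem_commutant_iff.2 fun b hb => (hcomm b (h₂ b hb)).eq.symm)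
    refine ⟨c, fun η η' => ?_⟩
    rw [← hB, hc, smul_apply, one_apply_eq_self, inner_smul_right]
  let S : H₁ →L[ℂ] H₁ := (W η₀).adjoint ∘L T ∘L W η₀
  have hS : ∀ ξ ξ', ⟪ξ', S ξ⟫_ℂ = ⟪V ξ' η₀, T (V ξ η₀)⟫_ℂ := fun ξ ξ' => by
    change ⟪ξ', (W η₀).adjoint (T (W η₀ ξ))⟫_ℂ = _
    rw [ContinuousLinearMap.adjoint_inner_right, hVW, hVW]
  refine ⟨S, mem_of_forall_commute fun a ha => ?_, ?_⟩
  · refine ContinuousLinearMap.ext fun ξ => ext_inner_left ℂ fun ξ' => ?_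
    rw [mul_apply_eq_comp, mul_apply_eq_comp, hS, ← inner_star_left a ξ', hS, ← hL₁, ← hL₁,
      ← hstar₁, inner_star_left, ← mul_apply_eq_comp, ← mul_apply_eq_comp, (h₁ a ha).eq]
  · have key : ∀ ξ η, T (V ξ η) = L₁ S (V ξ η) := by
      intro ξ η
      refine htotal _ _ fun ξ' η' => ?_
      obtain ⟨c, hc⟩ := hslice ξ ξ'
      rw [hc, hL₁, hinner, hS, hc, hη₀', mul_one]
    -- Totality of the elementary tensors is available for the left slot of the inner product, so
    -- agreement on elementary tensors is used through adjoints.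
    rw [← star_inj]
    refine ContinuousLinearMap.ext fun x => htotal _ _ fun ξ η => ?_
    rw [inner_star_right, inner_star_right, key]

end VonNeumannAlgebra

/-! ### Elementary tensors and operators `x ⊗ y` -/

namespace HilbertTensor

open scoped InnerProductSpace

variable {H₁ H₂ : Type*} [NormedAddCommGroup H₁] [InnerProductSpace ℂ H₁]
  [NormedAddCommGroup H₂] [InnerProductSpace ℂ H₂]

/-- The elementary tensors, as a function of the second factor. -/
def tensorRight (ξ : H₁) : H₂ →L[ℂ] HilbertTensor H₁ H₂ :=
  UniformSpace.Completion.toComplL.comp (TensorProduct.mkL ℂ H₁ H₂ ξ)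

/-- The elementary tensors, as a function of the first factor. -/
def tensorLeft (η : H₂) : H₁ →L[ℂ] HilbertTensor H₁ H₂ :=
  UniformSpace.Completion.toComplL.comp ((TensorProduct.mkL ℂ H₁ H₂).flip η)

theorem tensorRight_apply (ξ : H₁) (η : H₂) :
    tensorRight ξ η = ((ξ ⊗ₜ[ℂ] η : H₁ ⊗[ℂ] H₂) : HilbertTensor H₁ H₂) := rfl

theorem tensorRight_eq_tensorLeft (ξ : H₁) (η : H₂) : tensorRight ξ η = tensorLeft η ξ := rfl

theorem inner_tensorRight (ξ ξ' : H₁) (η η' : H₂) :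
    ⟪tensorRight ξ η, tensorRight ξ' η'⟫_ℂ = ⟪ξ, ξ'⟫_ℂ * ⟪η, η'⟫_ℂ := by
  rw [tensorRight_apply, tensorRight_apply, UniformSpace.Completion.inner_coe,
    TensorProduct.inner_tmul]

theorem ext_inner {x y : HilbertTensor H₁ H₂}
    (h : ∀ ξ η, ⟪tensorRight ξ η, x⟫_ℂ = ⟪tensorRight ξ η, y⟫_ℂ) : x = y := by
  refine ext_inner_left ℂ fun v => ?_
  induction v using UniformSpace.Completion.induction_on with
  | hp => exact isClosed_eq (by fun_prop) (by fun_prop)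
  | ih v =>
    induction v using TensorProduct.induction_on with
    | zero => rw [UniformSpace.Completion.coe_zero, inner_zero_left, inner_zero_left]
    | tmul ξ η => exact h ξ η
    | add a b ha hb => rw [UniformSpace.Completion.coe_add, inner_add_left, inner_add_left, ha, hb]

theorem opTensor_tensorRight (x : H₁ →L[ℂ] H₁) (y : H₂ →L[ℂ] H₂) (ξ : H₁) (η : H₂) :
    opTensor x y (tensorRight ξ η) = tensorRight (x ξ) (y η) :=
  opTensor_tmul x y ξ η

theorem operator_ext {S T : HilbertTensor H₁ H₂ →L[ℂ] HilbertTensor H₁ H₂}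
    (h : ∀ ξ η, S (tensorRight ξ η) = T (tensorRight ξ η)) : S = T := by
  rw [← star_inj]
  refine ContinuousLinearMap.ext fun x => ext_inner fun ξ η => ?_
  rw [VonNeumannAlgebra.inner_star_right, VonNeumannAlgebra.inner_star_right, h]

theorem opTensor_mul (x x' : H₁ →L[ℂ] H₁) (y y' : H₂ →L[ℂ] H₂) :
    opTensor x y * opTensor x' y' = opTensor (x * x') (y * y') :=
  operator_ext fun ξ η => by
    simp only [mul_apply_eq_comp, opTensor_tensorRight]

theorem opTensor_one : opTensor (1 : H₁ →L[ℂ] H₁) (1 : H₂ →L[ℂ] H₂) = 1 :=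
  operator_ext fun ξ η => by simp only [opTensor_tensorRight, one_apply_eq_self]

theorem opTensor_smul_one (c : ℂ) (x : H₁ →L[ℂ] H₁) :
    opTensor (c • x) (1 : H₂ →L[ℂ] H₂) = c • opTensor x 1 :=
  operator_ext fun ξ η => by
    rw [smul_apply, opTensor_tensorRight, opTensor_tensorRight, smul_apply,
      tensorRight_eq_tensorLeft, tensorRight_eq_tensorLeft, map_smul]

theorem opTensor_one_smul (c : ℂ) (y : H₂ →L[ℂ] H₂) :
    opTensor (1 : H₁ →L[ℂ] H₁) (c • y) = c • opTensor 1 y :=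
  operator_ext fun ξ η => by
    simp only [opTensor_tensorRight, smul_apply, map_smul]

theorem commute_opTensor (x : H₁ →L[ℂ] H₁) (y : H₂ →L[ℂ] H₂) :
    Commute (opTensor x 1) (opTensor 1 y) := by
  rw [commute_iff_eq, opTensor_mul, opTensor_mul, one_mul, mul_one, one_mul, mul_one]

theorem star_opTensor [CompleteSpace H₁] [CompleteSpace H₂] (x : H₁ →L[ℂ] H₁) (y : H₂ →L[ℂ] H₂) :
    star (opTensor x y) = opTensor (star x) (star y) :=
  operator_ext fun ξ η => ext_inner fun ξ' η' => by
    rw [VonNeumannAlgebra.inner_star_right, opTensor_tensorRight, opTensor_tensorRight,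
      inner_tensorRight, inner_tensorRight, VonNeumannAlgebra.inner_star_right,
      VonNeumannAlgebra.inner_star_right]

theorem opTensor_left_injective [Nontrivial H₂] {x x' : H₁ →L[ℂ] H₁}
    (h : opTensor x (1 : H₂ →L[ℂ] H₂) = opTensor x' 1) : x = x' := by
  obtain ⟨η, hη⟩ := exists_ne (0 : H₂)
  refine ContinuousLinearMap.ext fun ξ => ext_inner_left ℂ fun ξ' => ?_
  have h1 : ⟪tensorRight ξ' η, opTensor x 1 (tensorRight ξ η)⟫_ℂ =
    ⟪tensorRight ξ' η, opTensor x' 1 (tensorRight ξ η)⟫_ℂ := by rw [h]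
  rw [opTensor_tensorRight, opTensor_tensorRight, inner_tensorRight, inner_tensorRight,
    one_apply_eq_self] at h1
  exact mul_right_cancel₀ (by simpa using hη) h1

theorem opTensor_right_injective [Nontrivial H₁] {y y' : H₂ →L[ℂ] H₂}
    (h : opTensor (1 : H₁ →L[ℂ] H₁) y = opTensor 1 y') : y = y' := by
  obtain ⟨ξ, hξ⟩ := exists_ne (0 : H₁)
  refine ContinuousLinearMap.ext fun η => ext_inner_left ℂ fun η' => ?_
  have h1 : ⟪tensorRight ξ η', opTensor 1 y (tensorRight ξ η)⟫_ℂ =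
    ⟪tensorRight ξ η', opTensor 1 y' (tensorRight ξ η)⟫_ℂ := by rw [h]
  rw [opTensor_tensorRight, opTensor_tensorRight, inner_tensorRight, inner_tensorRight,
    one_apply_eq_self] at h1
  exact mul_left_cancel₀ (by simpa using hξ) h1

theorem nontrivial_left [Nontrivial (HilbertTensor H₁ H₂)] : Nontrivial H₁ := by
  by_contra hn
  rw [not_nontrivial_iff_subsingleton] at hn
  obtain ⟨x, hx⟩ := exists_ne (0 : HilbertTensor H₁ H₂)
  exact hx (ext_inner fun ξ η => by
    rw [Subsingleton.elim ξ 0, tensorRight_eq_tensorLeft, map_zero, inner_zero_left,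
      inner_zero_left])

theorem nontrivial_right [Nontrivial (HilbertTensor H₁ H₂)] : Nontrivial H₂ := by
  by_contra hn
  rw [not_nontrivial_iff_subsingleton] at hn
  obtain ⟨x, hx⟩ := exists_ne (0 : HilbertTensor H₁ H₂)
  exact hx (ext_inner fun ξ η => by
    rw [Subsingleton.elim η 0, map_zero, inner_zero_left, inner_zero_left])

end HilbertTensor

/-! ### Relative commutants of the two tensor factors -/

namespace VonNeumannAlgebra

open HilbertTensor

variable {H₁ H₂ : Type*} [NormedAddCommGroup H₁] [InnerProductSpace ℂ H₁] [CompleteSpace H₁]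
  [NormedAddCommGroup H₂] [InnerProductSpace ℂ H₂] [CompleteSpace H₂]
  {M₁ : VonNeumannAlgebra H₁} {M₂ : VonNeumannAlgebra H₂}

theorem opTensor_mem_tensor {x : H₁ →L[ℂ] H₁} {y : H₂ →L[ℂ] H₂} (hx : x ∈ M₁) (hy : y ∈ M₂) :
    opTensor x y ∈ M₁.tensor M₂ :=
  subset_vonNeumannGenerate ⟨x, hx, y, hy, rfl⟩

theorem commute_of_mem_tensor {T Z : HilbertTensor H₁ H₂ →L[ℂ] HilbertTensor H₁ H₂}
    (hT : T ∈ M₁.tensor M₂) (hx : ∀ x ∈ M₁, Commute (opTensor x 1) Z)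
    (hy : ∀ y ∈ M₂, Commute (opTensor 1 y) Z) : Commute T Z := by
  refine commute_of_mem_vonNeumannGenerate ?_ hT ?_
  · rintro _ ⟨x, hx, y, hy, rfl⟩
    exact ⟨_, star_mem hx, _, star_mem hy, star_opTensor x y⟩
  · rintro _ ⟨x, hx', y, hy', rfl⟩
    have : opTensor x y = opTensor x 1 * opTensor 1 y := by
      rw [opTensor_mul, one_mul, mul_one]
    rw [this]
    exact (hx x hx').mul_left (hy y hy')

theorem commute_opTensor_commutant_left {T : HilbertTensor H₁ H₂ →L[ℂ] HilbertTensor H₁ H₂}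
    (hT : T ∈ M₁.tensor M₂) {a : H₁ →L[ℂ] H₁} (ha : a ∈ M₁.commutant) :
    Commute T (opTensor a 1) := by
  refine commute_of_mem_tensor hT (fun x hx => ?_) fun y _ => (commute_opTensor a y).symm
  rw [commute_iff_eq, opTensor_mul, opTensor_mul, (commute_of_mem_commutant hx ha).eq]

theorem commute_opTensor_commutant_right {T : HilbertTensor H₁ H₂ →L[ℂ] HilbertTensor H₁ H₂}
    (hT : T ∈ M₁.tensor M₂) {b : H₂ →L[ℂ] H₂} (hb : b ∈ M₂.commutant) :
    Commute T (opTensor 1 b) := by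
  refine commute_of_mem_tensor hT (fun x _ => commute_opTensor x b) fun y hy => ?_
  rw [commute_iff_eq, opTensor_mul, opTensor_mul, (commute_of_mem_commutant hy hb).eq]

/-- `(M₁ ⊗̄ M₂) ∩ (1 ⊗ M₂)' = M₁ ⊗ 1` for a factor `M₂`. -/
theorem exists_eq_opTensor_left (hM₂ : M₂.IsFactor)
    {T : HilbertTensor H₁ H₂ →L[ℂ] HilbertTensor H₁ H₂} (hT : T ∈ M₁.tensor M₂)
    (h : ∀ y ∈ M₂, Commute T (opTensor 1 y)) : ∃ x ∈ M₁, T = opTensor x 1 := by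
  refine exists_eq_amplification (H := HilbertTensor H₁ H₂) tensorRight tensorLeft
    tensorRight_eq_tensorLeft ?_ ?_ (fun a => opTensor a 1) (fun b => opTensor 1 b) ?_ ?_ ?_ ?_
    M₁ hM₂ ?_ h ?_
  · exact fun ξ η ξ' η' => inner_tensorRight ξ ξ' η η'
  · exact fun _ _ h => ext_inner h
  · intro a ξ η
    rw [opTensor_tensorRight, one_apply_eq_self]
  · intro b ξ η
    rw [opTensor_tensorRight, one_apply_eq_self]
  · intro a
    rw [star_opTensor, star_one]
  · intro b
    rw [star_opTensor, star_one]
  · exact fun _ ha => commute_opTensor_commutant_left hT ha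
  · exact fun _ hb => commute_opTensor_commutant_right hT hb

/-- `(M₁ ⊗̄ M₂) ∩ (M₁ ⊗ 1)' = 1 ⊗ M₂` for a factor `M₁`. -/
theorem exists_eq_opTensor_right (hM₁ : M₁.IsFactor)
    {T : HilbertTensor H₁ H₂ →L[ℂ] HilbertTensor H₁ H₂} (hT : T ∈ M₁.tensor M₂)
    (h : ∀ x ∈ M₁, Commute T (opTensor x 1)) : ∃ y ∈ M₂, T = opTensor 1 y := by
  -- The same slice argument with the factors exchanged; its abstract formulation avoids a flip
  -- isomorphism.
  refine exists_eq_amplification (H := HilbertTensor H₁ H₂) tensorLeft tensorRight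
    (fun η ξ => (tensorRight_eq_tensorLeft ξ η).symm) ?_ ?_ (fun b => opTensor 1 b)
    (fun a => opTensor a 1) ?_ ?_ ?_ ?_ M₂ hM₁ ?_ h ?_
  · intro η ξ η' ξ'
    rw [← tensorRight_eq_tensorLeft, ← tensorRight_eq_tensorLeft, inner_tensorRight, mul_comm]
  · exact fun _ _ h => ext_inner fun ξ η => h η ξ
  · intro b η ξ
    rw [← tensorRight_eq_tensorLeft, ← tensorRight_eq_tensorLeft, opTensor_tensorRight,
      one_apply_eq_self]
  · intro a η ξ
    rw [← tensorRight_eq_tensorLeft, ← tensorRight_eq_tensorLeft, opTensor_tensorRight,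
      one_apply_eq_self]
  · intro b
    rw [star_opTensor, star_one]
  · intro a
    rw [star_opTensor, star_one]
  · exact fun _ hb => commute_opTensor_commutant_right hT hb
  · exact fun _ ha => commute_opTensor_commutant_left hT ha

theorem isFactor_of_tensor_left (h : (M₁.tensor M₂).IsFactor) : M₁.IsFactor := by
  have hnt : Nontrivial (HilbertTensor H₁ H₂) := by
    by_contra hn
    rw [not_nontrivial_iff_subsingleton] at hn
    exact h.1 (ContinuousLinearMap.ext fun x => Subsingleton.elim _ _)
  have := nontrivial_left (H₁ := H₁) (H₂ := H₂)
  have := nontrivial_right (H₁ := H₁) (H₂ := H₂)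
  refine ⟨one_ne_zero, fun z hz hz' => ?_⟩
  obtain ⟨c, hc⟩ := h.2 (opTensor z 1) (opTensor_mem_tensor hz (one_mem _))
    (mem_commutant_iff.2 fun T hT => (commute_opTensor_commutant_left hT hz').eq)
  refine ⟨c, opTensor_left_injective (H₂ := H₂) ?_⟩
  rw [hc, opTensor_smul_one, opTensor_one]

theorem isFactor_of_tensor_right (h : (M₁.tensor M₂).IsFactor) : M₂.IsFactor := by
  have hnt : Nontrivial (HilbertTensor H₁ H₂) := by
    by_contra hn
    rw [not_nontrivial_iff_subsingleton] at hn
    exact h.1 (ContinuousLinearMap.ext fun x => Subsingleton.elim _ _)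
  have := nontrivial_left (H₁ := H₁) (H₂ := H₂)
  have := nontrivial_right (H₁ := H₁) (H₂ := H₂)
  refine ⟨one_ne_zero, fun z hz hz' => ?_⟩
  obtain ⟨c, hc⟩ := h.2 (opTensor 1 z) (opTensor_mem_tensor (one_mem _) hz)
    (mem_commutant_iff.2 fun T hT => (commute_opTensor_commutant_right hT hz').eq)
  refine ⟨c, opTensor_right_injective (H₁ := H₁) ?_⟩
  rw [hc, opTensor_one_smul, opTensor_one]

end VonNeumannAlgebra
end

noncomputable section

open scoped TensorProduct

/-! ### Primeness -/

namespace VonNeumannAlgebra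

variable {H K : Type*} [NormedAddCommGroup H] [InnerProductSpace ℂ H] [CompleteSpace H]
  [NormedAddCommGroup K] [InnerProductSpace ℂ K] [CompleteSpace K]

theorem commute_starProjection_of_invariant {a : K →L[ℂ] K} {E : Submodule ℂ K}
    [E.HasOrthogonalProjection] (h : ∀ ξ ∈ E, a ξ ∈ E) (h' : ∀ ξ ∈ E, star a ξ ∈ E) :
    Commute a E.starProjection := by
  have key : ∀ b : K →L[ℂ] K, (∀ ξ ∈ E, b ξ ∈ E) →
      E.starProjection * (b * E.starProjection) = b * E.starProjection := fun b hb => by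
    ext ξ
    exact Submodule.starProjection_eq_self_iff.2 (hb _ (E.starProjection_apply_mem ξ))
  have hs : star E.starProjection = E.starProjection :=
    (isStarProjection_starProjection (U := E)).isSelfAdjoint.star_eq
  have h1 : E.starProjection * a * E.starProjection = E.starProjection * a := by
    simpa [hs] using congrArg star (key (star a) h')
  rw [commute_iff_eq, ← key a h, ← h1, mul_assoc]

/-- The relative commutant `M ∩ S'` of a self-adjoint set `S`. -/
def relativeCommutant (M : VonNeumannAlgebra K) (S : Set (K →L[ℂ] K)) : VonNeumannAlgebra K :=
  (vonNeumannGenerate ((M.commutant : Set (K →L[ℂ] K)) ∪ S)).commutant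

theorem mem_relativeCommutant {M : VonNeumannAlgebra K} {S : Set (K →L[ℂ] K)}
    (hS : ∀ y ∈ S, star y ∈ S) {x : K →L[ℂ] K} :
    x ∈ M.relativeCommutant S ↔ x ∈ M ∧ ∀ y ∈ S, Commute y x := by
  rw [relativeCommutant, mem_commutant_vonNeumannGenerate]
  · constructor
    · exact fun h => ⟨mem_of_forall_commute fun y hy => (h y (Or.inl hy)).symm,
        fun y hy => h y (Or.inr hy)⟩
    · rintro ⟨h1, h2⟩ y (hy | hy)
      · exact (commute_of_mem_commutant h1 hy).symm
      · exact h2 y hy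
  · rintro y (hy | hy)
    · exact Or.inl (star_mem (S := VonNeumannAlgebra K) hy)
    · exact Or.inr (hS y hy)

/-- A factor isomorphic to a von Neumann algebra with a minimal projection is of type I. -/
theorem isTypeI_of_isMinimalProjection {M : VonNeumannAlgebra H} (hM : M.IsFactor)
    {N : VonNeumannAlgebra K} (f : M.toStarSubalgebra → K →L[ℂ] K) (hinj : Function.Injective f)
    (hmul : ∀ a b, f (a * b) = f a * f b) (hstar : ∀ a, f (star a) = star (f a))
    (hsmul : ∀ (c : ℂ) a, f (c • a) = c • f a) (hmem : ∀ a, f a ∈ N)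
    (hsurj : ∀ x ∈ N, ∃ a, f a = x) {p : K →L[ℂ] K} (hp : N.IsMinimalProjection p) :
    M.IsTypeI := by
  obtain ⟨a, rfl⟩ := hsurj p hp.1
  have haa : a * a = a := hinj (by rw [hmul]; exact hp.2.1.isIdempotentElem.eq)
  have hsa : star a = a := hinj (by rw [hstar]; exact hp.2.1.isSelfAdjoint.star_eq)
  have ha0 : a ≠ 0 := by
    rintro rfl
    refine hp.2.2.1 ?_
    rw [← zero_smul ℂ (0 : M.toStarSubalgebra), hsmul, zero_smul]
  have hcorner : ∀ x : M.toStarSubalgebra, ∃ c : ℂ, a * x * a = c • a := by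
    intro x
    obtain ⟨c, hc⟩ := hp.exists_smul (hmem x)
    exact ⟨c, hinj (by rw [hmul, hmul, hsmul, hc])⟩
  -- In a factor the only nonzero central projection is `1`, so the single projection `a`, whose
  -- corner is one-dimensional, suffices.
  intro z hz hz' hzp hz0
  obtain ⟨c, rfl⟩ := hM.2 z hz hz'
  have hc : c = 1 := by
    have h1 := hzp.isIdempotentElem.eq
    rw [smul_mul_smul_comm, one_mul, ← sub_eq_zero, ← sub_smul, smul_eq_zero] at h1
    have h2 : c * (c - 1) = 0 := by
      rw [mul_sub, mul_one]; exact h1.resolve_right hM.1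
    rcases mul_eq_zero.1 h2 with h3 | h3
    · rw [h3, zero_smul] at hz0
      exact absurd rfl hz0
    · exact sub_eq_zero.1 h3
  refine ⟨a.1, ⟨a.2, ⟨congrArg Subtype.val haa, congrArg Subtype.val hsa⟩,
    fun h => ha0 (Subtype.ext h), fun x hx y hy => ?_⟩, by rw [hc, one_smul, one_mul]⟩
  obtain ⟨c₁, h₁⟩ := hcorner ⟨x, hx⟩
  obtain ⟨c₂, h₂⟩ := hcorner ⟨y, hy⟩
  have h₁' : a.1 * x * a.1 = c₁ • a.1 := congrArg Subtype.val h₁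
  have h₂' : a.1 * y * a.1 = c₂ • a.1 := congrArg Subtype.val h₂
  rw [h₁', h₂', smul_mul_smul_comm, smul_mul_smul_comm, mul_comm c₁]

end VonNeumannAlgebra

namespace groupVonNeumannAlgebra

open EllTwo VonNeumannAlgebra
open scoped InnerProductSpace
open Filter Topology

variable {G : Type*} [Group G]

/-- A surjective representation `π : R → L(G)` cannot be such that the elements mapped into `L(H)`
generate `R`, if `H` is a proper subgroup. -/
theorem not_generates_of_supportedOn {K : Type*} [NormedAddCommGroup K] [InnerProductSpace ℂ K]
    [CompleteSpace K] {R : VonNeumannAlgebra K}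
    (π : R.toStarSubalgebra →⋆ₐ[ℂ] (EllTwo G →L[ℂ] EllTwo G)) (hinj : Function.Injective π)
    (hsurj : ∀ x ∈ groupVonNeumannAlgebra G, ∃ a, π a = x) {H : Subgroup G} (hne : H ≠ ⊤)
    {s : R.toStarSubalgebra} {ζ : K} (hs0 : s ≠ 0) (hs : SupportedOn H (π s))
    (hle : ∀ x : R.toStarSubalgebra, ‖π (x * s) (basisVec 1)‖ ≤ ‖(x * s : K →L[ℂ] K) ζ‖) :
    ¬ ∀ Z : K →L[ℂ] K,
      (∀ a : R.toStarSubalgebra, SupportedOn H (π a) → Commute a.1 Z) →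
        ∀ a : R.toStarSubalgebra, Commute a.1 Z := by
  intro hgen
  obtain ⟨g, hg⟩ : ∃ g, g ∉ H := by
    by_contra! h
    exact hne (eq_top_iff.2 fun g _ => h g)
  -- The cyclic subspace of `sζ` under the elements mapped into `L(H)`. If these generated `R`, the
  -- projection onto its closure would commute with all of `R`, so the closure would also contain `y
  -- sζ` for a preimage `y` of `λ_g` with `g ∉ H`.
  let E₀ : Submodule ℂ K :=
    { carrier := {ξ | ∃ a : R.toStarSubalgebra, SupportedOn H (π a) ∧ ξ = a.1 (s.1 ζ)}
      add_mem' := by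
        rintro _ _ ⟨a, ha, rfl⟩ ⟨b, hb, rfl⟩
        exact ⟨a + b, by rw [map_add]; exact ha.add hb, rfl⟩
      zero_mem' := ⟨0, by simpa using (hs.smul 0), rfl⟩
      smul_mem' := by
        rintro c _ ⟨a, ha, rfl⟩
        exact ⟨c • a, by rw [map_smul]; exact ha.smul c, rfl⟩ }
  let E := E₀.topologicalClosure
  have : CompleteSpace E := (Submodule.isClosed_topologicalClosure _).completeSpace_coe
  have hinv : ∀ a : R.toStarSubalgebra, SupportedOn H (π a) → ∀ ξ ∈ E, a.1 ξ ∈ E := by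
    intro a ha
    have h1 : E₀ ≤ E.comap (a.1 : K →ₗ[ℂ] K) := by
      rintro _ ⟨b, hb, rfl⟩
      exact Submodule.le_topologicalClosure _ ⟨a * b, by rw [map_mul]; exact ha.mul hb, rfl⟩
    exact fun ξ hξ => Submodule.topologicalClosure_minimal _ h1
      ((Submodule.isClosed_topologicalClosure _).preimage a.1.continuous) hξ
  have hcomm : ∀ a : R.toStarSubalgebra, Commute a.1 E.starProjection := by
    refine hgen _ fun a ha => ?_
    exact commute_starProjection_of_invariant (hinv a ha)
      (hinv (star a) (by rw [map_star]; exact ha.star))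
  obtain ⟨y, hy⟩ := hsurj _ (leftOp_mem g)
  have hsE : s.1 ζ ∈ E := Submodule.le_topologicalClosure _
    ⟨1, by rw [map_one]; exact one_supportedOn, rfl⟩
  have hyE : y.1 (s.1 ζ) ∈ E := by
    have h1 := DFunLike.congr_fun (hcomm y).eq (s.1 ζ)
    rw [mul_apply_eq_comp, mul_apply_eq_comp, Submodule.starProjection_eq_self_iff.2 hsE] at h1
    rw [h1]
    exact E.starProjection_apply_mem _
  have hts : π s ≠ 0 := fun h => hs0 (hinj (by rw [h, map_zero]))
  obtain ⟨h, hh⟩ := exists_apply_ne_zero hs.1 hts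
  have hhH := hs.mem_of_apply_ne_zero hh
  have hgh : g * h ∉ H := fun hc => hg (by simpa using H.mul_mem hc (H.inv_mem hhH))
  have hval : π (y * s) (basisVec 1) (g * h) = π s (basisVec 1) h := by
    rw [map_mul, hy, mul_apply_eq_comp, leftOp_apply, inv_mul_cancel_left]
  -- An approximation of `y sζ` by some `a sζ` transfers through `hle` to `ℓ²(G)`. There it fails at
  -- the coordinate `gh ∉ H`, where `π(as)δ₁` vanishes and `π(ys)δ₁` has the value of `π(s)δ₁` at
  -- `h`.
  obtain ⟨_, ⟨a, ha, rfl⟩, hdist⟩ := Metric.mem_closure_iff.1 hyE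
    ‖π s (basisVec 1) h‖ (norm_pos_iff.2 hh)
  have h1 : π ((y - a) * s) (basisVec 1) (g * h) = π s (basisVec 1) h := by
    rw [sub_mul, map_sub, sub_apply]
    change π (y * s) (basisVec 1) (g * h) - π (a * s) (basisVec 1) (g * h) = _
    rw [hval, map_mul π a s, (ha.mul hs).2 _ hgh, sub_zero]
  have h2 := (norm_apply_le _ (g * h)).trans (hle (y - a))
  rw [h1] at h2
  refine absurd hdist (not_lt.2 (h2.trans_eq ?_))
  rw [dist_eq_norm]
  rfl

/-- If `L(H)` contains a weakly null sequence of unitaries `u`, then it contains everything that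
commutes with `u`, for malnormal `H`. -/
theorem supportedOn_of_commute {H : Subgroup G} (hH : IsMalnormal H)
    {u : ℕ → EllTwo G →L[ℂ] EllTwo G} (hu : ∀ n, SupportedOn H (u n))
    (huU : ∀ n, u n ∈ unitary (EllTwo G →L[ℂ] EllTwo G))
    (hlim : ∀ η, Tendsto (fun n => ⟪u n (basisVec 1), η⟫_ℂ) atTop (𝓝 0))
    {x : EllTwo G →L[ℂ] EllTwo G} (hx : x ∈ groupVonNeumannAlgebra G)
    (hxu : ∀ n, Commute x (u n)) : SupportedOn H x :=
  supportedOn_of_intertwines hH hu huU hu huU hlim hx fun n => (hxu n).eq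

-- The copies of `M₁` and `M₂` in `L(G)` are obtained as relative commutants of each other. This
-- makes them von Neumann algebras on `ℓ²(G)` although the isomorphism is only algebraic. Without
-- minimal projections in either copy, the mixing argument puts both into one `L(H)`, contradicting
-- that together they generate the tensor product.
open HilbertTensor in
theorem isPrimeAlgebra {G : Type u} [Group G] (hG : HasMalnormalHulls G) :
    IsPrimeAlgebra.{u, w₁, w₂} (groupVonNeumannAlgebra G) := by
  intro H₁ _ _ _ H₂ _ _ _ M₁ M₂ ⟨φ⟩
  have hM := isFactor hG
  set M := groupVonNeumannAlgebra G with hMdef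
  set R := M₁.tensor M₂ with hR
  let π : R.toStarSubalgebra →⋆ₐ[ℂ] (EllTwo G →L[ℂ] EllTwo G) :=
    M.toStarSubalgebra.subtype.comp φ.symm.toStarAlgHom
  have hπ : ∀ a, π a = (φ.symm a).1 := fun a => rfl
  have hinj : Function.Injective π := fun a b h => φ.symm.injective (Subtype.ext h)
  have hπmem : ∀ a, π a ∈ M := fun a => (φ.symm a).2
  have hsurj : ∀ x ∈ M, ∃ a, π a = x := fun x hx => ⟨φ ⟨x, hx⟩, by rw [hπ]; simp⟩
  have hπcomm : ∀ a b, Commute (π a) (π b) → Commute a.1 b.1 := fun a b h => by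
    have : a * b = b * a := hinj (by rw [map_mul, map_mul]; exact h.eq)
    exact congrArg Subtype.val this
  have hπcomm' : ∀ a b : R.toStarSubalgebra, Commute a.1 b.1 → Commute (π a) (π b) :=
    fun a b h => by
      have : a * b = b * a := Subtype.ext h.eq
      rw [commute_iff_eq, ← map_mul, ← map_mul, this]
  have hRfac : R.IsFactor := by
    refine ⟨fun h => hM.1 ?_, fun z hz hz' => ?_⟩
    · rw [← map_one π, show (1 : R.toStarSubalgebra) = 0 from Subtype.ext h, map_zero]
    · obtain ⟨c, hc⟩ := hM.2 (π ⟨z, hz⟩) (hπmem _) (mem_commutant_iff.2 fun x hx => by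
        obtain ⟨a, rfl⟩ := hsurj x hx
        exact (hπcomm' _ _ (commute_of_mem_commutant a.2 hz')).eq)
      refine ⟨c, ?_⟩
      have : (⟨z, hz⟩ : R.toStarSubalgebra) = c • 1 := hinj (by rw [hc, map_smul, map_one])
      exact congrArg Subtype.val this
  have hfac₁ := isFactor_of_tensor_left hRfac
  have hfac₂ := isFactor_of_tensor_right hRfac
  have hnt : Nontrivial (HilbertTensor H₁ H₂) := by
    by_contra hn
    rw [not_nontrivial_iff_subsingleton] at hn
    exact hRfac.1 (ContinuousLinearMap.ext fun x => Subsingleton.elim _ _)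
  have := nontrivial_left (H₁ := H₁) (H₂ := H₂)
  have := nontrivial_right (H₁ := H₁) (H₂ := H₂)
  let l : M₁.toStarSubalgebra → R.toStarSubalgebra := fun x =>
    ⟨opTensor x.1 1, opTensor_mem_tensor x.2 (one_mem _)⟩
  let r : M₂.toStarSubalgebra → R.toStarSubalgebra := fun y =>
    ⟨opTensor 1 y.1, opTensor_mem_tensor (one_mem _) y.2⟩
  let N₁ := M.relativeCommutant (Set.range fun y => π (r y))
  let N₂ := M.relativeCommutant (Set.range fun x => π (l x))
  have hrstar : ∀ y, π (r (star y)) = star (π (r y)) := fun y => by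
    rw [← map_star]
    exact congrArg π (Subtype.ext (by simp [r, star_opTensor]))
  have hlstar : ∀ x, π (l (star x)) = star (π (l x)) := fun x => by
    rw [← map_star]
    exact congrArg π (Subtype.ext (by simp [l, star_opTensor]))
  have hlr : ∀ x y, Commute (π (l x)) (π (r y)) := fun x y => hπcomm' _ _ (commute_opTensor _ _)
  have hN₁ : ∀ x, x ∈ N₁ ↔ ∃ a, π (l a) = x := by
    intro x
    rw [mem_relativeCommutant (by rintro _ ⟨y, rfl⟩; exact ⟨star y, hrstar y⟩)]
    constructor
    · rintro ⟨hx, hcomm⟩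
      obtain ⟨a, rfl⟩ := hsurj x hx
      obtain ⟨b, hb, hab⟩ := exists_eq_opTensor_left hfac₂ a.2 fun y hy =>
        (hπcomm (r ⟨y, hy⟩) a (hcomm _ ⟨⟨y, hy⟩, rfl⟩)).symm
      exact ⟨⟨b, hb⟩, congrArg π (Subtype.ext hab.symm)⟩
    · rintro ⟨a, rfl⟩
      exact ⟨hπmem _, by rintro _ ⟨y, rfl⟩; exact (hlr a y).symm⟩
  have hN₂ : ∀ x, x ∈ N₂ ↔ ∃ b, π (r b) = x := by
    intro x
    rw [mem_relativeCommutant (by rintro _ ⟨y, rfl⟩; exact ⟨star y, hlstar y⟩)]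
    constructor
    · rintro ⟨hx, hcomm⟩
      obtain ⟨a, rfl⟩ := hsurj x hx
      obtain ⟨b, hb, hab⟩ := exists_eq_opTensor_right hfac₁ a.2 fun y hy =>
        (hπcomm (l ⟨y, hy⟩) a (hcomm _ ⟨⟨y, hy⟩, rfl⟩)).symm
      exact ⟨⟨b, hb⟩, congrArg π (Subtype.ext hab.symm)⟩
    · rintro ⟨b, rfl⟩
      exact ⟨hπmem _, by rintro _ ⟨y, rfl⟩; exact hlr y b⟩
  by_cases hmin₁ : ∃ p, N₁.IsMinimalProjection p
  · obtain ⟨p, hp⟩ := hmin₁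
    refine Or.inl (isTypeI_of_isMinimalProjection hfac₁ (fun x => π (l x)) (fun a b h => ?_)
      (fun a b => ?_) hlstar (fun c a => ?_) (fun a => (hN₁ _).2 ⟨a, rfl⟩)
      (fun x hx => (hN₁ x).1 hx) hp)
    · exact Subtype.ext (opTensor_left_injective (congrArg Subtype.val (hinj h)))
    · rw [← map_mul]
      exact congrArg π (Subtype.ext (by simp [l, opTensor_mul]))
    · rw [← map_smul]
      exact congrArg π (Subtype.ext (opTensor_smul_one c a.1))
  by_cases hmin₂ : ∃ p, N₂.IsMinimalProjection p
  · obtain ⟨p, hp⟩ := hmin₂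
    refine Or.inr (isTypeI_of_isMinimalProjection hfac₂ (fun x => π (r x)) (fun a b h => ?_)
      (fun a b => ?_) hrstar (fun c a => ?_) (fun a => (hN₂ _).2 ⟨a, rfl⟩)
      (fun x hx => (hN₂ x).1 hx) hp)
    · exact Subtype.ext (opTensor_right_injective (congrArg Subtype.val (hinj h)))
    · rw [← map_mul]
      exact congrArg π (Subtype.ext (by simp [r, opTensor_mul]))
    · rw [← map_smul]
      exact congrArg π (Subtype.ext (opTensor_one_smul c a.1))
  exfalso
  obtain ⟨u, hu, huU, hulim⟩ :=
    exists_unitary_tendsto_inner_zero (not_exists.1 hmin₁) (basisVec (1 : G))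
  obtain ⟨v, hv, hvU, hvlim⟩ :=
    exists_unitary_tendsto_inner_zero (not_exists.1 hmin₂) (basisVec (1 : G))
  obtain ⟨s, ζ, hs0, hle⟩ := exists_norm_representation_le R π (basisVec (1 : G))
  choose a ha using fun n => (hN₁ _).1 (hu n)
  choose b hb using fun n => (hN₂ _).1 (hv n)
  -- The hull has to contain `π s` as well, for the comparison of vector states that replaces
  -- normality.
  obtain ⟨H, hH, hne, hsupp⟩ := exists_supportedOn hG
    (Sum.elim u (Sum.elim v fun _ : Unit => π s)) (by
      rintro (n | n | n)
      · exact (ha n).subst (motive := (· ∈ M)) (hπmem _)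
      · exact (hb n).subst (motive := (· ∈ M)) (hπmem _)
      · exact hπmem _)
  have hl : ∀ x, SupportedOn H (π (l x)) := fun x =>
    supportedOn_of_commute hH (fun n => hsupp (.inr (.inl n))) hvU hvlim (hπmem _) fun n => by
      change Commute _ (v n)
      rw [← hb n]
      exact hlr x (b n)
  have hr : ∀ y, SupportedOn H (π (r y)) := fun y =>
    supportedOn_of_commute hH (fun n => hsupp (.inl n)) huU hulim (hπmem _) fun n => by
      change Commute _ (u n)
      rw [← ha n]
      exact (hlr (a n) y).symm
  refine not_generates_of_supportedOn π hinj hsurj hne hs0 (hsupp (.inr (.inr ()))) hle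
    fun Z hZ c => commute_of_mem_tensor c.2 (fun x hx => ?_) fun y hy => ?_
  · exact hZ (l ⟨x, hx⟩) (hl _)
  · exact hZ (r ⟨y, hy⟩) (hr _)

end groupVonNeumannAlgebra
end

noncomputable section

/-! ### Regular abelian subalgebras -/

namespace VonNeumannAlgebra

variable {K : Type*} [NormedAddCommGroup K] [InnerProductSpace ℂ K] [CompleteSpace K]

theorem mul_mem_normalizerOf {M : VonNeumannAlgebra K}
    {A : NonUnitalStarSubalgebra ℂ (K →L[ℂ] K)} {u v : K →L[ℂ] K} (hu : u ∈ M.normalizerOf A)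
    (hv : v ∈ M.normalizerOf A) : u * v ∈ M.normalizerOf A := by
  refine ⟨mul_mem hu.1 hv.1, mul_mem hu.2.1 hv.2.1, ?_⟩
  have : (fun a => u * v * a * star (u * v)) = (fun a => u * a * star u) ∘
      fun a => v * a * star v := by
    ext1 a
    simp [mul_assoc]
  rw [this, Set.image_comp, hv.2.2, hu.2.2]

theorem star_mem_normalizerOf {M : VonNeumannAlgebra K}
    {A : NonUnitalStarSubalgebra ℂ (K →L[ℂ] K)} {u : K →L[ℂ] K} (hu : u ∈ M.normalizerOf A) :
    star u ∈ M.normalizerOf A := by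
  refine ⟨star_mem hu.1, Unitary.star_mem hu.2.1, ?_⟩
  conv_lhs => rw [← hu.2.2]
  rw [← Set.image_comp]
  convert Set.image_id _ using 2
  ext1 a
  have h := Unitary.star_mul_self_of_mem hu.2.1
  simp only [Function.comp_apply, star_star, id]
  rw [mul_assoc, mul_assoc, h, mul_one, ← mul_assoc, h, one_mul]

/-- Conjugation by a unitary normalizing `A` preserves `A'` and hence `A''`. -/
theorem conj_mem_of_mem_normalizerOf {M : VonNeumannAlgebra K}
    {A : NonUnitalStarSubalgebra ℂ (K →L[ℂ] K)} {u : K →L[ℂ] K} (hu : u ∈ M.normalizerOf A)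
    {x : K →L[ℂ] K} (hx : x ∈ vonNeumannGenerate (A : Set (K →L[ℂ] K))) :
    u * x * star u ∈ vonNeumannGenerate (A : Set (K →L[ℂ] K)) := by
  have hA : ∀ y ∈ (A : Set (K →L[ℂ] K)), star y ∈ (A : Set (K →L[ℂ] K)) := fun y hy =>
    star_mem (S := NonUnitalStarSubalgebra ℂ (K →L[ℂ] K)) hy
  have h1 := Unitary.star_mul_self_of_mem hu.2.1
  have h2 := Unitary.mul_star_self_of_mem hu.2.1
  refine mem_of_forall_commute fun y hy => ?_
  have hcomm : Commute x (star u * y * u) := by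
    refine commute_of_mem_vonNeumannGenerate hA hx fun a ha => ?_
    have h3 : u * a * star u ∈ (A : Set (K →L[ℂ] K)) := hu.2.2 ▸ ⟨a, ha, rfl⟩
    have h4 := ((mem_commutant_vonNeumannGenerate hA).1 hy _ h3).eq
    calc a * (star u * y * u) = star u * (u * a * star u * y) * u := by
          simp only [← mul_assoc]; rw [h1, one_mul]
      _ = star u * (y * (u * a * star u)) * u := by rw [h4]
      _ = star u * y * u * a := by
          simp only [mul_assoc]; rw [h1, mul_one]
  calc u * x * star u * y = u * (x * (star u * y * u)) * star u := by
        simp only [mul_assoc]; rw [h2, mul_one]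
    _ = u * (star u * y * u * x) * star u := by rw [hcomm.eq]
    _ = y * (u * x * star u) := by
        simp only [← mul_assoc]; rw [h2, one_mul]

theorem IsMinimalProjection.conj {M : VonNeumannAlgebra K}
    {A : NonUnitalStarSubalgebra ℂ (K →L[ℂ] K)} {u p : K →L[ℂ] K} (hu : u ∈ M.normalizerOf A)
    (hp : (vonNeumannGenerate (A : Set (K →L[ℂ] K))).IsMinimalProjection p) :
    (vonNeumannGenerate (A : Set (K →L[ℂ] K))).IsMinimalProjection (u * p * star u) := by
  have h1 := Unitary.star_mul_self_of_mem hu.2.1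
  have h2 := Unitary.mul_star_self_of_mem hu.2.1
  have hpp : p * p = p := hp.2.1.isIdempotentElem.eq
  have hback : ∀ x : K →L[ℂ] K, u * (star u * x * u) * star u = x := fun x => by
    simp only [mul_assoc]; rw [h2, mul_one, ← mul_assoc, h2, one_mul]
  have hback' : ∀ x : K →L[ℂ] K, star u * (u * x * star u) * u = x := fun x => by
    simp only [mul_assoc]; rw [h1, mul_one, ← mul_assoc, h1, one_mul]
  refine ⟨conj_mem_of_mem_normalizerOf hu hp.1, ⟨?_, ?_⟩, fun h => hp.2.2.1 ?_,
    fun q hq hqp hpq => ?_⟩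
  · change u * p * star u * (u * p * star u) = u * p * star u
    calc u * p * star u * (u * p * star u) = u * (p * (star u * u) * p) * star u := by
          simp only [mul_assoc]
      _ = _ := by rw [h1, mul_one, hpp]
  · rw [isSelfAdjoint_iff]
    simp [hp.2.1.isSelfAdjoint.star_eq, mul_assoc]
  · rw [← hback' p, h, mul_zero, zero_mul]
  · have hq' : star u * q * u ∈ vonNeumannGenerate (A : Set (K →L[ℂ] K)) := by
      simpa using conj_mem_of_mem_normalizerOf (star_mem_normalizerOf hu) hq
    have hproj : IsStarProjection (star u * q * u) := by
      refine ⟨?_, ?_⟩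
      · change star u * q * u * (star u * q * u) = star u * q * u
        calc star u * q * u * (star u * q * u) = star u * (q * (u * star u) * q) * u := by
              simp only [mul_assoc]
          _ = _ := by rw [h2, mul_one, hqp.isIdempotentElem.eq]
      · rw [isSelfAdjoint_iff]
        simp [hqp.isSelfAdjoint.star_eq, mul_assoc]
    have hle : p * (star u * q * u) = star u * q * u := by
      have h3 : star u * (u * p * star u * q) * u = p * (star u * q * u) := by
        simp only [← mul_assoc]; rw [h1, one_mul]
      rw [← h3, hpq]
    rcases hp.2.2.2 _ hq' hproj hle with h | h
    · left; rw [← hback q, h, mul_zero, zero_mul]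
    · right; rw [← hback q, h]

/-- When `p` and `q` commute, `pq` is a subprojection of both; if it is nonzero, it equals each of
them. -/
theorem IsMinimalProjection.mul_eq_zero {N : VonNeumannAlgebra K} {p q : K →L[ℂ] K}
    (hp : N.IsMinimalProjection p) (hq : N.IsMinimalProjection q) (hpq : Commute p q)
    (hne : p ≠ q) : p * q = 0 := by
  have h1 : IsStarProjection (p * q) := hp.2.1.mul hq.2.1 hpq
  have hm := mul_mem hp.1 hq.1
  have e1 : p * (p * q) = p * q := by rw [← mul_assoc, hp.2.1.isIdempotentElem.eq]
  have e2 : q * (p * q) = p * q := by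
    rw [hpq.eq, ← mul_assoc, hq.2.1.isIdempotentElem.eq]
  rcases hp.2.2.2 _ hm h1 e1 with h | h
  · exact h
  rcases hq.2.2.2 _ hm h1 e2 with h' | h'
  · exact h'
  · exact absurd (h.symm.trans h') hne

theorem isStarProjection_sum {F : Finset (K →L[ℂ] K)} (hF : ∀ p ∈ F, IsStarProjection p)
    (horth : ∀ p ∈ F, ∀ q ∈ F, p ≠ q → p * q = 0) : IsStarProjection (∑ p ∈ F, p) := by
  classical
  refine ⟨?_, ?_⟩
  · change (∑ p ∈ F, p) * (∑ p ∈ F, p) = ∑ p ∈ F, p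
    rw [Finset.sum_mul_sum]
    refine Finset.sum_congr rfl fun p hp => ?_
    rw [Finset.sum_eq_single p (fun q hq hne => horth p hp q hq hne.symm) (fun h => absurd hp h)]
    exact (hF p hp).isIdempotentElem.eq
  · rw [isSelfAdjoint_iff, star_sum]
    exact Finset.sum_congr rfl fun p hp => (hF p hp).isSelfAdjoint.star_eq

end VonNeumannAlgebra

/-! ### Orbits of minimal projections and the diffuse case -/

namespace groupVonNeumannAlgebra

open EllTwo VonNeumannAlgebra
open scoped InnerProductSpace
open Filter Topology

variable {G : Type*} [Group G]

/-- Pairwise orthogonal projections of the same positive trace are finite in number. -/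
theorem finite_of_orthogonal {O : Set (EllTwo G →L[ℂ] EllTwo G)}
    (hO : ∀ p ∈ O, IsStarProjection p) (horth : ∀ p ∈ O, ∀ q ∈ O, p ≠ q → p * q = 0) {c : ℝ}
    (hc : 0 < c) (hnorm : ∀ p ∈ O, ‖p (basisVec 1)‖ = c) : O.Finite := by
  by_contra hinf
  -- Each projection has trace `‖p δ₁‖² = c²`, so a sum of `n` of them would be a projection of
  -- trace `nc² > 1`.
  obtain ⟨n, hn⟩ := exists_nat_gt (1 / c ^ 2)
  obtain ⟨F, hFO, hcard⟩ := Set.Infinite.exists_subset_card_eq hinf n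
  have hP := isStarProjection_sum (F := F) (fun p hp => hO p (hFO hp))
    fun p hp q hq => horth p (hFO hp) q (hFO hq)
  have hsq : ∀ {p : EllTwo G →L[ℂ] EllTwo G}, IsStarProjection p →
      ⟪basisVec 1, p (basisVec 1)⟫_ℂ = ((‖p (basisVec 1)‖ ^ 2 : ℝ) : ℂ) := by
    intro p hp
    conv_lhs => rw [← hp.isIdempotentElem.eq]
    rw [mul_apply_eq_comp, ← VonNeumannAlgebra.inner_star_left, hp.isSelfAdjoint.star_eq,
      inner_self_eq_norm_sq_to_K]
    simp
  have h1 := hsq hP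
  have h2 : ⟪basisVec (1 : G), (∑ p ∈ F, p) (basisVec 1)⟫_ℂ = ((n * c ^ 2 : ℝ) : ℂ) := by
    rw [sum_apply, inner_sum, Finset.sum_congr rfl fun p hp => hsq (hO p (hFO hp)),
      Finset.sum_congr rfl fun p hp => by rw [hnorm p (hFO hp)], Finset.sum_const, hcard]
    simp
  rw [h2] at h1
  have h3 : (n : ℝ) * c ^ 2 = ‖(∑ p ∈ F, p) (basisVec (1 : G))‖ ^ 2 := by exact_mod_cast h1
  have h4 : ‖(∑ p ∈ F, p) (basisVec (1 : G))‖ ≤ 1 := by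
    have := (∑ p ∈ F, p).le_of_opNorm_le (IsStarProjection.norm_le _ hP) (basisVec (1 : G))
    simpa [norm_basisVec] using this
  have h5 : (n : ℝ) * c ^ 2 ≤ 1 := by
    rw [h3]; exact pow_le_one₀ (norm_nonneg _) h4
  rw [div_lt_iff₀ (by positivity)] at hn
  linarith


/-- In a factor `L(G)`, a regular abelian subalgebra whose generated von Neumann algebra has a
minimal projection is finite dimensional. -/
theorem finiteDimensional_of_isMinimalProjection (hM : (groupVonNeumannAlgebra G).IsFactor)
    {A : NonUnitalStarSubalgebra ℂ (EllTwo G →L[ℂ] EllTwo G)}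
    (hAM : ∀ x ∈ vonNeumannGenerate (A : Set (EllTwo G →L[ℂ] EllTwo G)),
      x ∈ groupVonNeumannAlgebra G)
    (hab : ∀ x ∈ vonNeumannGenerate (A : Set (EllTwo G →L[ℂ] EllTwo G)),
      ∀ y ∈ vonNeumannGenerate (A : Set (EllTwo G →L[ℂ] EllTwo G)), Commute x y)
    (hreg : (groupVonNeumannAlgebra G).IsRegular A) {p : EllTwo G →L[ℂ] EllTwo G}
    (hp : (vonNeumannGenerate (A : Set (EllTwo G →L[ℂ] EllTwo G))).IsMinimalProjection p) :
    FiniteDimensional ℂ A := by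
  classical
  let O : Set (EllTwo G →L[ℂ] EllTwo G) :=
    (fun u => u * p * star u) '' (groupVonNeumannAlgebra G).normalizerOf A
  have hOmin : ∀ q ∈ O, (vonNeumannGenerate (A : Set (EllTwo G →L[ℂ] EllTwo G))).IsMinimalProjection
      q := by
    rintro _ ⟨u, hu, rfl⟩
    exact hp.conj hu
  have horth : ∀ q ∈ O, ∀ r ∈ O, q ≠ r → q * r = 0 := fun q hq r hr hne =>
    (hOmin q hq).mul_eq_zero (hOmin r hr) (hab q (hOmin q hq).1 r (hOmin r hr).1) hne
  have hc : 0 < ‖p (basisVec 1)‖ :=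
    norm_pos_iff.2 fun h => hp.2.2.1 (eq_zero_of_apply_eq_zero (hAM p hp.1) h)
  have hnorm : ∀ q ∈ O, ‖q (basisVec 1)‖ = ‖p (basisVec 1)‖ := by
    rintro _ ⟨u, hu, rfl⟩
    have hup : u * p ∈ groupVonNeumannAlgebra G := mul_mem hu.1 (hAM p hp.1)
    have h1 : p * star u = star (u * p) := by rw [star_mul, hp.2.1.isSelfAdjoint.star_eq]
    change ‖(u * p * star u) (basisVec 1)‖ = _
    rw [mul_assoc, mul_apply_eq_comp, norm_apply_of_mem_unitary hu.2.1, h1,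
      star_apply_eq_modularConj hup, norm_modularConj, mul_apply_eq_comp,
      norm_apply_of_mem_unitary hu.2.1]
  have hfin : O.Finite := finite_of_orthogonal (fun q hq => (hOmin q hq).2.1) horth hc hnorm
  have hpO : p ∈ O := ⟨1, ⟨one_mem _, one_mem _, by simp⟩, by simp⟩
  -- The normalizer permutes the orbit, so `s` commutes with it, hence by regularity with `L(G)`.
  -- Thus `s` is scalar, and `sp = p` gives `s = 1`.
  let s : EllTwo G →L[ℂ] EllTwo G := ∑ q ∈ hfin.toFinset, q
  have hsM : s ∈ groupVonNeumannAlgebra G :=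
    sum_mem fun q hq => hAM q (hOmin q (hfin.mem_toFinset.1 hq)).1
  have hsN : s ∈ ((groupVonNeumannAlgebra G).normalizerOf A).centralizer := by
    intro v hv
    have h1 := Unitary.star_mul_self_of_mem hv.2.1
    have h2 := Unitary.mul_star_self_of_mem hv.2.1
    have hconj : ∀ w ∈ (groupVonNeumannAlgebra G).normalizerOf A, ∀ q ∈ O,
        w * q * star w ∈ O := by
      rintro w hw _ ⟨u, hu, rfl⟩
      exact ⟨w * u, mul_mem_normalizerOf hw hu, by simp [mul_assoc]⟩
    have hs : v * s * star v = s := by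
      simp only [s, Finset.mul_sum, Finset.sum_mul]
      refine Finset.sum_bij' (fun q _ => v * q * star v) (fun q _ => star v * q * v)
        (fun q hq => ?_) (fun q hq => ?_) (fun q _ => ?_) (fun q _ => ?_) (fun q _ => rfl)
      · exact hfin.mem_toFinset.2 (hconj v hv q (hfin.mem_toFinset.1 hq))
      · have := hconj _ (star_mem_normalizerOf hv) q (hfin.mem_toFinset.1 hq)
        rw [star_star] at this
        exact hfin.mem_toFinset.2 this
      · simp only [mul_assoc]; rw [h1, mul_one, ← mul_assoc, h1, one_mul]
      · simp only [mul_assoc]; rw [h2, mul_one, ← mul_assoc, h2, one_mul]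
    calc v * s = v * s * (star v * v) := by rw [h1, mul_one]
      _ = v * s * star v * v := by simp only [mul_assoc]
      _ = s * v := by rw [hs]
  obtain ⟨c, hsc⟩ := hM.2 s hsM (mem_commutant_iff.2 fun x hx => by
    rw [← SetLike.mem_coe, ← hreg] at hx
    exact (hx s hsN).symm)
  have hsp : s * p = p := by
    simp only [s, Finset.sum_mul]
    rw [Finset.sum_eq_single p (fun q hq hne => horth q (hfin.mem_toFinset.1 hq) p hpO hne)
      fun h => absurd (hfin.mem_toFinset.2 hpO) h]
    exact hp.2.1.isIdempotentElem.eq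
  have hs1 : s = 1 := by
    have h1 : (c - 1) • p = 0 := by
      rw [sub_smul, one_smul, sub_eq_zero, ← smul_one_mul, ← hsc, hsp]
    have h2 : c = 1 := sub_eq_zero.1 ((smul_eq_zero.1 h1).resolve_right hp.2.2.1)
    rw [hsc, h2, one_smul]
  -- Since the orbit sums to `1`, `x` is the sum of the `xq = qxq`, and each of these is a multiple
  -- of `q` by minimality.
  have hspan : ∀ x ∈ A, x ∈ Submodule.span ℂ O := by
    intro x hx
    have hxN : x ∈ vonNeumannGenerate (A : Set (EllTwo G →L[ℂ] EllTwo G)) :=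
      subset_vonNeumannGenerate hx
    rw [← mul_one x, ← hs1, Finset.mul_sum]
    refine Submodule.sum_mem _ fun q hq => ?_
    have hqO := hfin.mem_toFinset.1 hq
    obtain ⟨c, hc⟩ := (hOmin q hqO).exists_smul hxN
    have : x * q = c • q := by
      rw [← hc, ← (hab x hxN q (hOmin q hqO).1).eq, mul_assoc,
        (hOmin q hqO).2.1.isIdempotentElem.eq]
    rw [this]
    exact Submodule.smul_mem _ _ (Submodule.subset_span hqO)
  have : FiniteDimensional ℂ (Submodule.span ℂ O) := FiniteDimensional.span_of_finite ℂ hfin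
  exact Submodule.finiteDimensional_of_le (S₁ := A.toNonUnitalSubalgebra.toSubmodule) hspan

/-- If `A''` has no minimal projection, a weakly null sequence of its unitaries lies in `L(H)` for a
proper malnormal `H`. By commutativity `A''` lies in `L(H)`. A normalizing unitary `x` satisfies `x
u_n = (x u_n x*) x` with `x u_n x* ∈ A''`, so it lies in `L(H)` too, and regularity then forces `H =
G`. -/
theorem finiteDimensional_of_isRegular (hG : HasMalnormalHulls G)
    {A : NonUnitalStarSubalgebra ℂ (EllTwo G →L[ℂ] EllTwo G)}
    (hA : (A : Set (EllTwo G →L[ℂ] EllTwo G)) ⊆ groupVonNeumannAlgebra G)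
    (hab : ∀ x ∈ A, ∀ y ∈ A, x * y = y * x) (hreg : (groupVonNeumannAlgebra G).IsRegular A) :
    FiniteDimensional ℂ A := by
  classical
  have hstar : ∀ y ∈ (A : Set (EllTwo G →L[ℂ] EllTwo G)),
      star y ∈ (A : Set (EllTwo G →L[ℂ] EllTwo G)) := fun y hy =>
    star_mem (S := NonUnitalStarSubalgebra ℂ (EllTwo G →L[ℂ] EllTwo G)) hy
  have hNM : ∀ x ∈ vonNeumannGenerate (A : Set (EllTwo G →L[ℂ] EllTwo G)),
      x ∈ groupVonNeumannAlgebra G := fun x hx => mem_of_forall_commute fun y hy =>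
    commute_of_mem_vonNeumannGenerate hstar hx fun a ha => commute_of_mem_commutant (hA ha) hy
  have hNab : ∀ x ∈ vonNeumannGenerate (A : Set (EllTwo G →L[ℂ] EllTwo G)),
      ∀ y ∈ vonNeumannGenerate (A : Set (EllTwo G →L[ℂ] EllTwo G)), Commute x y :=
    fun x hx y hy => commute_of_mem_vonNeumannGenerate hstar hx fun a ha =>
      (commute_of_mem_vonNeumannGenerate hstar hy fun b hb => hab b hb a ha).symm
  by_cases hmin : ∃ p, (vonNeumannGenerate
      (A : Set (EllTwo G →L[ℂ] EllTwo G))).IsMinimalProjection p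
  · obtain ⟨p, hp⟩ := hmin
    exact finiteDimensional_of_isMinimalProjection (isFactor hG) hNM hNab hreg hp
  exfalso
  obtain ⟨u, hu, huU, hulim⟩ :=
    exists_unitary_tendsto_inner_zero (not_exists.1 hmin) (basisVec (1 : G))
  obtain ⟨H, hH, hHne, hHu⟩ := exists_supportedOn hG u fun n => hNM _ (hu n)
  have hN : ∀ x ∈ vonNeumannGenerate (A : Set (EllTwo G →L[ℂ] EllTwo G)), SupportedOn H x :=
    fun x hx => supportedOn_of_commute hH hHu huU hulim (hNM x hx) fun n => hNab x hx _ (hu n)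
  have hnorm : ∀ x ∈ (groupVonNeumannAlgebra G).normalizerOf A, SupportedOn H x := fun x hx =>
    supportedOn_of_intertwines hH hHu huU
      (fun n => hN _ (conj_mem_of_mem_normalizerOf hx (hu n)))
      (fun n => mul_mem (mul_mem hx.2.1 (huU n)) (Unitary.star_mem hx.2.1)) hulim hx.1 fun n => by
        rw [mul_assoc (x * u n), Unitary.star_mul_self_of_mem hx.2.1, mul_one]
  obtain ⟨g, hg⟩ : ∃ g, g ∉ H := by
    by_contra! h
    exact hHne ((Subgroup.eq_top_iff' H).2 h)
  have h1 : SupportedOn H (leftOp g) :=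
    .of_mem_bicommutant hnorm (by rw [hreg]; exact leftOp_mem g)
  have h2 := h1.2 g hg
  rw [leftOp_basisVec_one, basisVec_apply, if_pos rfl] at h2
  exact one_ne_zero h2

end groupVonNeumannAlgebra
end

theorem proposition5p1 (α : Ordinal.{u}) (hlim : Order.IsSuccLimit α)
    (hcof : Cardinal.aleph0 < α.cof) (Γ : Set.Iio α → Type v) [∀ β, Group (Γ β)]
    (hnontrivial : ∀ β, Nontrivial (Γ β))
    (htorsionfree : ∀ β, ∀ g : Γ β, g ≠ 1 → ¬ IsOfFinOrder g) :
    (groupVonNeumannAlgebra (IteratedWreath Γ)).IsIIOneFactor ∧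
    VonNeumannAlgebra.IsPrimeAlgebra.{max (u + 1) v, w₁, w₂}
      (groupVonNeumannAlgebra (IteratedWreath Γ)) ∧
    ¬ ∃ A : NonUnitalStarSubalgebra ℂ (EllTwo (IteratedWreath Γ) →L[ℂ] EllTwo (IteratedWreath Γ)),
      (A : Set (EllTwo (IteratedWreath Γ) →L[ℂ] EllTwo (IteratedWreath Γ))) ⊆
        groupVonNeumannAlgebra (IteratedWreath Γ) ∧
      (∀ x ∈ A, ∀ y ∈ A, x * y = y * x) ∧
      (groupVonNeumannAlgebra (IteratedWreath Γ)).IsRegular A ∧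
      ¬ FiniteDimensional ℂ A := by
  have hG := IteratedWreath.hasMalnormalHulls Γ hlim hcof hnontrivial htorsionfree
  refine ⟨groupVonNeumannAlgebra.isIIOneFactor hG, groupVonNeumannAlgebra.isPrimeAlgebra hG, ?_⟩
  rintro ⟨A, hA, hab, hreg, hinf⟩
  exact hinf (groupVonNeumannAlgebra.finiteDimensional_of_isRegular hG hA hab hreg)
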